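/- Let $n,k$ be integers with $1\le k\le n$, let $\Omega\subset\mathbb R^n$ be a bounded domain (nonempty, open, connected), let $\alpha>0$, and let $f=f(x,z,p)$ be a positive function in $C^{1,1}(\overline\Omega\times\mathbb R\times\mathbb R^n)$, i.e. $f>0$ is continuous on $\overline\Omega\times\mathbb R\times\mathbb R^n$ and continuously differentiable in $\Omega\times\mathbb R\times\mathbb R^n$, with first derivatives that are Lipschitz on every bounded subset of $\Omega\times\mathbb R\times\mathbb R^n$. For $\lambda\in\mathbb R^n$ put $\sigma_0(\lambda)=1$ and $\sigma_m(\lambda)=\sum_{1\le i_1<\dots<i_m\le n}\lambda_{i_1}\cdots\lambda_{i_m}$ for $m\ge1$, and let $\sigma_m(D^2u)$ be $\sigma_m$ of the eigenvalues of the Hessian $D^2u$. Put $\Gamma_k=\{\lambda\in\mathbb R^n:\sigma_m(\lambda)>0,\ m=1,\dots,k\}$. A function $u\in C^2(\Omega)$ is called $k$-convex if the eigenvalues of $D^2u(x)$ belong to $\Gamma_k$ for every $x\in\Omega$. Then for all real $M_0,M_1$ there is a constant $C>0$, depending only on $n$, $k$, $\Omega$, $\alpha$, $f$, $M_0$ and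 $M_1$, such that every $k$-convex solution $u\in C^4(\Omega)\cap C^{0,1}(\overline\Omega)$ of the Dirichlet problem $$\sigma_k(D^2u)+\alpha\,\sigma_{k-1}(D^2u)=f(x,u,Du)\ \text{ in }\Omega,\qquad u=0\ \text{ on }\partial\Omega,$$ with $\sup_\Omega|u|\le M_0$ and $\sup_\Omega|Du|\le M_1$ satisfies $$(-u)\,\Delta u\le C\qquad\text{in }\Omega.$$ -/

import Mathlib

noncomputable section

namespace SumHessian

/-- The Euclidean space of dimension `n`. -/
abbrev E (n : ℕ) : Type := EuclideanSpace ℝ (Fin n)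

/-- The `k`-th elementary symmetric function of `n` real variables (equal to `1` for `k = 0`). -/
def sigma {n : ℕ} (k : ℕ) (lam : Fin n → ℝ) : ℝ :=
  ∑ s ∈ Finset.powersetCard k (Finset.univ : Finset (Fin n)), ∏ i ∈ s, lam i

/-- The Garding cone `Γ_k`. -/
def gardingCone (n k : ℕ) : Set (Fin n → ℝ) :=
  {lam | ∀ m : ℕ, 1 ≤ m → m ≤ k → 0 < sigma m lam}

/-- The Hessian matrix of `u` at `x`: its `(i, j)` entry is the second partial derivative of `u`
in the directions of the standard basis vectors `e_i` and `e_j`. -/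
def hessian {n : ℕ} (u : E n → ℝ) (x : E n) : Matrix (Fin n) (Fin n) ℝ :=
  Matrix.of fun i j =>
    fderiv ℝ (fderiv ℝ u) x (EuclideanSpace.single i 1) (EuclideanSpace.single j 1)

/-- The Hessian matrix of a function that is `C^2` at `x` is symmetric. -/
theorem hessian_isHermitian {n : ℕ} {u : E n → ℝ} {x : E n} (hu : ContDiffAt ℝ 2 u x) :
    (hessian u x).IsHermitian := by
  have h : IsSymmSndFDerivAt ℝ u x := hu.isSymmSndFDerivAt (by simp)
  ext i j
  simpa [hessian] using h.eq (EuclideanSpace.single j 1) (EuclideanSpace.single i 1)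

open Classical in
/-- The eigenvalues of the Hessian matrix of `u` at `x`, with multiplicity. The second branch never
occurs where `u` is `C^2`, by `hessian_isHermitian`. -/
def hessianEigenvalues {n : ℕ} (u : E n → ℝ) (x : E n) : Fin n → ℝ :=
  if h : (hessian u x).IsHermitian then h.eigenvalues else 0

/-- `u ∈ C^2(Ω)` is `k`-convex in `Ω` if the eigenvalues of its Hessian lie in the Garding cone `Γ_k`
at every point of `Ω`. -/
def IsKConvexOn {n : ℕ} (k : ℕ) (Ω : Set (E n)) (u : E n → ℝ) : Prop :=
  ContDiffOn ℝ 2 u Ω ∧ ∀ x ∈ Ω, hessianEigenvalues u x ∈ gardingCone n k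

/-- `u` is a solution of the Dirichlet problem `σ_k(D²u) + α σ_{k-1}(D²u) = f(x, u, Du)` in `Ω`,
`u = 0` on the boundary of `Ω` (used for `k ≥ 1` only). -/
def IsDirichletSolution {n : ℕ} (k : ℕ) (α : ℝ) (Ω : Set (E n)) (f : E n × ℝ × E n → ℝ)
    (u : E n → ℝ) : Prop :=
  (∀ x ∈ Ω, sigma k (hessianEigenvalues u x) + α * sigma (k - 1) (hessianEigenvalues u x)
      = f (x, u x, gradient u x)) ∧
    ∀ x ∈ frontier Ω, u x = 0

/-- `F ∈ C^{1,1}` up to the boundary of the open set `U` (which may be unbounded): `F` is continuous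
on the closure of `U`, continuously differentiable in `U`, and its first derivatives are Lipschitz
on each bounded part of `U`; in particular they extend continuously to the closure. -/
def IsC11UpToBoundary {X : Type*} [NormedAddCommGroup X] [NormedSpace ℝ X] (U : Set X)
    (F : X → ℝ) : Prop :=
  ContinuousOn F (closure U) ∧ ContDiffOn ℝ 1 F U ∧
    ∀ B : Set X, Bornology.IsBounded B → ∃ L : NNReal, LipschitzOnWith L (fderiv ℝ F) (U ∩ B)

end SumHessian

end

/-! ### Newton's inequalities, the Gårding cone and superadditive quotients. -/

namespace SumHessian

open Finset Polynomial

/-! Write `F = σ_k + α σ_{k-1}` as a function of the eigenvalues `λ`, with derivatives `F_i`,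
`F_ij`; let `λ_o` be the largest eigenvalue and `E_j = F_j - λ_o F_oj` the part of `F_j` free of
`λ_o`. For `k = 1, 2` the equation bounds `Δu` directly. For `k ≥ 3` the bound is of Pogorelov type:
`(-u - ε) D²u(v, v) exp (N |Du|² / 2)` is maximised over unit vectors `v` and points where `u ≤ -ε`,
the maximum is bounded independently of `ε`, and `ε → 0`.

At the maximum three ingredients meet in `exists_bound_of_maximum`: the first and second order
conditions (`maximum_conditions`), the equation differentiated once and twice
(`differentiated_equation`), and a concavity inequality for `F` (`Garding.exists_spectral_bounds`)
that controls the third derivatives `u_oii`. What survives is the good term `N F_o λ_o² ≥ N c λ_o`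
from `|Du|²`, which beats every error linear in `λ_o` once `N` is large.

The concavity inequality rests on `α > 0`: since `σ_k > 0`, the equation bounds `σ_{k-1}` by `f /
α`. Put `q = σ_{k-1} / σ_{k-2}`. Newton's inequalities give `q^{k-2} σ_1 ≤ σ_{k-1}`, so `q → 0` as
`λ_o → ∞`. Products of `k - 1` eigenvalues are bounded and products of `k` or `k + 1` are `O(q)`
(`Garding.exists_abs_es_le`). Hence `F_o λ_o` lies between positive constants, and `F_o F_j - F
F_oj` is so small that cross terms between `o` and the other directions can be absorbed; in those
other directions log-concavity of `F` suffices (`Garding.sh_mul_hessian_le`, from the Marcus–Lopes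
inequality).

Eigenvalues need not be differentiable and `f` is only `C^{1,1}`. Both are handled by second order
expansions at one point (`Jet`): symmetric functions of eigenvalues are read off from determinants
(`jet_es_eigenvalues`), and `f` is replaced by a quadratic lower barrier (`rhs_jet_bound`). -/

theorem splits_derivative {p : ℝ[X]} (hp : p.Splits) : (derivative p).Splits := by
  rcases Nat.eq_zero_or_pos p.natDegree with h | h
  · rw [eq_C_of_natDegree_eq_zero h]
    simp
  · rw [splits_iff_card_roots]
    apply le_antisymm (card_roots' _)
    have h1 := card_roots_le_derivative p
    rw [← hp.natDegree_eq_card_roots] at h1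
    have h2 := natDegree_derivative_lt h.ne'
    omega

/-- Induction over the roots: if `p = (X - r) q`, then `p'² - p p'' = q² + (x - r)² (q'² - q q'')`.
-/
theorem eval_mul_eval_derivative_two_le {p : ℝ[X]} (hp : p.Splits) (x : ℝ) :
    p.eval x * (derivative (derivative p)).eval x ≤ (derivative p).eval x ^ 2 := by
  rw [hp.eq_prod_roots]
  generalize p.leadingCoeff = a
  have key : ∀ s : Multiset ℝ, (s.map (X - C ·)).prod.eval x *
      (derivative (derivative (s.map (X - C ·)).prod)).eval x ≤
      (derivative (s.map (X - C ·)).prod).eval x ^ 2 := by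
    intro s
    induction s using Multiset.induction_on with
    | empty => simp
    | cons r s ih =>
      simp only [Multiset.map_cons, Multiset.prod_cons, derivative_mul, derivative_sub,
        derivative_X, derivative_C, eval_add, eval_mul, eval_sub, eval_X, eval_C, sub_zero,
        one_mul, map_add] at ih ⊢
      generalize (s.map (X - C ·)).prod = q at ih ⊢
      nlinarith [sq_nonneg (eval x q), mul_le_mul_of_nonneg_left ih (sq_nonneg (x - r))]
  have := key p.roots
  simp only [derivative_mul, derivative_C, zero_mul, zero_add, eval_mul, eval_C]
  nlinarith [mul_le_mul_of_nonneg_left this (sq_nonneg a)]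

/-- For `j = 0` this is the preceding inequality at `0`. By Rolle the derivative is again
real-rooted, and passing to it shifts the coefficient index by one. -/
theorem coeff_mul_coeff_le_of_splits (j : ℕ) : ∀ {p : ℝ[X]}, p.Splits →
    (j + 2) * (p.coeff j * p.coeff (j + 2)) ≤ (j + 1) * p.coeff (j + 1) ^ 2 := by
  induction j with
  | zero =>
    intro p hp
    have h := eval_mul_eval_derivative_two_le hp 0
    simp only [← coeff_zero_eq_eval_zero, coeff_derivative] at h
    norm_num at h ⊢
    linarith
  | succ j ih =>
    intro p hp
    have h := ih (splits_derivative hp)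
    simp only [coeff_derivative] at h
    push_cast at h ⊢
    have h1 : (0 : ℝ) < (j + 1) * (j + 2) := by positivity
    refine le_of_mul_le_mul_left ?_ h1
    norm_num [add_assoc] at h ⊢
    nlinarith

variable {ι : Type*}

/-- The elementary symmetric function of degree `m` of the numbers `x i`, `i ∈ s`. -/
def es (s : Finset ι) (m : ℕ) (x : ι → ℝ) : ℝ := ∑ t ∈ s.powersetCard m, ∏ i ∈ t, x i

@[simp] theorem es_zero (s : Finset ι) (x : ι → ℝ) : es s 0 x = 1 := by simp [es]

theorem es_one (s : Finset ι) (x : ι → ℝ) : es s 1 x = ∑ i ∈ s, x i := by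
  simp [es, powersetCard_one]

theorem es_eq_zero {s : Finset ι} {m : ℕ} (h : s.card < m) (x : ι → ℝ) : es s m x = 0 := by
  simp [es, powersetCard_eq_empty.2 h]

/-- The coefficients of the real-rooted polynomial `∏ (X + x i)` are the elementary symmetric
functions in reverse order. The factor `(j + 1) / (j + 2) < 1` is given away. -/
theorem es_newton (s : Finset ι) (m : ℕ) (x : ι → ℝ) :
    es s m x * es s (m + 2) x ≤ es s (m + 1) x ^ 2 := by
  rcases lt_or_ge s.card (m + 2) with h | h
  · rw [es_eq_zero h, mul_zero]; positivity
  · obtain ⟨j, hj⟩ := Nat.exists_eq_add_of_le h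
    have hsp : (∏ i ∈ s, (X + C (x i))).Splits := Splits.prod fun i _ => by simp
    have h1 := coeff_mul_coeff_le_of_splits j hsp
    rw [Finset.prod_X_add_C_coeff s x (by omega), Finset.prod_X_add_C_coeff s x (by omega),
      Finset.prod_X_add_C_coeff s x (by omega), show s.card - j = m + 2 by omega,
      show s.card - (j + 2) = m by omega, show s.card - (j + 1) = m + 1 by omega] at h1
    change (j + 2 : ℝ) * (es s (m + 2) x * es s m x) ≤ (j + 1) * es s (m + 1) x ^ 2 at h1
    by_cases hs : es s m x * es s (m + 2) x ≤ 0
    · exact hs.trans (sq_nonneg _)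
    · have : (0 : ℝ) < j + 2 := by positivity
      nlinarith [sq_nonneg (es s (m + 1) x)]

/-- The Gårding cone in the coordinates from `s`. -/
def Garding (s : Finset ι) (k : ℕ) (x : ι → ℝ) : Prop := ∀ m ≤ k, 0 < es s m x

theorem Garding.mono {s : Finset ι} {k l : ℕ} {x : ι → ℝ} (h : Garding s k x) (hl : l ≤ k) :
    Garding s l x := fun m hm => h m (hm.trans hl)

theorem Garding.le_card {s : Finset ι} {k : ℕ} {x : ι → ℝ} (h : Garding s k x) : k ≤ s.card := by
  by_contra! hc
  have := h k le_rfl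
  rw [es_eq_zero hc] at this
  exact lt_irrefl _ this

variable [DecidableEq ι]

theorem es_insert {s : Finset ι} {i : ι} (hi : i ∉ s) (m : ℕ) (x : ι → ℝ) :
    es (insert i s) (m + 1) x = es s (m + 1) x + x i * es s m x := by
  unfold es
  rw [powersetCard_succ_insert hi, sum_union, sum_image, mul_sum]
  · congr 1
    refine sum_congr rfl fun t ht => prod_insert fun h => hi ((mem_powersetCard.1 ht).1 h)
  · intro t ht t' ht' h
    have h1 : i ∉ t := fun h => hi ((mem_powersetCard.1 ht).1 h)
    have h2 : i ∉ t' := fun h => hi ((mem_powersetCard.1 ht').1 h)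
    rw [← erase_insert h1, ← erase_insert h2]
    exact congrArg (fun u => u.erase i) h
  · rw [disjoint_left]
    intro t ht ht'
    obtain ⟨t', -, rfl⟩ := mem_image.1 ht'
    exact hi ((mem_powersetCard.1 ht).1 (mem_insert_self _ _))

theorem es_erase {s : Finset ι} {i : ι} (hi : i ∈ s) (m : ℕ) (x : ι → ℝ) :
    es s (m + 1) x = es (s.erase i) (m + 1) x + x i * es (s.erase i) m x := by
  rw [← es_insert (notMem_erase i s), insert_erase hi]

theorem sum_mul_es_erase (s : Finset ι) (m : ℕ) (x : ι → ℝ) :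
    ∑ i ∈ s, x i * es (s.erase i) m x = (m + 1) * es s (m + 1) x := by
  induction s using Finset.induction_on generalizing m with
  | empty => rw [es_eq_zero (by simp)]; simp
  | insert a s ha ih =>
    rw [sum_insert ha, erase_insert ha]
    have h : ∀ i ∈ s, (insert a s).erase i = insert a (s.erase i) := fun i hi =>
      erase_insert_of_ne (by rintro rfl; exact ha hi)
    have ha' : ∀ i, a ∉ s.erase i := fun i h => ha (mem_of_mem_erase h)
    cases m with
    | zero => simp [es_one, sum_insert ha]
    | succ m =>
      have : ∑ i ∈ s, x i * es ((insert a s).erase i) (m + 1) x =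
          ∑ i ∈ s, x i * es (s.erase i) (m + 1) x + x a * ∑ i ∈ s, x i * es (s.erase i) m x := by
        rw [mul_sum, ← sum_add_distrib]
        refine sum_congr rfl fun i hi => ?_
        rw [h i hi, es_insert (ha' i)]
        ring
      rw [this, ih, ih, es_insert ha (m + 1)]
      push_cast
      ring

/-- Let `A`, `B`, `D` be the functions of degrees `m`, `m + 1`, `m + 2` without `x i`. If `A > 0`
but `B ≤ 0`, then `x i * A > -B` and `D > -x i * B`, so `A * D > B²`, against Newton. -/
theorem Garding.erase {s : Finset ι} {k : ℕ} {x : ι → ℝ} (h : Garding s (k + 1) x) (i : ι) :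
    Garding (s.erase i) k x := by
  by_cases hi : i ∈ s
  swap
  · rw [erase_eq_of_notMem hi]; exact h.mono (by omega)
  intro m
  induction m with
  | zero => simp
  | succ m ih =>
    intro hm
    have h0 := ih (by omega)
    have h1 := h (m + 1) (by omega)
    have h2 := h (m + 2) (by omega)
    rw [es_erase hi] at h1 h2
    have h3 := es_newton (s.erase i) m x
    by_contra! hneg
    set A := es (s.erase i) m x
    set B := es (s.erase i) (m + 1) x
    set D := es (s.erase i) (m + 2) x
    have hx : 0 < x i := by
      by_contra! hx
      nlinarith
    nlinarith [mul_pos h0 h2, mul_nonneg h1.le (neg_nonneg.2 hneg)]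

/-- Marcus–Lopes identity. -/
theorem es_div_es_eq {s : Finset ι} {k : ℕ} {x : ι → ℝ} (h : Garding s (k + 1) x) :
    (k + 2) * (es s (k + 2) x / es s (k + 1) x) = ∑ i ∈ s, (x i - x i ^ 2 /
      (x i + es (s.erase i) (k + 1) x / es (s.erase i) k x)) := by
  have hk := h (k + 1) le_rfl
  have h1 := sum_mul_es_erase s (k + 1) x
  push_cast at h1
  have h2 : (k + 2) * (es s (k + 2) x / es s (k + 1) x) =
      ∑ i ∈ s, x i * es (s.erase i) (k + 1) x / es s (k + 1) x := by
    rw [← sum_div, h1]; ring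
  rw [h2]
  refine sum_congr rfl fun i hi => ?_
  have h3 := h.erase i k le_rfl
  have h4 := es_erase hi k x
  rw [h4] at hk ⊢
  have h5 : x i + es (s.erase i) (k + 1) x / es (s.erase i) k x =
    (es (s.erase i) (k + 1) x + x i * es (s.erase i) k x) / es (s.erase i) k x := by
    field_simp; ring
  rw [h5]
  field_simp
  ring

/-- Joint convexity and homogeneity of `a² / A`; it makes the summands of the Marcus–Lopes identity
superadditive. -/
theorem add_sq_div_le {a b A B D : ℝ} (hA : 0 < A) (hB : 0 < B) (hD : A + B ≤ D) :
    (a + b) ^ 2 / D ≤ a ^ 2 / A + b ^ 2 / B := by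
  have h1 : (a + b) ^ 2 / D ≤ (a + b) ^ 2 / (A + B) := by gcongr
  refine h1.trans ?_
  rw [div_add_div _ _ hA.ne' hB.ne', div_le_div_iff₀ (by positivity) (by positivity)]
  nlinarith [sq_nonneg (a * B - b * A)]

/-- Induction on the degree: in `es_div_es_eq` the denominators are `x i` plus a quotient of one
degree less without coordinate `i`, superadditive by the induction hypothesis. Convexity of the cone
comes along, since a positive lower bound for the quotient makes the next function positive. -/
theorem Garding.add_and_le (k : ℕ) : ∀ {s : Finset ι} {x y : ι → ℝ},
    Garding s (k + 1) x → Garding s (k + 1) y → Garding s (k + 1) (x + y) ∧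
    es s (k + 1) x / es s k x + es s (k + 1) y / es s k y ≤
      es s (k + 1) (x + y) / es s k (x + y) := by
  induction k with
  | zero =>
    intro s x y hx hy
    have h : es s 1 (x + y) = es s 1 x + es s 1 y := by simp [es_one, sum_add_distrib]
    refine ⟨fun m hm => ?_, by simp [h]⟩
    interval_cases m
    · simp
    · rw [h]; exact add_pos (hx 1 le_rfl) (hy 1 le_rfl)
  | succ k ih =>
    intro s x y hx hy
    have h0 := ih (hx.mono (by omega)) (hy.mono (by omega))
    have h1 : es s (k + 2) x / es s (k + 1) x + es s (k + 2) y / es s (k + 1) y ≤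
        es s (k + 2) (x + y) / es s (k + 1) (x + y) := by
      have hp : (0 : ℝ) < k + 2 := by positivity
      refine le_of_mul_le_mul_left ?_ hp
      rw [mul_add, es_div_es_eq (hx.mono (by omega)), es_div_es_eq (hy.mono (by omega)),
        es_div_es_eq h0.1, ← sum_add_distrib]
      refine sum_le_sum fun i hi => ?_
      have hpos : ∀ {z : ι → ℝ}, Garding s (k + 2) z →
          0 < z i + es (s.erase i) (k + 1) z / es (s.erase i) k z := by
        intro z hz
        have a1 := hz (k + 1) (by omega)
        have a2 := hz.erase i k (by omega)
        rw [es_erase hi] at a1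
        have : z i + es (s.erase i) (k + 1) z / es (s.erase i) k z =
          (es (s.erase i) (k + 1) z + z i * es (s.erase i) k z) / es (s.erase i) k z := by
          field_simp; ring
        rw [this]
        exact div_pos a1 a2
      have h2 := (ih (hx.erase i) (hy.erase i)).2
      have h3 := add_sq_div_le (a := x i) (b := y i) (hpos hx) (hpos hy)
        (D := (x + y) i + es (s.erase i) (k + 1) (x + y) / es (s.erase i) k (x + y))
        (by simp only [Pi.add_apply]; linarith)
      simp only [Pi.add_apply] at h3 ⊢
      linarith
    refine ⟨fun m hm => ?_, h1⟩
    rcases Nat.lt_or_ge m (k + 2) with hm' | hm'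
    · exact h0.1 m (by omega)
    · obtain rfl : m = k + 2 := by omega
      have h2 : 0 < es s (k + 2) (x + y) / es s (k + 1) (x + y) := lt_of_lt_of_le
        (add_pos (div_pos (hx _ le_rfl) (hx _ (by omega)))
          (div_pos (hy _ le_rfl) (hy _ (by omega)))) h1
      have h3 := h0.1 (k + 1) le_rfl
      exact (div_pos_iff_of_pos_right h3).1 h2

/-- `es s k` is the telescoping product of consecutive quotients, and each satisfies `4ab ≤ (a + b)²
≤ c²`. By homogeneity the factor `4 ^ k` makes this log-concavity at midpoints. -/
theorem Garding.es_mul_es_le (k : ℕ) {s : Finset ι} {x y : ι → ℝ}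
    (hx : Garding s k x) (hy : Garding s k y) :
    4 ^ k * (es s k x * es s k y) ≤ es s k (x + y) ^ 2 := by
  induction k with
  | zero => simp
  | succ k ih =>
    have h0 := ih (hx.mono (by omega)) (hy.mono (by omega))
    obtain ⟨h1, h2⟩ := Garding.add_and_le k hx hy
    have px := hx k (by omega)
    have py := hy k (by omega)
    have pz := h1 k (by omega)
    have px' := hx (k + 1) (by omega)
    have py' := hy (k + 1) (by omega)
    have pz' := h1 (k + 1) (by omega)
    set a := es s (k + 1) x / es s k x with ha
    set b := es s (k + 1) y / es s k y with hb
    set c := es s (k + 1) (x + y) / es s k (x + y) with hc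
    have a0 : 0 < a := div_pos px' px
    have b0 : 0 < b := div_pos py' py
    have ea : es s (k + 1) x = a * es s k x := by rw [ha]; field_simp
    have eb : es s (k + 1) y = b * es s k y := by rw [hb]; field_simp
    have ec : es s (k + 1) (x + y) = c * es s k (x + y) := by rw [hc]; field_simp
    rw [ea, eb, ec]
    have h4 : 4 * (a * b) ≤ c ^ 2 := by nlinarith [sq_nonneg (a - b)]
    calc 4 ^ (k + 1) * (a * es s k x * (b * es s k y))
        = (4 * (a * b)) * (4 ^ k * (es s k x * es s k y)) := by ring
      _ ≤ c ^ 2 * es s k (x + y) ^ 2 := by gcongr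
      _ = _ := by ring

end SumHessian

/-! ### Calculus of second order expansions at a point. -/

namespace SumHessian

open Finset Polynomial Filter Topology

/-- `f t = a + b t + c t² + o(t²)` as `t → 0`, with `f 0 = a`. -/
def Jet (f : ℝ → ℝ) (a b c : ℝ) : Prop :=
  ∃ r : ℝ → ℝ, Tendsto r (𝓝 0) (𝓝 0) ∧ ∀ t, f t = a + b * t + c * t ^ 2 + r t * t ^ 2

namespace Jet

variable {f g : ℝ → ℝ} {a b c a' b' c' : ℝ}

theorem eval_zero (h : Jet f a b c) : f 0 = a := by
  obtain ⟨r, -, h⟩ := h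
  simp [h 0]

theorem congr (h : Jet f a b c) (hfg : f =ᶠ[𝓝 0] g) : Jet g a b c := by
  have h0 : f 0 = g 0 := hfg.self_of_nhds
  obtain ⟨r, hr, h⟩ := h
  refine ⟨fun t => r t + (g t - f t) / t ^ 2, ?_, fun t => ?_⟩
  · refine hr.congr' ?_
    filter_upwards [hfg] with t ht
    simp [ht]
  · rcases eq_or_ne t 0 with rfl | ht
    · have := h 0
      simp only [mul_zero, add_zero, ne_eq, OfNat.ofNat_ne_zero, not_false_eq_true, zero_pow] at this ⊢
      rw [← h0, this]
    · have := h t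
      field_simp
      linarith

theorem const (a : ℝ) : Jet (fun _ => a) a 0 0 := ⟨0, tendsto_const_nhds, by simp⟩

theorem id : Jet (fun t => t) 0 1 0 := ⟨0, tendsto_const_nhds, by simp⟩

theorem sq : Jet (fun t => t ^ 2) 0 0 1 := ⟨0, tendsto_const_nhds, by simp⟩

theorem add (hf : Jet f a b c) (hg : Jet g a' b' c') :
    Jet (fun t => f t + g t) (a + a') (b + b') (c + c') := by
  obtain ⟨r, hr, h⟩ := hf
  obtain ⟨s, hs, h'⟩ := hg
  refine ⟨fun t => r t + s t, by simpa using hr.add hs, fun t => ?_⟩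
  beta_reduce; rw [h, h']; ring

theorem const_mul (k : ℝ) (hf : Jet f a b c) : Jet (fun t => k * f t) (k * a) (k * b) (k * c) := by
  obtain ⟨r, hr, h⟩ := hf
  refine ⟨fun t => k * r t, by simpa using hr.const_mul k, fun t => ?_⟩
  beta_reduce; rw [h]; ring

theorem sub (hf : Jet f a b c) (hg : Jet g a' b' c') :
    Jet (fun t => f t - g t) (a - a') (b - b') (c - c') := by
  have := hf.add (hg.const_mul (-1))
  simpa [sub_eq_add_neg] using this

theorem mul (hf : Jet f a b c) (hg : Jet g a' b' c') :
    Jet (fun t => f t * g t) (a * a') (a * b' + b * a') (a * c' + b * b' + c * a') := by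
  obtain ⟨r, hr, h⟩ := hf
  obtain ⟨s, hs, h'⟩ := hg
  refine ⟨fun t => r t * (a' + b' * t + c' * t ^ 2 + s t * t ^ 2) +
    (a + b * t + c * t ^ 2) * s t + (b * c' + c * b') * t + c * c' * t ^ 2, ?_, fun t => ?_⟩
  · have ht : Tendsto (fun t : ℝ => t) (𝓝 0) (𝓝 0) := tendsto_id
    have h1 := (hr.mul (((ht.const_mul b').const_add a').add (((ht.pow 2).const_mul c').add
      (hs.mul (ht.pow 2))))).add ((((ht.const_mul b).const_add a).add
        ((ht.pow 2).const_mul c)).mul hs)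
    have h2 := (h1.add (ht.const_mul (b * c' + c * b'))).add ((ht.pow 2).const_mul (c * c'))
    simp only [mul_zero, zero_mul, add_zero, ne_eq, OfNat.ofNat_ne_zero, not_false_eq_true,
      zero_pow] at h2
    refine h2.congr fun t => ?_
    ring
  · beta_reduce; rw [h, h']; ring

theorem sum {ι : Type*} (s : Finset ι) {f : ι → ℝ → ℝ} {a b c : ι → ℝ}
    (h : ∀ i ∈ s, Jet (f i) (a i) (b i) (c i)) :
    Jet (fun t => ∑ i ∈ s, f i t) (∑ i ∈ s, a i) (∑ i ∈ s, b i) (∑ i ∈ s, c i) := by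
  classical
  induction s using Finset.induction_on with
  | empty => simpa using const 0
  | insert i s hi ih =>
    simp only [sum_insert hi]
    exact (h i (mem_insert_self _ _)).add (ih fun j hj => h j (mem_insert_of_mem hj))

theorem cast (hf : Jet f a b c) (ha : a = a') (hb : b = b') (hc : c = c') : Jet f a' b' c' := by
  subst ha hb hc; exact hf

theorem comp {h : ℝ → ℝ} {h0 h1 h2 : ℝ} (hh : Jet (fun s => h (a + s)) h0 h1 h2)
    (hf : Jet f a b c) : Jet (fun t => h (f t)) h0 (h1 * b) (h1 * c + h2 * b ^ 2) := by
  obtain ⟨r, hr, h⟩ := hf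
  obtain ⟨s, hs, h'⟩ := hh
  have ht : Tendsto (fun t : ℝ => t) (𝓝 0) (𝓝 0) := tendsto_id
  have hd : Tendsto (fun t : ℝ => b + c * t + r t * t) (𝓝 0) (𝓝 b) := by
    have := ((ht.const_mul c).const_add b).add (hr.mul ht)
    simpa using this
  have hδ : Tendsto (fun t : ℝ => t * (b + c * t + r t * t)) (𝓝 0) (𝓝 0) := by
    simpa using ht.mul hd
  refine ⟨fun t => h1 * r t + h2 * ((b + c * t + r t * t) ^ 2 - b ^ 2) +
    s (t * (b + c * t + r t * t)) * (b + c * t + r t * t) ^ 2, ?_, fun t => ?_⟩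
  · have := ((hr.const_mul h1).add (((hd.pow 2).sub_const (b ^ 2)).const_mul h2)).add
      ((hs.comp hδ).mul (hd.pow 2))
    simpa using this
  · have e := h' (t * (b + c * t + r t * t))
    have e2 : a + t * (b + c * t + r t * t) = f t := by rw [h]; ring
    simp only [e2] at e
    beta_reduce; rw [e]; ring

/-- Mean value inequality on the ball of radius `|t|` for `f` minus its quadratic polynomial, whose
derivative is `o(t)` there. The third entry of a jet is half the second derivative. -/
theorem of_hasDerivAt {f' : ℝ → ℝ} {d : ℝ} (h1 : ∀ᶠ t in 𝓝 0, HasDerivAt f (f' t) t)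
    (h2 : HasDerivAt f' d 0) : Jet f (f 0) (f' 0) (d / 2) := by
  refine ⟨fun t => (f t - (f 0 + f' 0 * t + d / 2 * t ^ 2)) / t ^ 2, ?_, fun t => ?_⟩
  swap
  · rcases eq_or_ne t 0 with rfl | ht
    · simp
    · field_simp; ring
  rw [Metric.tendsto_nhds]
  intro ε hε
  have h3 := (hasDerivAt_iff_isLittleO.1 h2).def (half_pos hε)
  obtain ⟨δ, hδ, hball⟩ := Metric.eventually_nhds_iff_ball.1 (h1.and h3)
  filter_upwards [Metric.ball_mem_nhds (0 : ℝ) hδ] with t ht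
  rcases eq_or_ne t 0 with rfl | ht0
  · simpa using hε
  have hsub : ∀ s ∈ Metric.closedBall (0 : ℝ) |t|, s ∈ Metric.ball (0 : ℝ) δ := by
    intro s hs
    simp only [Metric.mem_closedBall, Metric.mem_ball, dist_zero_right, Real.norm_eq_abs] at hs ht ⊢
    exact lt_of_le_of_lt hs ht
  have hder : ∀ s ∈ Metric.closedBall (0 : ℝ) |t|,
      HasDerivWithinAt (fun t => f t - (f 0 + f' 0 * t + d / 2 * t ^ 2))
        (f' s - (f' 0 + d * s)) (Metric.closedBall (0 : ℝ) |t|) s := by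
    intro s hs
    have hd := (hball s (hsub s hs)).1
    have hp : HasDerivAt (fun t : ℝ => f 0 + f' 0 * t + d / 2 * t ^ 2) (f' 0 + d * s) s := by
      have h5 := (((hasDerivAt_id s).const_mul (f' 0)).const_add (f 0)).add
        ((hasDerivAt_pow 2 s).const_mul (d / 2))
      convert! h5 using 1
      simp; ring
    exact (hd.sub hp).hasDerivWithinAt
  have hbd : ∀ s ∈ Metric.closedBall (0 : ℝ) |t|, ‖f' s - (f' 0 + d * s)‖ ≤ ε / 2 * |t| := by
    intro s hs
    have h4 := (hball s (hsub s hs)).2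
    simp only [sub_zero, smul_eq_mul, Real.norm_eq_abs] at h4
    simp only [Metric.mem_closedBall, dist_zero_right, Real.norm_eq_abs] at hs
    calc ‖f' s - (f' 0 + d * s)‖ = |f' s - f' 0 - s * d| := by
          rw [Real.norm_eq_abs]; congr 1; ring
      _ ≤ ε / 2 * |s| := h4
      _ ≤ ε / 2 * |t| := by gcongr
  have := (convex_closedBall (0 : ℝ) |t|).norm_image_sub_le_of_norm_hasDerivWithin_le hder hbd
    (x := 0) (y := t) (by simp) (by simp)
  simp only [mul_zero, add_zero, ne_eq, OfNat.ofNat_ne_zero, not_false_eq_true, zero_pow, sub_self,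
    sub_zero, Real.norm_eq_abs] at this
  rw [dist_zero_right, Real.norm_eq_abs, abs_div, abs_of_pos (by positivity : 0 < t ^ 2),
    div_lt_iff₀ (by positivity)]
  have ht2 : |t| * |t| = t ^ 2 := by rw [← sq_abs]; ring
  have : 0 < t ^ 2 := by positivity
  nlinarith

theorem log_of_pos (hf : Jet f a b c) (ha : 0 < a) :
    Jet (fun t => Real.log (f t)) (Real.log a) (b / a) (c / a - b ^ 2 / (2 * a ^ 2)) := by
  have key : Jet (fun s => Real.log (a + s)) (Real.log a) a⁻¹ (-(a ^ 2)⁻¹ / 2) := by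
    have h1 : ∀ᶠ t : ℝ in 𝓝 0, HasDerivAt (fun s => Real.log (a + s)) ((a + t)⁻¹) t := by
      have : ∀ᶠ t : ℝ in 𝓝 0, 0 < a + t :=
        (tendsto_id.const_add a).eventually_const_lt (by simpa using ha)
      filter_upwards [this] with t ht
      simpa using ((hasDerivAt_id t).const_add a).log ht.ne'
    have h2 : HasDerivAt (fun t : ℝ => (a + t)⁻¹) (-(a ^ 2)⁻¹) 0 := by
      have := ((hasDerivAt_id (0 : ℝ)).const_add a).fun_inv (by simpa using ha.ne')
      convert! this using 1
      simp [neg_div]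
    simpa using of_hasDerivAt h1 h2
  refine (comp key hf).cast rfl ?_ ?_
  · field_simp
  · field_simp; ring

theorem eq_zero_and_nonpos (hf : Jet f a b c) (hmax : ∀ᶠ t in 𝓝 0, f t ≤ f 0) :
    b = 0 ∧ c ≤ 0 := by
  have h0 := hf.eval_zero
  obtain ⟨r, hr, h⟩ := hf
  rw [h0] at hmax
  have ht : Tendsto (fun t : ℝ => t) (𝓝 0) (𝓝 0) := tendsto_id
  have hlim : Tendsto (fun t => b + c * t + r t * t) (𝓝 0) (𝓝 b) := by
    have := ((ht.const_mul c).const_add b).add (hr.mul ht)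
    simpa using this
  have hpos : ∀ᶠ t in 𝓝[>] (0 : ℝ), b + c * t + r t * t ≤ 0 := by
    filter_upwards [hmax.filter_mono nhdsWithin_le_nhds, self_mem_nhdsWithin] with t ht1 ht2
    rw [h] at ht1
    have ht2 : 0 < t := ht2
    by_contra! hc
    nlinarith [mul_pos ht2 hc]
  have hneg : ∀ᶠ t in 𝓝[<] (0 : ℝ), 0 ≤ b + c * t + r t * t := by
    filter_upwards [hmax.filter_mono nhdsWithin_le_nhds, self_mem_nhdsWithin] with t ht1 ht2
    rw [h] at ht1
    have ht2 : t < 0 := ht2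
    by_contra! hc
    nlinarith [mul_pos_of_neg_of_neg ht2 hc]
  have hb1 : b ≤ 0 := le_of_tendsto (hlim.mono_left nhdsWithin_le_nhds) hpos
  have hb2 : 0 ≤ b := ge_of_tendsto (hlim.mono_left nhdsWithin_le_nhds) hneg
  have hb : b = 0 := le_antisymm hb1 hb2
  refine ⟨hb, ?_⟩
  have hlim2 : Tendsto (fun t => c + r t) (𝓝[>] 0) (𝓝 c) := by
    simpa using (hr.const_add c).mono_left nhdsWithin_le_nhds
  refine le_of_tendsto hlim2 ?_
  filter_upwards [hmax.filter_mono nhdsWithin_le_nhds, self_mem_nhdsWithin] with t ht1 ht2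
  rw [h, hb] at ht1
  have ht2 : 0 < t := ht2
  by_contra! hc
  nlinarith [mul_pos (pow_pos ht2 2) hc]

/-- Comparison with a barrier touching at `0`; it replaces a second differentiation of the
right-hand side. -/
theorem le_of_eventually_le (hf : Jet f a b c) (hg : Jet g a b' c')
    (hfg : ∀ᶠ t in 𝓝 0, f t ≤ g t) : b = b' ∧ c ≤ c' := by
  have h := (hf.sub hg).eq_zero_and_nonpos (by
    filter_upwards [hfg] with t ht
    rw [hf.eval_zero, hg.eval_zero]
    linarith)
  exact ⟨by linarith [h.1], by linarith [h.2]⟩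

theorem tendsto (hf : Jet f a b c) : Tendsto f (𝓝 0) (𝓝 a) := by
  obtain ⟨r, hr, h⟩ := hf
  have ht : Tendsto (fun t : ℝ => t) (𝓝 0) (𝓝 0) := tendsto_id
  have := (((ht.const_mul b).const_add a).add ((ht.pow 2).const_mul c)).add (hr.mul (ht.pow 2))
  simp only [mul_zero, add_zero, ne_eq, OfNat.ofNat_ne_zero, not_false_eq_true, zero_pow] at this
  exact this.congr fun t => (h t).symm

theorem prod {ι : Type*} [DecidableEq ι] (s : Finset ι) {f : ι → ℝ → ℝ} {a b c : ι → ℝ}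
    (h : ∀ i ∈ s, Jet (f i) (a i) (b i) (c i)) :
    Jet (fun t => ∏ i ∈ s, f i t) (∏ i ∈ s, a i) (∑ i ∈ s, b i * ∏ j ∈ s.erase i, a j)
      (∑ i ∈ s, c i * ∏ j ∈ s.erase i, a j +
        1 / 2 * ∑ i ∈ s, ∑ j ∈ s.erase i, b i * b j * ∏ l ∈ (s.erase i).erase j, a l) := by
  induction s using Finset.induction_on with
  | empty => simpa using const 1
  | insert i s hi ih =>
    simp only [prod_insert hi]
    have he : ∀ j ∈ s, (insert i s).erase j = insert i (s.erase j) := fun j hj =>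
      erase_insert_of_ne (by rintro rfl; exact hi hj)
    have hi' : ∀ j, i ∉ s.erase j := fun j h => hi (mem_of_mem_erase h)
    have hi'' : ∀ j l, i ∉ (s.erase j).erase l := fun j l h => hi' j (mem_of_mem_erase h)
    have he' : ∀ j ∈ s, ∀ l ∈ s.erase j, (insert i (s.erase j)).erase l =
        insert i ((s.erase j).erase l) := fun j hj l hl =>
      erase_insert_of_ne (by rintro rfl; exact hi' j hl)
    refine ((h i (mem_insert_self _ _)).mul
      (ih fun j hj => h j (mem_insert_of_mem hj))).cast rfl ?_ ?_
    · rw [sum_insert hi, erase_insert hi, add_comm, mul_sum]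
      congr 1
      refine sum_congr rfl fun j hj => ?_
      rw [he j hj, prod_insert (hi' j)]; ring
    · have h1 : ∀ j ∈ s, c j * ∏ l ∈ (insert i s).erase j, a l =
          a i * (c j * ∏ l ∈ s.erase j, a l) := fun j hj => by
        rw [he j hj, prod_insert (hi' j)]; ring
      have h2 : ∀ j ∈ s, ∑ l ∈ (insert i s).erase j, b j * b l *
          ∏ p ∈ ((insert i s).erase j).erase l, a p = b i * (b j * ∏ l ∈ s.erase j, a l) +
            a i * ∑ l ∈ s.erase j, b j * b l * ∏ p ∈ (s.erase j).erase l, a p := fun j hj => by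
        rw [he j hj, sum_insert (hi' j), erase_insert (hi' j), mul_sum]
        congr 1
        · ring
        refine sum_congr rfl fun l hl => ?_
        rw [he' j hj l hl, prod_insert (hi'' j l)]; ring
      have h3 : ∀ j ∈ s, b i * b j * ∏ p ∈ s.erase j, a p = b i * (b j * ∏ p ∈ s.erase j, a p) :=
        fun j hj => by ring
      rw [sum_insert hi, sum_insert hi, erase_insert hi, sum_congr rfl h1, sum_congr rfl h2,
        sum_congr rfl h3, sum_add_distrib, ← mul_sum, ← mul_sum, ← mul_sum]
      ring

end Jet

end SumHessian

/-! ### Expansion and log-concavity of the sum operator. -/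

namespace SumHessian

open Finset Polynomial Filter Topology

variable {ι : Type*} [DecidableEq ι]

/-- Pairs `(t, i)` with `i ∈ t` correspond to pairs `(i, t.erase i)`. Derivatives of products are
thereby regrouped into elementary symmetric functions with coordinates removed. -/
theorem sum_powersetCard_succ_erase {M : Type*} [AddCommMonoid M] (s : Finset ι) (m : ℕ)
    (g : ι → Finset ι → M) :
    ∑ t ∈ s.powersetCard (m + 1), ∑ i ∈ t, g i (t.erase i) =
      ∑ i ∈ s, ∑ t ∈ (s.erase i).powersetCard m, g i t := by
  rw [sum_sigma', sum_sigma']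
  refine sum_bij' (fun p _ => ⟨p.2, p.1.erase p.2⟩) (fun p _ => ⟨insert p.1 p.2, p.1⟩) ?_ ?_ ?_ ?_ ?_
  · rintro ⟨t, i⟩ h
    simp only [mem_sigma, mem_powersetCard] at h ⊢
    exact ⟨h.1.1 h.2, erase_subset_erase _ h.1.1, by rw [card_erase_of_mem h.2, h.1.2]; rfl⟩
  · rintro ⟨i, t⟩ h
    simp only [mem_sigma, mem_powersetCard] at h ⊢
    have hi : i ∉ t := fun hi => notMem_erase i s (h.2.1 hi)
    exact ⟨⟨insert_subset h.1 (h.2.1.trans (erase_subset _ _)),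
      by rw [card_insert_of_notMem hi, h.2.2]⟩, mem_insert_self _ _⟩
  · rintro ⟨t, i⟩ h
    simp only [mem_sigma, mem_powersetCard] at h
    simp [insert_erase h.2]
  · rintro ⟨i, t⟩ h
    simp only [mem_sigma, mem_powersetCard] at h
    have hi : i ∉ t := fun hi => notMem_erase i s (h.2.1 hi)
    simp [erase_insert hi]
  · rintro ⟨t, i⟩ h
    rfl

theorem jet_es (s : Finset ι) (m : ℕ) (x η : ι → ℝ) :
    Jet (fun t => es s (m + 2) (x + t • η)) (es s (m + 2) x)
      (∑ i ∈ s, η i * es (s.erase i) (m + 1) x)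
      (1 / 2 * ∑ i ∈ s, ∑ j ∈ s.erase i, η i * η j * es ((s.erase i).erase j) m x) := by
  have h : ∀ i, Jet (fun t => (x + t • η) i) (x i) (η i) 0 := fun i => by
    have := (Jet.const (x i)).add (Jet.id.const_mul (η i))
    simpa [mul_comm] using this
  refine (Jet.sum (s.powersetCard (m + 2)) fun t _ => Jet.prod t fun i _ => h i).cast rfl ?_ ?_
  · rw [sum_powersetCard_succ_erase s (m + 1) fun i t => η i * ∏ j ∈ t, x j]
    simp only [es, mul_sum]
  · simp only [zero_mul, sum_const_zero, zero_add]
    rw [← mul_sum, sum_powersetCard_succ_erase s (m + 1) fun i t => ∑ j ∈ t, η i * η j *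
      ∏ l ∈ t.erase j, x l]
    congr 1
    refine sum_congr rfl fun i _ => ?_
    rw [sum_powersetCard_succ_erase (s.erase i) m fun j t => η i * η j * ∏ l ∈ t, x l]
    simp only [es, mul_sum]

/-- The sum `σ_{m+1} + α σ_m` in the coordinates from `s`. -/
def sh (α : ℝ) (s : Finset ι) (m : ℕ) (x : ι → ℝ) : ℝ := es s (m + 1) x + α * es s m x

theorem sh_erase (α : ℝ) {s : Finset ι} {i : ι} (hi : i ∈ s) (m : ℕ) (x : ι → ℝ) :
    sh α s (m + 1) x = sh α (s.erase i) (m + 1) x + x i * sh α (s.erase i) m x := by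
  unfold sh
  rw [es_erase hi (m + 1), es_erase hi m]
  ring

/-- Index convention for `k = m + 3`: the operator is `sh α univ (m + 2)`, and each derivative
removes a coordinate and lowers the index by one. There are no pure second derivatives because the
operator is affine in each coordinate. -/
theorem jet_sh (α : ℝ) (s : Finset ι) (m : ℕ) (x η : ι → ℝ) :
    Jet (fun t => sh α s (m + 2) (x + t • η)) (sh α s (m + 2) x)
      (∑ i ∈ s, η i * sh α (s.erase i) (m + 1) x)
      (1 / 2 * ∑ i ∈ s, ∑ j ∈ s.erase i, η i * η j * sh α ((s.erase i).erase j) m x) := by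
  refine ((jet_es s (m + 1) x η).add ((jet_es s m x η).const_mul α)).cast rfl ?_ ?_
  · simp only [sh, mul_add, sum_add_distrib, mul_sum]
    congr 1
    refine sum_congr rfl fun i _ => by ring
  · simp only [sh, mul_add, sum_add_distrib, mul_sum]
    congr 1
    refine sum_congr rfl fun i _ => sum_congr rfl fun j _ => by ring

theorem jet_es_continuous (s : Finset ι) (m : ℕ) (x η : ι → ℝ) :
    Tendsto (fun t : ℝ => es s m (x + t • η)) (𝓝 0) (𝓝 (es s m x)) := by
  have : Continuous fun t : ℝ => es s m (x + t • η) := by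
    unfold es
    simp only [Pi.add_apply, Pi.smul_apply, smul_eq_mul]
    fun_prop
  simpa using this.tendsto 0

theorem Garding.eventually {s : Finset ι} {k : ℕ} {x : ι → ℝ} (h : Garding s k x) (η : ι → ℝ) :
    ∀ᶠ t : ℝ in 𝓝 0, Garding s k (x + t • η) := by
  have h1 : ∀ m ∈ range (k + 1), ∀ᶠ t : ℝ in 𝓝 0, 0 < es s m (x + t • η) := fun m hm =>
    (jet_es_continuous s m x η).eventually_const_lt (h m (by simpa [Nat.lt_succ_iff] using hm))
  filter_upwards [(eventually_all_finset _).2 h1] with t ht m hm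
  exact ht m (by simpa [Nat.lt_succ_iff] using hm)

/-- The operator factors as `es s k` times (quotient `+ α`). The first factor is midpoint
log-concave by `Garding.es_mul_es_le`, the second because the quotient is superadditive and
homogeneous of degree one. -/
theorem Garding.sh_mul_sh_le {α : ℝ} (hα : 0 ≤ α) (k : ℕ) {s : Finset ι} {x y : ι → ℝ}
    (hx : Garding s (k + 1) x) (hy : Garding s (k + 1) y) :
    sh α s k x * sh α s k y ≤ sh α s k ((2 : ℝ)⁻¹ • (x + y)) ^ 2 := by
  have hom : ∀ m, es s m ((2 : ℝ)⁻¹ • (x + y)) = (2 : ℝ)⁻¹ ^ m * es s m (x + y) := by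
    intro m
    unfold es
    rw [mul_sum]
    refine sum_congr rfl fun t ht => ?_
    simp only [Pi.smul_apply, smul_eq_mul, prod_mul_distrib, prod_const]
    rw [(mem_powersetCard.1 ht).2]
  have h0 := Garding.es_mul_es_le k (hx.mono (by omega)) (hy.mono (by omega))
  obtain ⟨h1, h2⟩ := Garding.add_and_le k hx hy
  have px := hx k (by omega)
  have py := hy k (by omega)
  have pz := h1 k (by omega)
  have px' := hx (k + 1) (by omega)
  have py' := hy (k + 1) (by omega)
  have pz' := h1 (k + 1) (by omega)
  unfold sh
  rw [hom, hom]
  set a := es s (k + 1) x / es s k x with ha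
  set b := es s (k + 1) y / es s k y with hb
  set c := es s (k + 1) (x + y) / es s k (x + y) with hc
  have a0 : 0 < a := div_pos px' px
  have b0 : 0 < b := div_pos py' py
  have ea : es s (k + 1) x = a * es s k x := by rw [ha]; field_simp
  have eb : es s (k + 1) y = b * es s k y := by rw [hb]; field_simp
  have ec : es s (k + 1) (x + y) = c * es s k (x + y) := by rw [hc]; field_simp
  rw [ea, eb, ec]
  have h4 : (a + α) * (b + α) ≤ (2⁻¹ * c + α) ^ 2 := by
    nlinarith [sq_nonneg (a - b), mul_nonneg hα (by linarith : 0 ≤ c - (a + b))]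
  have h5 : es s k x * es s k y ≤ ((2 : ℝ)⁻¹ ^ k * es s k (x + y)) ^ 2 := by
    have : ((2 : ℝ)⁻¹ ^ k * es s k (x + y)) ^ 2 = (4 ^ k)⁻¹ * es s k (x + y) ^ 2 := by
      rw [mul_pow, ← pow_mul, mul_comm k 2, pow_mul, ← inv_pow]; norm_num
    rw [this, inv_mul_eq_div, le_div_iff₀ (by positivity)]
    linarith
  calc (a * es s k x + α * es s k x) * (b * es s k y + α * es s k y)
      = ((a + α) * (b + α)) * (es s k x * es s k y) := by ring
    _ ≤ (2⁻¹ * c + α) ^ 2 * ((2 : ℝ)⁻¹ ^ k * es s k (x + y)) ^ 2 := by gcongr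
    _ = _ := by ring

/-- Logarithmic concavity of `σ_{m+3} + α σ_{m+2}` in the Gårding cone. -/
theorem Garding.sh_mul_hessian_le {α : ℝ} (hα : 0 ≤ α) {m : ℕ} {s : Finset ι} {x : ι → ℝ}
    (hx : Garding s (m + 3) x) (η : ι → ℝ) :
    sh α s (m + 2) x *
        ∑ i ∈ s, ∑ j ∈ s.erase i, η i * η j * sh α ((s.erase i).erase j) m x ≤
      (∑ i ∈ s, η i * sh α (s.erase i) (m + 1) x) ^ 2 := by
  have h1 := jet_sh α s m x η
  have h2 := jet_sh α s m x (-η)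
  -- Since `x` is the midpoint of `x + tη` and `x - tη`, the product of the two values is maximal at
  -- `t = 0`; its second coefficient is the difference of the two sides.
  have h3 := (h1.mul h2).eq_zero_and_nonpos (by
    filter_upwards [hx.eventually η, hx.eventually (-η)] with t ht1 ht2
    have := ht1.sh_mul_sh_le hα (m + 2) ht2
    have e : (2 : ℝ)⁻¹ • (x + t • η + (x + t • -η)) = x := by
      ext i; simp; ring
    rw [e] at this
    simpa [pow_two] using this)
  have h4 := h3.2
  simp only [Pi.neg_apply, neg_mul, mul_neg, neg_neg, sum_neg_distrib] at h4
  nlinarith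

end SumHessian

/-! ### Quantitative estimates in the Gårding cone. -/

namespace SumHessian

open Finset Polynomial Filter Topology

variable {ι : Type*} [DecidableEq ι]

theorem Garding.abs_le {s : Finset ι} {x : ι → ℝ} (h : Garding s 1 x) {o : ι}
    (hmax : ∀ i ∈ s, x i ≤ x o) {N : ℝ} (hN : s.card ≤ N) {j : ι} (hj : j ∈ s) :
    |x j| ≤ N * x o := by
  have h1 := h 1 le_rfl
  rw [es_one] at h1
  have hc : (1 : ℝ) ≤ s.card := by exact_mod_cast card_pos.2 ⟨j, hj⟩
  have hpos : 0 < x o := by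
    by_contra! hx
    exact absurd h1 (not_lt.2 (sum_nonpos fun i hi => (hmax i hi).trans hx))
  have h2 : ∑ i ∈ s.erase j, x i ≤ (s.card - 1) * x o := by
    have := sum_le_card_nsmul (s.erase j) x (x o) fun i hi => hmax i (mem_of_mem_erase hi)
    rw [card_erase_of_mem hj, nsmul_eq_mul, Nat.cast_sub (card_pos.2 ⟨j, hj⟩)] at this
    simpa using this
  rw [← add_sum_erase s x hj] at h1
  rw [_root_.abs_le]
  have h3 := hmax j hj
  constructor <;> nlinarith

/-- The two sides differ by `x o - x i` times the function of degree `m` with both coordinates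
removed, which is positive. -/
theorem Garding.es_erase_anti {s : Finset ι} {x : ι → ℝ} {m : ℕ} (h : Garding s (m + 2) x)
    {i o : ι} (hi : i ∈ s) (ho : o ∈ s) (hio : x i ≤ x o) :
    es (s.erase o) (m + 1) x ≤ es (s.erase i) (m + 1) x := by
  rcases eq_or_ne i o with rfl | hne
  · rfl
  rw [es_erase (mem_erase.2 ⟨hne, hi⟩), es_erase (mem_erase.2 ⟨hne.symm, ho⟩) (s := s.erase i),
    erase_right_comm]
  have := (h.erase i).erase o m (by omega)
  nlinarith

/-- Each summand `x i * es (s.erase i) m x` equals `es s (m + 1) x - es (s.erase i) (m + 1) x`,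
largest at `i = o` by `Garding.es_erase_anti`. -/
theorem Garding.succ_mul_es_le {s : Finset ι} {x : ι → ℝ} {m : ℕ} (h : Garding s (m + 2) x)
    {o : ι} (ho : o ∈ s) (hmax : ∀ i ∈ s, x i ≤ x o) :
    (m + 1) * es s (m + 1) x ≤ s.card * (x o * es (s.erase o) m x) := by
  rw [← sum_mul_es_erase, ← nsmul_eq_mul]
  refine sum_le_card_nsmul _ _ _ fun i hi => ?_
  have h1 := h.es_erase_anti hi ho (hmax i hi)
  have h2 := es_erase hi m x
  have h3 := es_erase ho m x
  linarith

theorem Garding.mul_es_erase_le {s : Finset ι} {x : ι → ℝ} {m : ℕ} (h : Garding s (m + 2) x)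
    {o : ι} (ho : o ∈ s) : x o * es (s.erase o) m x ≤ es s (m + 1) x := by
  have := h.erase o (m + 1) le_rfl
  rw [es_erase ho]
  linarith

/-- In the Gårding cone of order `m + 2`, products of at least `m + 1` coordinates are controlled by
the elementary symmetric functions of degrees `m` and `m + 1`. -/
theorem Garding.abs_prod_mul_le (m : ℕ) : ∀ {s : Finset ι} {x : ι → ℝ}, Garding s (m + 2) x →
    ∀ {N : ℝ}, s.card ≤ N → ∀ {r : ℕ} {t : Finset ι}, t ⊆ s → t.card = m + 1 + r →
    |∏ i ∈ t, x i| * es s m x ^ r ≤ N ^ ((r + 1) * (m + 1)) * es s (m + 1) x ^ (r + 1) := by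
  induction m with
  | zero =>
    intro s x h N hN r t hts ht
    have hne : s.Nonempty := card_pos.1 (by have := h.le_card; omega)
    obtain ⟨o, ho, hmax⟩ := exists_max_image s x hne
    have hN0 : 0 ≤ N := le_trans (by positivity) hN
    have h1 : ∀ j ∈ s, |x j| ≤ N * x o := fun j hj =>
      (h.mono (l := 1) (by omega)).abs_le hmax hN hj
    have h2 := h.mul_es_erase_le ho
    simp only [es_zero, mul_one, zero_add] at h2
    simp only [es_zero, one_pow, mul_one, zero_add]
    rw [abs_prod, ← mul_pow]
    have : ∏ i ∈ t, |x i| ≤ ∏ _i ∈ t, (N * es s 1 x) :=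
      Finset.prod_le_prod (fun _ _ => abs_nonneg _) fun i hi => (h1 i (hts hi)).trans (by gcongr)
    rw [prod_const, ht] at this
    rwa [add_comm r 1]
  | succ m ih =>
    intro s x h N hN r t hts ht
    have hne : s.Nonempty := card_pos.1 (by have := h.le_card; omega)
    obtain ⟨o, ho, hmax⟩ := exists_max_image s x hne
    have hN0 : 0 ≤ N := le_trans (by positivity) hN
    have hx : ∀ j ∈ s, |x j| ≤ N * x o := fun j hj =>
      (h.mono (l := 1) (by omega)).abs_le hmax hN hj
    -- One factor, at most `N * x o` in size, is dropped so that the rest avoids the largest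
    -- coordinate and the induction hypothesis applies to `s.erase o`. The bounds `h4` and `h3` then
    -- trade powers of `x o` for functions of one degree more on `s`.
    obtain ⟨j, hj, hjo⟩ : ∃ j ∈ t, t.erase j ⊆ s.erase o := by
      by_cases hot : o ∈ t
      · exact ⟨o, hot, erase_subset_erase _ hts⟩
      · obtain ⟨j, hj⟩ := card_pos.1 (by omega : 0 < t.card)
        refine ⟨j, hj, fun i hi => mem_erase.2 ⟨?_, hts (mem_of_mem_erase hi)⟩⟩
        rintro rfl
        exact hot (mem_of_mem_erase hi)
    have hA := h.erase o
    have h1 := ih hA (N := N) (r := r) (t := t.erase j)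
      (le_trans (by exact_mod_cast card_le_card (erase_subset _ _)) hN) hjo
      (by rw [card_erase_of_mem hj]; omega)
    have h2 := (h.mono (l := m + 2) (by omega)).succ_mul_es_le ho hmax
    have h3 := h.mul_es_erase_le ho
    have p0 := h (m + 1) (by omega)
    have p1 := hA m (by omega)
    have p2 := hA (m + 1) (by omega)
    have hxo : 0 < x o := by
      by_contra! hc
      have hm : (0 : ℝ) < m + 1 := by positivity
      have : (s.card : ℝ) * (x o * es (s.erase o) m x) ≤ 0 :=
        mul_nonpos_of_nonneg_of_nonpos (by positivity) (mul_nonpos_of_nonpos_of_nonneg hc p1.le)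
      nlinarith [mul_pos hm p0]
    have h4 : es s (m + 1) x ≤ N * (x o * es (s.erase o) m x) := by
      have e1 : es s (m + 1) x ≤ (m + 1) * es s (m + 1) x := by
        have : (0 : ℝ) ≤ m := by positivity
        nlinarith
      refine e1.trans (h2.trans ?_)
      gcongr
    rw [← mul_prod_erase t x hj, abs_mul]
    calc |x j| * |∏ i ∈ t.erase j, x i| * es s (m + 1) x ^ r
        ≤ (N * x o) * |∏ i ∈ t.erase j, x i| * (N * (x o * es (s.erase o) m x)) ^ r := by
          gcongr
          exact hx j (hts hj)
      _ = (N * x o) ^ (r + 1) * (|∏ i ∈ t.erase j, x i| * es (s.erase o) m x ^ r) := by ring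
      _ ≤ (N * x o) ^ (r + 1) * (N ^ ((r + 1) * (m + 1)) * es (s.erase o) (m + 1) x ^ (r + 1)) := by
          gcongr
      _ = N ^ ((r + 1) * (m + 1 + 1)) * (x o * es (s.erase o) (m + 1) x) ^ (r + 1) := by ring
      _ ≤ _ := by gcongr

theorem abs_es_le [Fintype ι] {s : Finset ι} {j : ℕ} {x : ι → ℝ} {B : ℝ} (hB : 0 ≤ B)
    (h : ∀ t ⊆ s, t.card = j → |∏ i ∈ t, x i| ≤ B) :
    |es s j x| ≤ 2 ^ Fintype.card ι * B := by
  unfold es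
  refine (abs_sum_le_sum_abs _ _).trans ?_
  refine (sum_le_card_nsmul _ _ B fun t ht =>
    h t (mem_powersetCard.1 ht).1 (mem_powersetCard.1 ht).2).trans ?_
  rw [nsmul_eq_mul]
  gcongr
  have : (s.powersetCard j).card ≤ 2 ^ Fintype.card ι := by
    rw [← Fintype.card_finset, ← Finset.card_univ]
    exact card_le_card (subset_univ _)
  exact_mod_cast this

/-- Removing a coordinate from a point of the Gårding cone. -/
theorem Garding.half_le_or {s : Finset ι} {x : ι → ℝ} {m : ℕ} (h : Garding s (m + 3) x)
    {j : ι} (hj : j ∈ s) :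
    es s (m + 1) x ≤ 2 * es (s.erase j) (m + 1) x ∨
      0 < x j ∧ es s (m + 2) x ≤ 2 * (x j * es (s.erase j) (m + 1) x) := by
  by_contra! hc
  obtain ⟨h1, h2⟩ := hc
  have p0 := h.erase j m (by omega)
  have p1 := h.erase j (m + 1) (by omega)
  have hN := es_newton (s.erase j) m x
  have e1 := es_erase hj m x
  have e2 := es_erase hj (m + 1) x
  have h3 : es (s.erase j) (m + 1) x < x j * es (s.erase j) m x := by linarith
  have hx : 0 < x j := by
    by_contra! hx
    nlinarith
  have h4 := h2 hx
  have h5 : x j * es (s.erase j) (m + 1) x < es (s.erase j) (m + 2) x := by linarith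
  -- With `A`, `B`, `D` of degrees `m`, `m + 1`, `m + 2` without `x j`, failure of both alternatives
  -- gives `A D > x_j A B > B²`, against Newton.
  nlinarith [mul_lt_mul_of_pos_left h5 p0, mul_lt_mul_of_pos_right h3 p1]

/-- By Newton the consecutive quotients decrease with the degree, so all lower ones are at least
`q`; multiply them. With `es s (m + 2) x` bounded, a large trace therefore forces `q` to be small.
-/
theorem Garding.pow_mul_le {s : Finset ι} {x : ι → ℝ} {q : ℝ} (hq : 0 ≤ q) (m : ℕ)
    (h : Garding s (m + 2) x) (hqm : q * es s (m + 1) x ≤ es s (m + 2) x) :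
    q ^ (m + 1) * es s 1 x ≤ es s (m + 2) x := by
  induction m with
  | zero => simpa using hqm
  | succ m ih =>
    have p1 := h (m + 1) (by omega)
    have p2 := h (m + 2) (by omega)
    have h1 : q * es s (m + 1) x ≤ es s (m + 2) x := by
      have := es_newton s (m + 1) x
      by_contra! hc
      nlinarith [mul_lt_mul_of_pos_left hc p2, mul_le_mul_of_nonneg_left hqm p1.le]
    have h2 := ih (h.mono (by omega)) h1
    calc q ^ (m + 1 + 1) * es s 1 x = q * (q ^ (m + 1) * es s 1 x) := by ring
      _ ≤ q * es s (m + 2) x := by gcongr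
      _ ≤ _ := hqm

theorem Garding.sh_pos {α : ℝ} (hα : 0 ≤ α) {s : Finset ι} {m : ℕ} {x : ι → ℝ}
    (h : Garding s (m + 1) x) : 0 < sh α s m x := by
  have h1 := h (m + 1) le_rfl
  have h2 := h m (by omega)
  unfold sh
  positivity

end SumHessian

/-! ### Bounds for the derivatives of the operator in terms of `q`. -/

namespace SumHessian

open Finset Polynomial Filter Topology

variable {ι : Type*} [DecidableEq ι]

/-- If `σ_{m+2} = q σ_{m+1}` is bounded then long products are small in terms of `q`. -/
theorem Garding.exists_abs_es_le [Fintype ι] (m : ℕ) {S : ℝ} (hS : 0 < S) : ∃ K : ℝ, 0 < K ∧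
    ∀ {x : ι → ℝ} {q : ℝ}, Garding univ (m + 3) x → 0 < q → q ≤ 1 →
      es univ (m + 2) x = q * es univ (m + 1) x → es univ (m + 2) x ≤ S →
      (∀ t : Finset ι, t.card = m + 1 → q * |∏ i ∈ t, x i| ≤ K) ∧
      (∀ t : Finset ι, t.card = m + 2 → |∏ i ∈ t, x i| ≤ K) ∧
      (∀ t : Finset ι, t.card = m + 3 → |∏ i ∈ t, x i| ≤ K * q) ∧
      (∀ t : Finset ι, t.card = m + 4 → |∏ i ∈ t, x i| ≤ K * q) := by
  set N : ℝ := Fintype.card ι + 1 with hN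
  have hN1 : 1 ≤ N := by simp [hN]
  have hNc : ((univ : Finset ι).card : ℝ) ≤ N := by simp [hN, Finset.card_univ]
  refine ⟨N ^ (3 * (m + 2)) * S, by positivity, fun {x q} h hq hq1 he hle => ?_⟩
  have p1 := h (m + 1) (by omega)
  -- Every factor beyond `m + 2` gains one `q`: by `he` the power `es univ (m + 2) x ^ r` equals `q
  -- ^ r * es univ (m + 1) x ^ r`, and the last power cancels.
  have key : ∀ r ≤ 2, ∀ t : Finset ι, t.card = m + 2 + r →
      |∏ i ∈ t, x i| ≤ N ^ (3 * (m + 2)) * S * q ^ r := by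
    intro r hr t ht
    have h1 := Garding.abs_prod_mul_le (m + 1) h hNc (r := r) (subset_univ t) (by omega)
    have h2 : N ^ ((r + 1) * (m + 1 + 1)) ≤ N ^ (3 * (m + 2)) :=
      pow_le_pow_right₀ hN1 (Nat.mul_le_mul_right _ (by omega))
    refine le_of_mul_le_mul_right (h1.trans ?_) (pow_pos p1 r)
    calc N ^ ((r + 1) * (m + 1 + 1)) * es univ (m + 2) x ^ (r + 1)
        = N ^ ((r + 1) * (m + 1 + 1)) * es univ (m + 2) x * es univ (m + 2) x ^ r := by ring
      _ ≤ N ^ (3 * (m + 2)) * S * es univ (m + 2) x ^ r := by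
          have := h (m + 2) (by omega)
          gcongr
      _ = _ := by rw [he]; ring
  refine ⟨fun t ht => ?_, fun t ht => by simpa using key 0 (by omega) t ht,
    fun t ht => by simpa using key 1 (by omega) t ht, fun t ht => ?_⟩
  · have h1 := Garding.abs_prod_mul_le m (h.mono (by omega)) hNc (r := 0) (subset_univ t)
      (by omega)
    simp only [pow_zero, mul_one, zero_add, one_mul, pow_one] at h1
    have h2 : N ^ (m + 1) ≤ N ^ (3 * (m + 2)) := pow_le_pow_right₀ hN1 (by omega)
    calc q * |∏ i ∈ t, x i| ≤ q * (N ^ (m + 1) * es univ (m + 1) x) := by gcongr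
      _ = N ^ (m + 1) * es univ (m + 2) x := by rw [he]; ring
      _ ≤ _ := by
        have := h (m + 2) (by omega)
        gcongr
  · refine (key 2 le_rfl t ht).trans ?_
    have : q ^ 2 ≤ q := by nlinarith
    gcongr

theorem mul_abs_es_le [Fintype ι] {s : Finset ι} {j : ℕ} {x : ι → ℝ} {a B : ℝ} (ha : 0 < a)
    (hB : 0 ≤ B) (h : ∀ t ⊆ s, t.card = j → a * |∏ i ∈ t, x i| ≤ B) :
    a * |es s j x| ≤ 2 ^ Fintype.card ι * B := by
  have := abs_es_le (x := x) (s := s) (j := j) (B := B / a) (by positivity) fun t ht hc => by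
    rw [le_div_iff₀ ha, mul_comm]; exact h t ht hc
  calc a * |es s j x| ≤ a * (2 ^ Fintype.card ι * (B / a)) := by gcongr
    _ = _ := by field_simp

theorem mul_abs_sh_le [Fintype ι] {s : Finset ι} {j : ℕ} {x : ι → ℝ} {a B α : ℝ} (ha : 0 < a)
    (hα : 0 ≤ α) (hB : 0 ≤ B) (h : ∀ t ⊆ s, t.card = j → a * |∏ i ∈ t, x i| ≤ B)
    (h' : ∀ t ⊆ s, t.card = j + 1 → a * |∏ i ∈ t, x i| ≤ B) :
    a * |sh α s j x| ≤ 2 ^ Fintype.card ι * (1 + α) * B := by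
  have h1 := mul_abs_es_le ha hB h
  have h2 := mul_abs_es_le ha hB h'
  have h3 : |sh α s j x| ≤ |es s (j + 1) x| + α * |es s j x| := by
    unfold sh
    refine (abs_add_le _ _).trans ?_
    rw [abs_mul, abs_of_nonneg hα]
  calc a * |sh α s j x| ≤ a * |es s (j + 1) x| + α * (a * |es s j x|) := by
        have := mul_le_mul_of_nonneg_left h3 ha.le
        linarith
    _ ≤ 2 ^ Fintype.card ι * B + α * (2 ^ Fintype.card ι * B) := by gcongr
    _ = _ := by ring

/-- Meant for `X = x o`, `F = F_j`, and `A`, `E`, `d` the operator functions of index `m + 2`, `m +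
1`, `m` without `o` and `j`. The two squares are treated apart: `E⁴ X³ = (X|E|)³ |E|`, and `(A d)²
X⁴ = (X|A|)² (X|d|)²` with `X|d| ≤ (1 + D) F` and `q F ≤ B`. -/
theorem sq_sub_mul_sq_mul_le {E A d F q X B D : ℝ} (hX : 1 ≤ X) (hq : 0 < q) (hq1 : q ≤ 1)
    (hB : 0 < B) (hD : 0 < D) (hF : 0 < F) (hd : F = E + X * d) (h1 : X * |E| ≤ B)
    (h2 : |E| ≤ D * q * F) (h3 : X * |A| ≤ B * q) (hF' : q * F ≤ B) :
    (E ^ 2 - A * d) ^ 2 * X ^ 3 ≤ (2 * B ^ 3 * D + 2 * B ^ 2 * (1 + D) ^ 2 * B) * q * F := by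
  have hX0 : 0 < X := by linarith
  have hE0 := abs_nonneg E
  have hA0 := abs_nonneg A
  have i1 : X * |d| ≤ (1 + D) * F := by
    rw [show X * |d| = |F - E| by
      rw [show F - E = X * d by linarith, abs_mul, abs_of_pos hX0]]
    refine (abs_sub _ _).trans ?_
    rw [abs_of_pos hF]
    have := mul_le_mul_of_nonneg_left hq1 (mul_pos hD hF).le
    linarith
  have i2 : E ^ 4 * X ^ 3 ≤ B ^ 3 * (D * q * F) := by
    calc E ^ 4 * X ^ 3 = (X * |E|) ^ 3 * |E| := by
          have : E ^ 4 = |E| ^ 4 := (Even.pow_abs ⟨2, rfl⟩ E).symm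
          rw [this]; ring
      _ ≤ B ^ 3 * (D * q * F) := by gcongr
  have i3 : (A * d) ^ 2 * X ^ 3 ≤ B ^ 2 * (1 + D) ^ 2 * B * (q * F) := by
    have h4 : (A * d) ^ 2 * X ^ 4 ≤ (B * q) ^ 2 * ((1 + D) * F) ^ 2 := by
      calc (A * d) ^ 2 * X ^ 4 = (X * |A|) ^ 2 * (X * |d|) ^ 2 := by
            rw [mul_pow, mul_pow, mul_pow, sq_abs, sq_abs]; ring
        _ ≤ _ := by gcongr
    have h5 : X ^ 3 ≤ X ^ 4 := pow_le_pow_right₀ hX (by omega)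
    have h6 : q * F * (q * F) ≤ B * (q * F) :=
      mul_le_mul_of_nonneg_right hF' (mul_pos hq hF).le
    calc (A * d) ^ 2 * X ^ 3 ≤ (A * d) ^ 2 * X ^ 4 :=
          mul_le_mul_of_nonneg_left h5 (sq_nonneg _)
      _ ≤ _ := h4
      _ = B ^ 2 * (1 + D) ^ 2 * (q * F * (q * F)) := by ring
      _ ≤ B ^ 2 * (1 + D) ^ 2 * (B * (q * F)) :=
          mul_le_mul_of_nonneg_left h6 (by positivity)
      _ = _ := by ring
  have i4 : (E ^ 2 - A * d) ^ 2 ≤ 2 * E ^ 4 + 2 * (A * d) ^ 2 := by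
    nlinarith [sq_nonneg (E ^ 2 + A * d)]
  have := mul_le_mul_of_nonneg_right i4 (pow_pos hX0 3).le
  linarith

-- The upper bounds come from counting factors: `F_j` is built from products of `m + 1` and `m + 2`
-- coordinates, multiplication by `x j` or `x o` inserts one more, and `Garding.exists_abs_es_le`
-- applies. Products of `m + 3` or `m + 4` coordinates carry the factor `q` that makes the error
-- terms small.
set_option maxHeartbeats 1000000 in
theorem Garding.exists_spectral_bounds_ratio [Fintype ι] (m : ℕ) {α c₀ C₀ : ℝ} (hα : 0 < α)
    (hc₀ : 0 < c₀) (hC₀ : 0 < C₀) : ∃ c C : ℝ, 0 < c ∧ 0 < C ∧ ∀ (x : ι → ℝ) (o : ι) (q : ℝ),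
      Garding univ (m + 3) x → (∀ i, x i ≤ x o) → c₀ ≤ sh α univ (m + 2) x →
      sh α univ (m + 2) x ≤ C₀ → 1 ≤ x o → 0 < q → q ≤ 1 →
      es univ (m + 2) x = q * es univ (m + 1) x →
      c ≤ sh α (univ.erase o) (m + 1) x * x o ∧
      (∀ j, sh α (univ.erase j) (m + 1) x * |x j| ≤ C) ∧
      (∀ j ≠ o, x o * |sh α ((univ.erase o).erase j) (m + 1) x| ≤ C) ∧
      (∀ j ≠ o, |sh α ((univ.erase o).erase j) (m + 1) x| ≤
        C * q * sh α (univ.erase j) (m + 1) x) ∧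
      (∀ j ≠ o, (sh α ((univ.erase o).erase j) (m + 1) x ^ 2 -
          sh α ((univ.erase o).erase j) (m + 2) x * sh α ((univ.erase o).erase j) m x) ^ 2 *
          x o ^ 3 ≤ C * q * sh α (univ.erase j) (m + 1) x) ∧
      (∀ j, -(C * q) ≤ x j) ∧
      sh α (univ.erase o) (m + 2) x ≤ C * q := by
  obtain ⟨K, hK, hprod⟩ := Garding.exists_abs_es_le (ι := ι) m (S := C₀ / α) (by positivity)
  set B : ℝ := 2 ^ Fintype.card ι * (1 + α) * K with hBdef
  have hB : 0 < B := by positivity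
  set n : ℝ := Fintype.card ι + 1 with hn
  have hn0 : 0 < n := by positivity
  set e : ℝ := c₀ / (1 + α) with hedef
  have he : 0 < e := by positivity
  set c : ℝ := α * e / (2 * n) with hcdef
  have hc : 0 < c := by positivity
  have hn1 : 1 ≤ n := by simp [hn]
  set D : ℝ := B / c with hD
  have hDpos : 0 < D := by positivity
  refine ⟨c, B + D + (2 * B ^ 3 * D + 2 * B ^ 2 * (1 + D) ^ 2 * B), hc, by positivity, ?_⟩
  intro x o q h hmax hFc hFC hxo hq hq1 hqe
  have p1 := h (m + 1) (by omega)
  have p2 := h (m + 2) (by omega)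
  have p3 := h (m + 3) (by omega)
  have hF : sh α univ (m + 2) x = es univ (m + 3) x + α * es univ (m + 2) x := rfl
  have hS : es univ (m + 2) x ≤ C₀ / α := by
    rw [le_div_iff₀ hα]; linarith
  obtain ⟨t1, t2, t3, t4⟩ := hprod h hq hq1 hqe hS
  -- Newton gives `es univ (m + 3) x ≤ q * es univ (m + 2) x`, so for `q ≤ 1` the lower bound on the
  -- operator passes to its lower order term.
  have hle : e ≤ es univ (m + 2) x := by
    have h1 : es univ (m + 3) x ≤ es univ (m + 2) x := by
      have h2 := es_newton univ (m + 1) x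
      have h3 : es univ (m + 1) x * es univ (m + 3) x ≤
          es univ (m + 1) x * (q * es univ (m + 2) x) := by
        calc _ ≤ _ := h2
          _ = _ := by rw [pow_two]; nth_rewrite 1 [hqe]; ring
      have h4 := le_of_mul_le_mul_left h3 p1
      nlinarith
    rw [hedef, div_le_iff₀ (by positivity)]
    linarith
  have hxo0 : 0 < x o := by linarith
  have pos1 : ∀ j, 0 < es (univ.erase j) (m + 1) x := fun j => h.erase j _ (by omega)
  have pos2 : ∀ j, 0 < es (univ.erase j) (m + 2) x := fun j => h.erase j _ (by omega)
  have Fpos : ∀ j, 0 < sh α (univ.erase j) (m + 1) x := fun j => (h.erase j).sh_pos hα.le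
  have Fge : ∀ j, α * es (univ.erase j) (m + 1) x ≤ sh α (univ.erase j) (m + 1) x := fun j => by
    have := pos2 j
    unfold sh; linarith
  have insert_prod : ∀ {i : ι} {t : Finset ι}, i ∉ t → ∀ y : ι → ℝ,
      |y i| * |∏ l ∈ t, y l| = |∏ l ∈ insert i t, y l| := fun hi y => by
    rw [prod_insert hi, abs_mul]
  have KqK : K * q ≤ K := by nlinarith
  have hBq : 2 ^ Fintype.card ι * (1 + α) * (K * q) = B * q := by rw [hBdef]; ring
  -- the derivative in the direction of the largest coordinate
  have c1 : c ≤ sh α (univ.erase o) (m + 1) x * x o := by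
    have h1 := (h.mono (l := m + 3) le_rfl).succ_mul_es_le (m := m + 1) (mem_univ o)
      fun i _ => hmax i
    push_cast at h1
    have h2 : ((univ : Finset ι).card : ℝ) ≤ n := by simp [hn, Finset.card_univ]
    have h3 : es univ (m + 2) x ≤ n * (x o * es (univ.erase o) (m + 1) x) := by
      have : (0 : ℝ) ≤ m := by positivity
      have h4 := pos1 o
      calc es univ (m + 2) x ≤ (m + 1 + 1) * es univ (m + 2) x := by nlinarith
        _ ≤ _ := h1
        _ ≤ _ := by gcongr
    have h5 := mul_le_mul_of_nonneg_right (Fge o) hxo0.le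
    rw [hcdef, div_le_iff₀ (by positivity)]
    have h6 : 0 < es (univ.erase o) (m + 1) x * x o := mul_pos (pos1 o) hxo0
    calc α * e ≤ α * (n * (x o * es (univ.erase o) (m + 1) x)) := by gcongr; linarith
      _ = n * (α * es (univ.erase o) (m + 1) x * x o) := by ring
      _ ≤ n * (sh α (univ.erase o) (m + 1) x * x o) := by gcongr
      _ ≤ _ := by
        have := mul_pos hn0 (mul_pos (Fpos o) hxo0)
        linarith
  have c2 : ∀ j, sh α (univ.erase j) (m + 1) x * |x j| ≤ B := by
    intro j
    rcases eq_or_ne (x j) 0 with h0 | h0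
    · simp [h0, hB.le]
    have := mul_abs_sh_le (s := univ.erase j) (j := m + 1) (x := x) (a := |x j|) (B := K)
      (abs_pos.2 h0) hα.le hK.le
      (fun t ht hc => by
        rw [insert_prod (fun hj => notMem_erase j _ (ht hj))]
        exact t2 _ (by rw [card_insert_of_notMem (fun hj => notMem_erase j _ (ht hj)), hc]))
      (fun t ht hc => by
        rw [insert_prod (fun hj => notMem_erase j _ (ht hj))]
        exact (t3 _ (by rw [card_insert_of_notMem (fun hj => notMem_erase j _ (ht hj)), hc])).trans
          KqK)
    rw [abs_of_pos (Fpos j)] at this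
    linarith
  have c2' : ∀ j, q * sh α (univ.erase j) (m + 1) x ≤ B := by
    intro j
    have := mul_abs_sh_le (s := univ.erase j) (j := m + 1) (x := x) (a := q) (B := K)
      hq hα.le hK.le (fun t _ hc => t1 t hc) (fun t _ hc =>
        (mul_le_of_le_one_left (abs_nonneg _) hq1).trans (t2 t hc))
    rwa [abs_of_pos (Fpos j)] at this
  have hmem : ∀ {j} {t : Finset ι}, t ⊆ (univ.erase o).erase j → o ∉ t ∧ j ∉ t := fun ht =>
    ⟨fun h1 => notMem_erase o _ (mem_of_mem_erase (ht h1)), fun h1 => notMem_erase _ _ (ht h1)⟩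
  have ins_o : ∀ {j} {t : Finset ι}, t ⊆ (univ.erase o).erase j →
      x o * |∏ i ∈ t, x i| = |∏ i ∈ insert o t, x i| := fun ht => by
    rw [← insert_prod (hmem ht).1, abs_of_pos hxo0]
  have c3 : ∀ j, x o * |sh α ((univ.erase o).erase j) (m + 1) x| ≤ B := by
    intro j
    refine mul_abs_sh_le hxo0 hα.le hK.le (fun t ht hc => ?_) (fun t ht hc => ?_)
    · rw [ins_o ht]
      exact t2 _ (by rw [card_insert_of_notMem (hmem ht).1, hc])
    · rw [ins_o ht]
      exact (t3 _ (by rw [card_insert_of_notMem (hmem ht).1, hc])).trans KqK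
  have c3' : ∀ j, x o * |sh α ((univ.erase o).erase j) (m + 2) x| ≤ B * q := by
    intro j
    rw [← hBq]
    refine mul_abs_sh_le hxo0 hα.le (by positivity) (fun t ht hc => ?_) (fun t ht hc => ?_)
    · rw [ins_o ht]
      exact t3 _ (by rw [card_insert_of_notMem (hmem ht).1, hc])
    · rw [ins_o ht]
      exact t4 _ (by rw [card_insert_of_notMem (hmem ht).1, hc])
  have c3'' : ∀ j ≠ o, 0 < x j →
      x o * x j * |sh α ((univ.erase o).erase j) (m + 1) x| ≤ B * q := by
    intro j hj hxj
    have hh : ∀ {t : Finset ι}, t ⊆ (univ.erase o).erase j →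
        x o * x j * |∏ i ∈ t, x i| = |∏ i ∈ insert o (insert j t), x i| ∧
        (insert o (insert j t)).card = t.card + 2 := fun {t} ht => by
      have h1 : o ∉ insert j t := by
        rw [mem_insert, not_or]; exact ⟨hj.symm, (hmem ht).1⟩
      rw [← insert_prod h1, ← insert_prod (hmem ht).2, abs_of_pos hxo0, abs_of_pos hxj,
        card_insert_of_notMem h1, card_insert_of_notMem (hmem ht).2]
      exact ⟨by ring, rfl⟩
    rw [← hBq]
    refine mul_abs_sh_le (by positivity) hα.le (by positivity) (fun t ht hc => ?_)
      (fun t ht hc => ?_)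
    · rw [(hh ht).1]
      exact t3 _ (by rw [(hh ht).2, hc])
    · rw [(hh ht).1]
      exact t4 _ (by rw [(hh ht).2, hc])
  have ce : c ≤ α * e / 2 := by
    rw [hcdef]
    apply div_le_div_of_nonneg_left (by positivity) (by positivity)
    linarith
  -- Either `F_j ≥ c / q`, or `x j > 0` and `F_j ≥ c / x j`. In the first case `c3` bounds `E_j` by
  -- `q F_j`; in the second, `c3''` does, as inserting both `x o` and `x j` gains a `q`. A negative
  -- `x j` falls under the first case.
  have dich : ∀ j, c ≤ q * sh α (univ.erase j) (m + 1) x ∨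
      0 < x j ∧ c ≤ sh α (univ.erase j) (m + 1) x * x j := by
    intro j
    rcases h.half_le_or (mem_univ j) with h1 | ⟨h1, h2⟩
    · left
      calc c ≤ α * e / 2 := ce
        _ ≤ α * es univ (m + 2) x / 2 := by gcongr
        _ = q * (α * (es univ (m + 1) x / 2)) := by rw [hqe]; ring
        _ ≤ q * (α * es (univ.erase j) (m + 1) x) := by gcongr; linarith
        _ ≤ _ := by gcongr; exact Fge j
    · refine Or.inr ⟨h1, ?_⟩
      calc c ≤ α * e / 2 := ce
        _ ≤ α * (es univ (m + 2) x / 2) := by rw [mul_div_assoc]; gcongr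
        _ ≤ α * (x j * es (univ.erase j) (m + 1) x) := by gcongr; linarith
        _ = α * es (univ.erase j) (m + 1) x * x j := by ring
        _ ≤ _ := by gcongr; exact Fge j
  have c4 : ∀ j ≠ o, |sh α ((univ.erase o).erase j) (m + 1) x| ≤
      D * q * sh α (univ.erase j) (m + 1) x := by
    intro j hj
    have hE := abs_nonneg (sh α ((univ.erase o).erase j) (m + 1) x)
    have hFj := Fpos j
    rw [hD, div_mul_eq_mul_div, div_mul_eq_mul_div, le_div_iff₀ hc]
    rcases dich j with h1 | ⟨h1, h2⟩
    · have h2 : |sh α ((univ.erase o).erase j) (m + 1) x| ≤ B := by nlinarith [c3 j]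
      calc _ ≤ B * (q * sh α (univ.erase j) (m + 1) x) := by gcongr
        _ = _ := by ring
    · have h3 : x j * |sh α ((univ.erase o).erase j) (m + 1) x| ≤ B * q := by
        have := mul_nonneg h1.le hE
        nlinarith [c3'' j hj h1]
      calc _ ≤ |sh α ((univ.erase o).erase j) (m + 1) x| *
            (sh α (univ.erase j) (m + 1) x * x j) := by gcongr
        _ = (x j * |sh α ((univ.erase o).erase j) (m + 1) x|) * sh α (univ.erase j) (m + 1) x := by
          ring
        _ ≤ B * q * sh α (univ.erase j) (m + 1) x := by gcongr
  have c5 : ∀ j ≠ o, (sh α ((univ.erase o).erase j) (m + 1) x ^ 2 -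
      sh α ((univ.erase o).erase j) (m + 2) x * sh α ((univ.erase o).erase j) m x) ^ 2 *
      x o ^ 3 ≤ (2 * B ^ 3 * D + 2 * B ^ 2 * (1 + D) ^ 2 * B) * q *
        sh α (univ.erase j) (m + 1) x := by
    intro j hj
    have h1 := c3 j
    have h2 := c4 j hj
    have h3 := c3' j
    have hd := sh_erase α (mem_erase.2 ⟨hj.symm, mem_univ o⟩) m x
    rw [erase_right_comm] at hd
    have hFj := Fpos j
    have hF' := c2' j
    set E := sh α ((univ.erase o).erase j) (m + 1) x
    set A := sh α ((univ.erase o).erase j) (m + 2) x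
    set d := sh α ((univ.erase o).erase j) m x
    set Fj := sh α (univ.erase j) (m + 1) x
    exact sq_sub_mul_sq_mul_le hxo hq hq1 hB hDpos hFj hd h1 h2 h3 hF'
  have extra : 0 ≤ 2 * B ^ 3 * D + 2 * B ^ 2 * (1 + D) ^ 2 * B := by positivity
  have mono : ∀ {C' y : ℝ}, C' ≤ B + D + (2 * B ^ 3 * D + 2 * B ^ 2 * (1 + D) ^ 2 * B) →
      0 ≤ y → C' * y ≤ (B + D + (2 * B ^ 3 * D + 2 * B ^ 2 * (1 + D) ^ 2 * B)) * y :=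
    fun h1 h2 => mul_le_mul_of_nonneg_right h1 h2
  refine ⟨c1, fun j => (c2 j).trans (by linarith), fun j _ => (c3 j).trans (by linarith),
    fun j hj => (c4 j hj).trans ?_, fun j hj => (c5 j hj).trans ?_, fun j => ?_, ?_⟩
  · have := mono (C' := D) (by linarith) (mul_pos hq (Fpos j)).le
    linarith
  · have := mono (C' := 2 * B ^ 3 * D + 2 * B ^ 2 * (1 + D) ^ 2 * B) (by linarith)
      (mul_pos hq (Fpos j)).le
    linarith
  · rcases le_or_gt 0 (x j) with h0 | h0
    · have := mul_nonneg (by positivity :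
        0 ≤ B + D + (2 * B ^ 3 * D + 2 * B ^ 2 * (1 + D) ^ 2 * B)) hq.le
      linarith
    · rcases dich j with h1 | ⟨h1, -⟩
      · have h2 := c2 j
        rw [abs_of_neg h0] at h2
        have h3 : -x j ≤ D * q := by
          rw [hD, div_mul_eq_mul_div, le_div_iff₀ hc]
          calc -x j * c ≤ -x j * (q * sh α (univ.erase j) (m + 1) x) := by
                gcongr; linarith
            _ = (sh α (univ.erase j) (m + 1) x * -x j) * q := by ring
            _ ≤ B * q := by gcongr
        have := mono (C' := D) (by linarith) hq.le
        linarith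
      · exact absurd h1 (not_lt.2 h0.le)
  · have h1 : x o * |sh α (univ.erase o) (m + 2) x| ≤ B * q := by
      rw [← hBq]
      refine mul_abs_sh_le hxo0 hα.le (by positivity) (fun t ht hc => ?_) (fun t ht hc => ?_)
      · have ho : o ∉ t := fun h1 => notMem_erase o _ (ht h1)
        rw [show x o * |∏ i ∈ t, x i| = |∏ i ∈ insert o t, x i| by
          rw [← insert_prod ho, abs_of_pos hxo0]]
        exact t3 _ (by rw [card_insert_of_notMem ho, hc])
      · have ho : o ∉ t := fun h1 => notMem_erase o _ (ht h1)
        rw [show x o * |∏ i ∈ t, x i| = |∏ i ∈ insert o t, x i| by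
          rw [← insert_prod ho, abs_of_pos hxo0]]
        exact t4 _ (by rw [card_insert_of_notMem ho, hc])
    have h2 := mono (C' := B) (by linarith) hq.le
    have h3 := abs_nonneg (sh α (univ.erase o) (m + 2) x)
    have h4 := le_abs_self (sh α (univ.erase o) (m + 2) x)
    nlinarith

end SumHessian

/-! ### The concavity inequality with one large coordinate. -/

namespace SumHessian

open Finset Polynomial Filter Topology

variable {ι : Type*} [DecidableEq ι]

theorem sum_sum_erase_split [Fintype ι] (o : ι) (g : ι → ι → ℝ) :
    ∑ i, ∑ j ∈ univ.erase i, g i j = ∑ j ∈ univ.erase o, (g o j + g j o) +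
      ∑ i ∈ univ.erase o, ∑ j ∈ (univ.erase i).erase o, g i j := by
  rw [← add_sum_erase univ _ (mem_univ o), sum_add_distrib, add_assoc]
  congr 1
  rw [← sum_add_distrib]
  refine sum_congr rfl fun i hi => ?_
  rw [add_sum_erase]
  exact mem_erase.2 ⟨(ne_of_mem_erase hi).symm, mem_univ o⟩

/-- A large top coordinate replaces the small parameter: if `q > δ`, then `x o * δ ^ (m + 1) ≤ q ^
(m + 1) * es univ 1 x ≤ es univ (m + 2) x ≤ C₀ / α`, which the choice of `Λ` excludes. -/
theorem Garding.exists_spectral_bounds_of_pos [Fintype ι] (m : ℕ) {α c₀ C₀ : ℝ} (hα : 0 < α)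
    (hc₀ : 0 < c₀) (hC₀ : 0 < C₀) : ∃ c C : ℝ, 0 < c ∧ 0 < C ∧ ∀ ε > 0, ∃ Λ ≥ 1,
      ∀ (x : ι → ℝ) (o : ι),
      Garding univ (m + 3) x → (∀ i, x i ≤ x o) → c₀ ≤ sh α univ (m + 2) x →
      sh α univ (m + 2) x ≤ C₀ → Λ ≤ x o →
      c ≤ sh α (univ.erase o) (m + 1) x * x o ∧
      (∀ j, sh α (univ.erase j) (m + 1) x * |x j| ≤ C) ∧
      (∀ j ≠ o, x o * |sh α ((univ.erase o).erase j) (m + 1) x| ≤ C) ∧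
      (∀ j ≠ o, |sh α ((univ.erase o).erase j) (m + 1) x| ≤
        sh α (univ.erase j) (m + 1) x / 4) ∧
      (∀ j ≠ o, (sh α (univ.erase o) (m + 1) x * sh α (univ.erase j) (m + 1) x -
          sh α univ (m + 2) x * sh α ((univ.erase o).erase j) m x) ^ 2 *
          x o ^ 3 ≤ ε * sh α (univ.erase j) (m + 1) x) ∧
      (∀ j, -(x o / 2) ≤ x j) ∧
      sh α univ (m + 2) x - sh α (univ.erase o) (m + 1) x * x o ≤ ε := by
  obtain ⟨c, C, hc, hC, H⟩ := Garding.exists_spectral_bounds_ratio (ι := ι) m hα hc₀ hC₀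
  refine ⟨c, C, hc, hC, fun ε hε => ?_⟩
  set δ : ℝ := min (min 1 (1 / (4 * C))) (ε / C) with hδ
  have hδ0 : 0 < δ := by positivity
  have hδ1 : δ ≤ 1 := (min_le_left _ _).trans (min_le_left _ _)
  have hδ2 : C * δ ≤ 1 / 4 := by
    have : δ ≤ 1 / (4 * C) := (min_le_left _ _).trans (min_le_right _ _)
    calc C * δ ≤ C * (1 / (4 * C)) := by gcongr
      _ = 1 / 4 := by field_simp
  have hδ3 : C * δ ≤ ε := by
    have : δ ≤ ε / C := min_le_right _ _
    calc C * δ ≤ C * (ε / C) := by gcongr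
      _ = ε := by field_simp
  refine ⟨max 1 (C₀ / α / δ ^ (m + 1) + 1), le_max_left _ _, fun x o h hmax hFc hFC hxo => ?_⟩
  have p1 := h (m + 1) (by omega)
  have p2 := h (m + 2) (by omega)
  have p3 := h (m + 3) (by omega)
  have hF : sh α univ (m + 2) x = es univ (m + 3) x + α * es univ (m + 2) x := rfl
  have hS : es univ (m + 2) x ≤ C₀ / α := by
    rw [le_div_iff₀ hα]; linarith
  have hxo1 : 1 ≤ x o := (le_max_left _ _).trans hxo
  have hxo2 : C₀ / α / δ ^ (m + 1) < x o := by
    have := (le_max_right _ _).trans hxo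
    linarith
  set q := es univ (m + 2) x / es univ (m + 1) x with hq
  have hq0 : 0 < q := div_pos p2 p1
  have hqe : es univ (m + 2) x = q * es univ (m + 1) x := by rw [hq]; field_simp
  have hqδ : q ≤ δ := by
    by_contra! hlt
    have h1 := (h.mono (l := m + 2) (by omega)).pow_mul_le hq0.le m hqe.ge
    have h2 := (h.mono (l := 2) (by omega)).mul_es_erase_le (m := 0) (mem_univ o)
    simp only [es_zero, mul_one, zero_add] at h2
    rw [div_lt_iff₀ (by positivity)] at hxo2
    have h3 : x o * δ ^ (m + 1) ≤ q ^ (m + 1) * es univ 1 x := by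
      rw [mul_comm]
      gcongr
    linarith
  have hCq : C * q ≤ C * δ := by gcongr
  obtain ⟨g1, g2, g3, g4, g5, g6, g7⟩ :=
    H x o q h hmax hFc hFC hxo1 hq0 (hqδ.trans hδ1) hqe
  have Fpos : ∀ j, 0 < sh α (univ.erase j) (m + 1) x := fun j => (h.erase j).sh_pos hα.le
  refine ⟨g1, g2, g3, fun j hj => (g4 j hj).trans ?_, fun j hj => ?_, fun j => ?_, ?_⟩
  · have := mul_le_mul_of_nonneg_right (hCq.trans hδ2) (Fpos j).le
    linarith
  · have e1 := sh_erase α (mem_univ o) (m + 1) x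
    have e2 := sh_erase α (mem_erase.2 ⟨hj, mem_univ j⟩ : j ∈ univ.erase o) (m + 1) x
    have e3 := sh_erase α (mem_erase.2 ⟨hj, mem_univ j⟩ : j ∈ univ.erase o) m x
    have e4 := sh_erase α (mem_erase.2 ⟨hj.symm, mem_univ o⟩ : o ∈ univ.erase j) m x
    rw [erase_right_comm] at e4
    have := g5 j hj
    -- The operator is affine in `x o` and in `x j`, namely `F = A + (x_o + x_j) E + x_o x_j d`,
    -- whence `F_o F_j - F F_oj = E² - A d`.
    rw [show sh α (univ.erase o) (m + 1) x * sh α (univ.erase j) (m + 1) x -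
          sh α univ (m + 2) x * sh α ((univ.erase o).erase j) m x =
        sh α ((univ.erase o).erase j) (m + 1) x ^ 2 -
          sh α ((univ.erase o).erase j) (m + 2) x * sh α ((univ.erase o).erase j) m x by
      rw [e1, e2, e4, e3]; ring]
    have h1 := mul_le_mul_of_nonneg_right (hCq.trans hδ3) (Fpos j).le
    linarith
  · have := g6 j
    linarith
  · have e1 := sh_erase α (mem_univ o) (m + 1) x
    linarith

/-- A concavity inequality for `F = σ_{m+3} + α σ_{m+2}` at points of the Gårding cone with one
large coordinate, together with bounds for the derivatives of `F`. -/
theorem Garding.exists_spectral_bounds [Fintype ι] (m : ℕ) {α c₀ C₀ : ℝ} (hα : 0 < α)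
    (hc₀ : 0 < c₀) (hC₀ : 0 < C₀) : ∃ c C : ℝ, 0 < c ∧ 0 < C ∧ ∀ δ > 0, ∃ Λ ≥ 1,
      ∀ (x : ι → ℝ) (o : ι),
      Garding univ (m + 3) x → (∀ i, x i ≤ x o) → c₀ ≤ sh α univ (m + 2) x →
      sh α univ (m + 2) x ≤ C₀ → Λ ≤ x o →
      c ≤ sh α (univ.erase o) (m + 1) x * x o ∧
      (∀ j, sh α (univ.erase j) (m + 1) x * |x j| ≤ C) ∧
      (∀ j ≠ o, x o * |sh α ((univ.erase o).erase j) (m + 1) x| ≤ C) ∧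
      (∀ j ≠ o, |sh α ((univ.erase o).erase j) (m + 1) x| ≤
        sh α (univ.erase j) (m + 1) x / 4) ∧
      (∀ j, -(x o / 2) ≤ x j) ∧
      sh α univ (m + 2) x - sh α (univ.erase o) (m + 1) x * x o ≤ δ ∧
      ∀ ξ : ι → ℝ, (1 - δ) * (sh α (univ.erase o) (m + 1) x ^ 2 * ξ o ^ 2) ≤
        (∑ i, ξ i * sh α (univ.erase i) (m + 1) x) ^ 2 -
        sh α univ (m + 2) x *
          ∑ i, ∑ j ∈ univ.erase i, ξ i * ξ j * sh α ((univ.erase i).erase j) m x +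
        sh α univ (m + 2) x / x o *
          ∑ j ∈ univ.erase o, sh α (univ.erase j) (m + 1) x * ξ j ^ 2 := by
  obtain ⟨c, C, hc, hC, H⟩ := Garding.exists_spectral_bounds_of_pos (ι := ι) m hα hc₀ hC₀
  refine ⟨c, C, hc, hC, fun δ hδ => ?_⟩
  set n : ℝ := Fintype.card ι + 1 with hn
  have hn0 : 0 < n := by positivity
  set ε := min δ (δ * c₀ * c ^ 2 / n) with hε
  have hε0 : 0 < ε := by positivity
  obtain ⟨Λ, hΛ, H⟩ := H ε hε0
  refine ⟨Λ, hΛ, fun x o h hmax hFc hFC hxo => ?_⟩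
  obtain ⟨g1, g2, g3, g4, g5, g6, g7⟩ := H x o h hmax hFc hFC hxo
  refine ⟨g1, g2, g3, g4, g6, g7.trans (min_le_left _ _), fun ξ => ?_⟩
  have hxo0 : 0 < x o := by linarith
  have Fpos : ∀ j, 0 < sh α (univ.erase j) (m + 1) x := fun j => (h.erase j).sh_pos hα.le
  have hF0 : 0 < sh α univ (m + 2) x := by linarith
  set F := sh α univ (m + 2) x with hFdef
  set Fd : ι → ℝ := fun j => sh α (univ.erase j) (m + 1) x with hFd
  set Fdd : ι → ι → ℝ := fun i j => sh α ((univ.erase i).erase j) m x with hFdd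
  have hsymm : ∀ i j, Fdd i j = Fdd j i := fun i j => by simp only [hFdd, erase_right_comm]
  -- Log-concavity is used only for `ξ` with its `o`-component removed. As `F_oo = 0`, what remains
  -- is `F_o² ξ_o²` and cross terms with coefficients `F_o F_j - F F_oj`.
  have hlog := h.sh_mul_hessian_le hα.le (Function.update ξ o 0)
  rw [sum_sum_erase_split o, ← add_sum_erase univ _ (mem_univ o)] at hlog
  simp only [Function.update_self, zero_mul, mul_zero, add_zero, sum_const_zero, zero_add]
    at hlog
  have s1 : ∑ i ∈ univ.erase o, ∑ j ∈ (univ.erase i).erase o, Function.update ξ o 0 i *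
      Function.update ξ o 0 j * sh α ((univ.erase i).erase j) m x =
      ∑ i ∈ univ.erase o, ∑ j ∈ (univ.erase i).erase o, ξ i * ξ j * Fdd i j :=
    sum_congr rfl fun i hi => sum_congr rfl fun j hj => by
      rw [Function.update_of_ne (ne_of_mem_erase hi), Function.update_of_ne (ne_of_mem_erase hj)]
  have s2 : ∑ i ∈ univ.erase o, Function.update ξ o 0 i * sh α (univ.erase i) (m + 1) x =
      ∑ i ∈ univ.erase o, ξ i * Fd i :=
    sum_congr rfl fun i hi => by rw [Function.update_of_ne (ne_of_mem_erase hi)]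
  rw [s1, s2] at hlog
  change (1 - δ) * (Fd o ^ 2 * ξ o ^ 2) ≤ (∑ i, ξ i * Fd i) ^ 2 -
    F * (∑ i, ∑ j ∈ univ.erase i, ξ i * ξ j * Fdd i j) +
    F / x o * ∑ j ∈ univ.erase o, Fd j * ξ j ^ 2
  rw [sum_sum_erase_split o, ← add_sum_erase univ (fun i => ξ i * Fd i) (mem_univ o)]
  set η := ∑ i ∈ univ.erase o, ξ i * Fd i with hη
  set Q := ∑ i ∈ univ.erase o, ∑ j ∈ (univ.erase i).erase o, ξ i * ξ j * Fdd i j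
  -- Completing the square with `F / x_o * F_j ξ_j²` costs `M² x_o / (F F_j) * ξ_o²`. Since `M² x_o³
  -- ≤ ε F_j`, `F ≥ c₀` and `F_o ≥ c / x_o`, the choice of `ε` makes this at most `δ / n * F_o²
  -- ξ_o²`.
  have hcross : ∀ j ∈ univ.erase o, -(δ / n * (Fd o ^ 2 * ξ o ^ 2)) ≤
      2 * ξ o * ((Fd o * Fd j - F * Fdd o j) * ξ j) + F / x o * (Fd j * ξ j ^ 2) := by
    intro j hj
    have h5 := g5 j (ne_of_mem_erase hj)
    change (Fd o * Fd j - F * Fdd o j) ^ 2 * x o ^ 3 ≤ ε * Fd j at h5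
    set M := Fd o * Fd j - F * Fdd o j
    have hFj : 0 < Fd j := Fpos j
    have hFo : c / x o ≤ Fd o := by rw [div_le_iff₀ hxo0]; exact g1
    have k1 : M ^ 2 * x o / (F * Fd j) ≤ δ / n * Fd o ^ 2 := by
      have k2 : M ^ 2 * x o / (F * Fd j) ≤ ε / (F * x o ^ 2) := by
        rw [div_le_div_iff₀ (by positivity) (by positivity)]
        calc M ^ 2 * x o * (F * x o ^ 2) = F * (M ^ 2 * x o ^ 3) := by ring
          _ ≤ F * (ε * Fd j) := by gcongr
          _ = _ := by ring
      have k3 : ε / (F * x o ^ 2) ≤ (δ * c₀ * c ^ 2 / n) / (c₀ * x o ^ 2) := by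
        have : ε ≤ δ * c₀ * c ^ 2 / n := min_le_right _ _
        gcongr
      have k4 : (δ * c₀ * c ^ 2 / n) / (c₀ * x o ^ 2) = δ / n * (c / x o) ^ 2 := by
        field_simp
      calc _ ≤ _ := k2
        _ ≤ _ := k3
        _ = _ := k4
        _ ≤ _ := by gcongr
    have k5 : 0 ≤ (M ^ 2 * x o / (F * Fd j)) * ξ o ^ 2 + 2 * ξ o * (M * ξ j) +
        F / x o * (Fd j * ξ j ^ 2) := by
      have : (M ^ 2 * x o / (F * Fd j)) * ξ o ^ 2 + 2 * ξ o * (M * ξ j) +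
        F / x o * (Fd j * ξ j ^ 2) = (M * x o * ξ o + F * Fd j * ξ j) ^ 2 / (F * Fd j * x o) := by
        field_simp
        ring
      rw [this]
      positivity
    have := mul_le_mul_of_nonneg_right k1 (sq_nonneg (ξ o))
    linarith
  have hsum := sum_le_sum hcross
  rw [sum_add_distrib, ← mul_sum, ← mul_sum, sum_const, nsmul_eq_mul] at hsum
  have hcard : ((univ.erase o).card : ℝ) * -(δ / n * (Fd o ^ 2 * ξ o ^ 2)) ≥
      -(δ * (Fd o ^ 2 * ξ o ^ 2)) := by
    have h1 : ((univ.erase o).card : ℝ) ≤ n := by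
      have := card_le_card (erase_subset o univ)
      rw [Finset.card_univ] at this
      have h2 : ((univ.erase o).card : ℝ) ≤ Fintype.card ι := by exact_mod_cast this
      linarith
    have h2 : 0 ≤ δ / n * (Fd o ^ 2 * ξ o ^ 2) := by positivity
    have h3 := mul_le_mul_of_nonneg_right h1 h2
    have h4 : n * (δ / n * (Fd o ^ 2 * ξ o ^ 2)) = δ * (Fd o ^ 2 * ξ o ^ 2) := by field_simp
    linarith
  have e1 : ∑ j ∈ univ.erase o, (ξ o * ξ j * Fdd o j + ξ j * ξ o * Fdd j o) =
      2 * ξ o * ∑ j ∈ univ.erase o, Fdd o j * ξ j := by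
    rw [mul_sum]
    refine sum_congr rfl fun j _ => ?_
    rw [hsymm j o]; ring
  have e2 : ∑ j ∈ univ.erase o, (Fd o * Fd j - F * Fdd o j) * ξ j =
      Fd o * η - F * ∑ j ∈ univ.erase o, Fdd o j * ξ j := by
    rw [hη, mul_sum, mul_sum, ← sum_sub_distrib]
    refine sum_congr rfl fun j _ => by ring
  rw [e2] at hsum
  rw [e1]
  linarith

end SumHessian

/-! ### Algebra at the maximum point. -/

namespace SumHessian

open Finset Polynomial Filter Topology

variable {ι : Type*} [DecidableEq ι]

/-- Directions other than `o`. Expanding the square cancels `u² / w²`, and the part of `2 E a²`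
containing `N² u² l²` is absorbed by `F a²` thanks to `|E| ≤ F / 4`; the remaining part is small
because `lam * |E|` is bounded. -/
theorem small_direction_bound {F E l u w N lam C K : ℝ} (hw : 0 < w) (hN : 0 < N) (hl : 0 < lam)
    (hC : 0 < C) (hF : 0 < F) (hFl : F * |l| ≤ C) (hE : lam * |E| ≤ C)
    (hE4 : |E| ≤ F / 4) (hu : u ^ 2 ≤ K) :
    -(C / w) - 2 * N * K * C / w - 4 * C * K / (lam * w ^ 2) ≤
      F * (-l / w - u ^ 2 / w ^ 2 + (u / w - N * u * l) ^ 2 + N * l ^ 2) -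
        2 * E * (u / w - N * u * l) ^ 2 := by
  set a := u / w - N * u * l with ha
  have hE0 := abs_nonneg E
  have h1 : E * a ^ 2 ≤ |E| * a ^ 2 := by gcongr; exact le_abs_self E
  have h2 : a ^ 2 ≤ 2 * (u ^ 2 / w ^ 2) + 2 * (N ^ 2 * u ^ 2 * l ^ 2) := by
    have : 0 ≤ (u / w + N * u * l) ^ 2 := sq_nonneg _
    have e : u ^ 2 / w ^ 2 = (u / w) ^ 2 := by rw [div_pow]
    rw [ha, e]
    nlinarith
  have h3 : |E| * a ^ 2 ≤ |E| * (2 * (u ^ 2 / w ^ 2) + 2 * (N ^ 2 * u ^ 2 * l ^ 2)) := by gcongr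
  have h4 : |E| * (u ^ 2 / w ^ 2) ≤ C * K / (lam * w ^ 2) := by
    have : |E| ≤ C / lam := by rw [le_div_iff₀ hl]; linarith
    calc |E| * (u ^ 2 / w ^ 2) ≤ C / lam * (K / w ^ 2) := by gcongr
      _ = _ := by rw [div_mul_div_comm]
  have h5 : |E| * (N ^ 2 * u ^ 2 * l ^ 2) ≤ F / 4 * (N ^ 2 * u ^ 2 * l ^ 2) := by gcongr
  have h6 : F * (l / w) ≤ C / w := by
    rw [← mul_div_assoc]
    gcongr
    exact (mul_le_mul_of_nonneg_left (le_abs_self l) hF.le).trans hFl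
  have h7 : F * (2 * N * u ^ 2 * l / w) ≤ 2 * N * K * C / w := by
    rw [← mul_div_assoc]
    refine div_le_div_of_nonneg_right ?_ hw.le
    calc F * (2 * N * u ^ 2 * l) = 2 * N * u ^ 2 * (F * l) := by ring
      _ ≤ 2 * N * u ^ 2 * C := by
        gcongr
        exact (mul_le_mul_of_nonneg_left (le_abs_self l) hF.le).trans hFl
      _ ≤ 2 * N * K * C := by gcongr
  have h8 : 0 ≤ F * (N * l ^ 2) := by positivity
  have h9 : a ^ 2 = u ^ 2 / w ^ 2 - 2 * N * u ^ 2 * l / w + N ^ 2 * u ^ 2 * l ^ 2 := by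
    rw [ha]; field_simp; ring
  have h10 : F * (-l / w - u ^ 2 / w ^ 2 + a ^ 2 + N * l ^ 2) =
      -(F * (l / w)) - F * (2 * N * u ^ 2 * l / w) + F * (N ^ 2 * u ^ 2 * l ^ 2) +
        F * (N * l ^ 2) := by rw [h9]; ring
  rw [h10]
  have h11 : 4 * C * K / (lam * w ^ 2) = 4 * (C * K / (lam * w ^ 2)) := by ring
  rw [h11]
  linarith

/-- Direction `o`. Here only a fraction `d` of the negative square remains, and it costs at most `u²
/ w²` plus half of the good term `N lam²`; the other half gives `N / 2 * c * lam`. -/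
theorem large_direction_bound {F u w N lam C K c d : ℝ} (hw : 0 < w) (hN : 0 < N) (hl : 0 < lam)
    (hC : 0 < C) (hF : 0 < F) (hFl : F * lam ≤ C) (hcF : c ≤ F * lam) (hd : 0 ≤ d)
    (hd1 : 2 * d ≤ 1) (hdN : 4 * d * N * K ≤ 1) (hu : u ^ 2 ≤ K) :
    N / 2 * c * lam - C / w - 2 * C * K / (lam * w ^ 2) ≤
      F * (-lam / w - u ^ 2 / w ^ 2 - d * (u / w - N * u * lam) ^ 2 + N * lam ^ 2) := by
  set a := u / w - N * u * lam with ha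
  have h2 : a ^ 2 ≤ 2 * (u ^ 2 / w ^ 2) + 2 * (N ^ 2 * u ^ 2 * lam ^ 2) := by
    have : 0 ≤ (u / w + N * u * lam) ^ 2 := sq_nonneg _
    have e : u ^ 2 / w ^ 2 = (u / w) ^ 2 := by rw [div_pow]
    rw [ha, e]
    nlinarith
  have hFC : F ≤ C / lam := by rw [le_div_iff₀ hl]; exact hFl
  have h4 : F * (u ^ 2 / w ^ 2) ≤ C * K / (lam * w ^ 2) := by
    calc F * (u ^ 2 / w ^ 2) ≤ C / lam * (K / w ^ 2) := by gcongr
      _ = _ := by rw [div_mul_div_comm]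
  have h0 : 0 ≤ F * (u ^ 2 / w ^ 2) := by positivity
  have h3 : d * a ^ 2 ≤ u ^ 2 / w ^ 2 + N / 2 * lam ^ 2 := by
    calc d * a ^ 2 ≤ d * (2 * (u ^ 2 / w ^ 2) + 2 * (N ^ 2 * u ^ 2 * lam ^ 2)) := by gcongr
      _ = (2 * d) * (u ^ 2 / w ^ 2) + 2 * d * N ^ 2 * lam ^ 2 * u ^ 2 := by ring
      _ ≤ 1 * (u ^ 2 / w ^ 2) + 2 * d * N ^ 2 * lam ^ 2 * K := by gcongr
      _ = u ^ 2 / w ^ 2 + (4 * d * N * K) * (N / 2 * lam ^ 2) := by ring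
      _ ≤ u ^ 2 / w ^ 2 + 1 * (N / 2 * lam ^ 2) := by gcongr
      _ = _ := by ring
  have h5 := mul_le_mul_of_nonneg_left h3 hF.le
  have h6 : F * (lam / w) ≤ C / w := by
    rw [← mul_div_assoc]
    gcongr
  have h7 : N / 2 * c * lam ≤ F * (N / 2 * lam ^ 2) := by
    calc N / 2 * c * lam ≤ N / 2 * (F * lam) * lam := by gcongr
      _ = _ := by ring
  have h8 : F * (-lam / w - u ^ 2 / w ^ 2 - d * a ^ 2 + N * lam ^ 2) =
      -(F * (lam / w)) - F * (u ^ 2 / w ^ 2) - F * (d * a ^ 2) + 2 * (F * (N / 2 * lam ^ 2)) := by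
    ring
  rw [h8]
  have h11 : 2 * C * K / (lam * w ^ 2) = 2 * (C * K / (lam * w ^ 2)) := by ring
  rw [h11]
  linarith

theorem mul_le_of_le_add_inv {w lam R W : ℝ} (hw : 0 < w) (hl : 0 < lam) (hR : 0 < R)
    (hwW : w ≤ W) (h : lam ≤ R * (1 / w + 1 / (lam * w ^ 2) + 1)) :
    w * lam ≤ 1 + R * (2 + W) := by
  have hW : 0 < W := hw.trans_le hwW
  by_contra! hc
  have h1 : 1 < w * lam := by
    have : 0 < R * (2 + W) := by positivity
    linarith
  have h2 : w * lam ≤ R * (1 + 1 / (w * lam) + w) := by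
    calc w * lam ≤ w * (R * (1 / w + 1 / (lam * w ^ 2) + 1)) := by gcongr
      _ = _ := by field_simp
  have h3 : 1 / (w * lam) ≤ 1 := by
    rw [div_le_one (by linarith)]; linarith
  have h4 : R * (1 + 1 / (w * lam) + w) ≤ R * (2 + W) := by
    gcongr
    linarith
  linarith

set_option maxHeartbeats 1000000 in
/-- The algebraic part of the maximum principle argument. Here `lam` are the eigenvalues, `Fd` and
`Fdd` the derivatives of the operator, `T3` and `T4` third and fourth derivatives of the solution at
a maximum point of the auxiliary function, in a basis of eigenvectors. -/
theorem exists_bound_of_maximum [Fintype ι] {c C K c₀ W : ℝ} (hc : 0 < c) (hC : 0 < C)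
    (hK : 0 < K) (hc₀ : 0 < c₀) : ∃ N > 0, ∃ δ > 0, ∃ R, 0 < R ∧
    ∀ (o : ι) (lam Fd E u G D T4 : ι → ℝ) (Fdd : ι → ι → ℝ) (T3 : ι → ι → ι → ℝ) (F w : ℝ),
      0 < w → w ≤ W → 1 ≤ lam o → (∀ i, 0 < Fd i) → (∀ i j, i ≠ j → 0 ≤ Fdd i j) →
      (∀ i j, Fdd i j = Fdd j i) → c₀ ≤ F →
      c ≤ Fd o * lam o → (∀ j, Fd j * |lam j| ≤ C) → (∀ j ≠ o, lam o * |E j| ≤ C) →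
      (∀ j ≠ o, |E j| ≤ Fd j / 4) → (∀ j ≠ o, lam o * Fdd o j = Fd j - E j) →
      F - Fd o * lam o ≤ δ →
      (1 - δ) * (Fd o ^ 2 * T3 o o o ^ 2) ≤ (∑ i, T3 o i i * Fd i) ^ 2 -
        F * ∑ i, ∑ j ∈ univ.erase i, T3 o i i * T3 o j j * Fdd i j +
        F / lam o * ∑ j ∈ univ.erase o, Fd j * T3 o j j ^ 2 →
      (∀ i j k, T3 i j k = T3 j i k) → (∀ i j k, T3 i j k = T3 i k j) →
      (∀ i, T3 i o o = lam o * (u i / w - N * u i * lam i)) →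
      (∀ i, -lam i / w - u i ^ 2 / w ^ 2 + T4 i / lam o +
        (if i = o then 0 else T3 o i i ^ 2 / lam o ^ 2) - (u i / w - N * u i * lam i) ^ 2 +
        N * (lam i ^ 2 + ∑ l, u l * T3 i i l) ≤ 0) →
      (∀ l, ∑ i, Fd i * T3 l i i = G l + D l * lam l) →
      (∑ l, D l * T3 o o l - K * (1 + lam o) ^ 2 ≤ ∑ i, Fd i * T4 i +
        ∑ i, ∑ j ∈ univ.erase i, Fdd i j * (T3 o i i * T3 o j j - T3 o i j ^ 2)) →
      (∀ i, u i ^ 2 ≤ K) → |∑ l, u l * D l| ≤ K → |∑ l, u l * G l| ≤ K → |G o| ≤ K →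
      |D o| ≤ K → w * lam o ≤ R := by
  -- `B` is the total coefficient of `(1 + λ_o)² / λ_o ≤ 4 λ_o`: `K` comes from the twice
  -- differentiated equation and `K² / c₀` from the concavity inequality. `N` is chosen so that `N /
  -- 2 * c * λ_o` exceeds `4 B λ_o` by `λ_o`, and `δ`, after `N`, so that the loss `d` is admissible
  -- in `large_direction_bound`.
  set B : ℝ := K + K ^ 2 / c₀ with hB
  have hB0 : 0 < B := by positivity
  set N : ℝ := 2 / c * (4 * B + 1) with hN
  have hN0 : 0 < N := by positivity
  set δ : ℝ := min 1 (min (1 / 2) (1 / (4 * N * K)) / (1 + 1 / c₀)) with hδ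
  have hδ0 : 0 < δ := by positivity
  have hδ1 : δ ≤ 1 := min_le_left _ _
  set d : ℝ := δ * (1 + 1 / c₀) with hd
  have hd0 : 0 < d := by positivity
  have hdm : d ≤ min (1 / 2) (1 / (4 * N * K)) := by
    have h1 : δ ≤ min (1 / 2) (1 / (4 * N * K)) / (1 + 1 / c₀) := min_le_right _ _
    rwa [le_div_iff₀ (by positivity)] at h1
  have hd1 : 2 * d ≤ 1 := by
    have := hdm.trans (min_le_left _ _)
    linarith
  have hdN : 4 * d * N * K ≤ 1 := by
    have h1 := hdm.trans (min_le_right _ _)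
    rw [le_div_iff₀ (by positivity)] at h1
    linarith
  set n : ℝ := ((Fintype.card ι : ℕ) : ℝ) with hn
  set R : ℝ := n * (C + 2 * N * K * C + 4 * C * K) + C + 2 * C * K + K + N * K with hR
  have hn0 : 0 ≤ n := by positivity
  have hR0 : 0 < R := by positivity
  refine ⟨N, hN0, δ, hδ0, 1 + R * (2 + |W|), by positivity, ?_⟩
  intro o lam Fd E u G D T4 Fdd T3 F w hw hwW hl1 hFd hFdd hFdds hF hcF hFC hE hE4 hEF hFδ hconc
    hs1 hs2 hcrit hsec hEl hE2 hu huD huG hGo hDo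
  have hl0 : 0 < lam o := by linarith
  have hF0 : 0 < F := by linarith
  refine mul_le_of_le_add_inv hw hl0 hR0 (hwW.trans (le_abs_self W)) ?_
  set a : ι → ℝ := fun i => u i / w - N * u i * lam i with ha
  have hcrit' : ∀ i, T3 o o i = lam o * a i := fun i => by
    rw [hs2 o o i, hs1 o i o]; exact hcrit i
  -- the sum of the second order conditions
  have hsum : ∑ i, Fd i * (-lam i / w - u i ^ 2 / w ^ 2 - a i ^ 2 + N * lam i ^ 2) +
      1 / lam o * ∑ i, Fd i * T4 i + 1 / lam o ^ 2 * ∑ j ∈ univ.erase o, Fd j * T3 o j j ^ 2 +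
      N * ∑ l, u l * (G l + D l * lam l) ≤ 0 := by
    have h1 := sum_nonpos fun i (_ : i ∈ univ) =>
      mul_nonpos_of_nonneg_of_nonpos (hFd i).le (hsec i)
    have e1 : ∑ j ∈ univ.erase o, Fd j * T3 o j j ^ 2 =
        ∑ j, Fd j * (if j = o then 0 else T3 o j j ^ 2) := by
      rw [← add_sum_erase univ _ (mem_univ o)]
      simp only [if_true, mul_zero, zero_add]
      exact sum_congr rfl fun j hj => by rw [if_neg (ne_of_mem_erase hj)]
    have e2 : ∑ l, u l * (G l + D l * lam l) = ∑ i, Fd i * ∑ l, u l * T3 i i l := by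
      simp only [← hEl, mul_sum]
      rw [sum_comm]
      refine sum_congr rfl fun i _ => sum_congr rfl fun l _ => ?_
      rw [hs2 i i l, hs1 i l i]; ring
    rw [e1, e2, mul_sum, mul_sum, mul_sum, ← sum_add_distrib, ← sum_add_distrib,
      ← sum_add_distrib]
    refine le_trans (le_of_eq (sum_congr rfl fun i _ => ?_)) h1
    have : (if i = o then 0 else T3 o i i ^ 2 / lam o ^ 2) =
        1 / lam o ^ 2 * (if i = o then 0 else T3 o i i ^ 2) := by
      split_ifs <;> ring
    rw [this]
    ring
  -- off-diagonal third derivatives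
  have hoff : 2 * ∑ j ∈ univ.erase o, (Fd j - E j) * a j ^ 2 ≤
      1 / lam o * ∑ i, ∑ j ∈ univ.erase i, Fdd i j * T3 o i j ^ 2 := by
    rw [sum_sum_erase_split o]
    -- Pairs avoiding `o` are dropped. For pairs with `o`, `λ_o F_oj = F_j - E_j` produces `2 (F_j -
    -- E_j) a_j²`, which turns the unfavourable `-F_j a_j²` into `F_j a_j² - 2 E_j a_j²`.
    have h1 : 0 ≤ ∑ i ∈ univ.erase o, ∑ j ∈ (univ.erase i).erase o, Fdd i j * T3 o i j ^ 2 :=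
      sum_nonneg fun i _ => sum_nonneg fun j hj =>
        mul_nonneg (hFdd i j (ne_of_mem_erase (mem_of_mem_erase hj)).symm) (sq_nonneg _)
    have h2 : ∑ j ∈ univ.erase o, (Fdd o j * T3 o o j ^ 2 + Fdd j o * T3 o j o ^ 2) =
        lam o * (2 * ∑ j ∈ univ.erase o, (Fd j - E j) * a j ^ 2) := by
      rw [mul_sum, mul_sum]
      refine sum_congr rfl fun j hj => ?_
      rw [← hEF j (ne_of_mem_erase hj), hFdds j o, hs2 o j o, hcrit' j]
      ring
    rw [h2, one_div, inv_mul_eq_div, le_div_iff₀ hl0]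
    linarith
  -- the concavity inequality
  have hdiag : (1 - d) * (Fd o * a o ^ 2) - K ^ 2 / c₀ * ((1 + lam o) ^ 2 / lam o) ≤
      -(1 / lam o * ∑ i, ∑ j ∈ univ.erase i, T3 o i i * T3 o j j * Fdd i j) +
        1 / lam o ^ 2 * ∑ j ∈ univ.erase o, Fd j * T3 o j j ^ 2 := by
    have e1 : ∑ i, T3 o i i * Fd i = G o + D o * lam o := by
      rw [← hEl o]
      exact sum_congr rfl fun i _ => mul_comm _ _
    have h1 : (G o + D o * lam o) ^ 2 ≤ K ^ 2 * (1 + lam o) ^ 2 := by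
      rw [← mul_pow]
      have hD : |D o * lam o| ≤ K * lam o := by
        rw [abs_mul, abs_of_pos hl0]
        gcongr
      obtain ⟨x1, x2⟩ := abs_le.1 hD
      obtain ⟨x3, x4⟩ := abs_le.1 hGo
      exact sq_le_sq' (by linarith) (by linarith)
    rw [e1, hcrit' o] at hconc
    set Q := ∑ i, ∑ j ∈ univ.erase i, T3 o i i * T3 o j j * Fdd i j
    set P := ∑ j ∈ univ.erase o, Fd j * T3 o j j ^ 2
    -- After division by `F λ_o` the correction sum carries `1 / λ_o²`, exactly the squares `T3 o i
    -- i ^ 2 / λ_o²` available in the second order conditions.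
    have h2 : (1 - δ) * (Fd o ^ 2 * (lam o * a o) ^ 2) / (F * lam o) ≤
        K ^ 2 * (1 + lam o) ^ 2 / (F * lam o) - 1 / lam o * Q + 1 / lam o ^ 2 * P := by
      rw [div_le_iff₀ (by positivity)]
      have : (K ^ 2 * (1 + lam o) ^ 2 / (F * lam o) - 1 / lam o * Q + 1 / lam o ^ 2 * P) *
          (F * lam o) = K ^ 2 * (1 + lam o) ^ 2 - F * Q + F / lam o * P := by
        field_simp
      rw [this]
      linarith
    have h3 : K ^ 2 * (1 + lam o) ^ 2 / (F * lam o) ≤ K ^ 2 / c₀ * ((1 + lam o) ^ 2 / lam o) := by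
      rw [div_mul_div_comm]
      gcongr
    have h4 : (1 - d) * (Fd o * a o ^ 2) ≤
        (1 - δ) * (Fd o ^ 2 * (lam o * a o) ^ 2) / (F * lam o) := by
      have h5 : 1 - δ / c₀ ≤ Fd o * lam o / F := by
        rw [le_div_iff₀ hF0]
        have : δ ≤ δ / c₀ * F := by
          rw [div_mul_eq_mul_div, le_div_iff₀ hc₀]; gcongr
        linarith
      have h6 : 1 - d ≤ (1 - δ) * (Fd o * lam o / F) := by
        calc 1 - d ≤ (1 - δ) * (1 - δ / c₀) := by
              have : 0 ≤ δ * (δ / c₀) := by positivity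
              rw [hd]
              have e : δ * (1 + 1 / c₀) = δ + δ / c₀ := by ring
              rw [e]
              linarith
          _ ≤ _ := by
              apply mul_le_mul_of_nonneg_left h5
              linarith
      have h7 := mul_le_mul_of_nonneg_right h6 (mul_nonneg (hFd o).le (sq_nonneg (a o)))
      refine h7.trans (le_of_eq ?_)
      field_simp
    linarith
  -- the equation differentiated twice
  have hE2' : 1 / w * ∑ l, u l * D l - N * ∑ l, u l * (D l * lam l) -
      K * ((1 + lam o) ^ 2 / lam o) ≤ 1 / lam o * ∑ i, Fd i * T4 i +
        1 / lam o * ∑ i, ∑ j ∈ univ.erase i, T3 o i i * T3 o j j * Fdd i j -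
        1 / lam o * ∑ i, ∑ j ∈ univ.erase i, Fdd i j * T3 o i j ^ 2 := by
    have h1 := mul_le_mul_of_nonneg_left hE2 (one_div_pos.2 hl0).le
    have e1 : ∑ i, ∑ j ∈ univ.erase i, Fdd i j * (T3 o i i * T3 o j j - T3 o i j ^ 2) =
        ∑ i, ∑ j ∈ univ.erase i, T3 o i i * T3 o j j * Fdd i j -
          ∑ i, ∑ j ∈ univ.erase i, Fdd i j * T3 o i j ^ 2 := by
      simp only [← sum_sub_distrib]
      exact sum_congr rfl fun i _ => sum_congr rfl fun j _ => by ring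
    -- The first order condition removes the third derivatives here. The resulting term with factor
    -- `N` cancels the one that the once differentiated equation puts into `hsum`.
    have e2 : 1 / lam o * ∑ l, D l * T3 o o l =
        1 / w * ∑ l, u l * D l - N * ∑ l, u l * (D l * lam l) := by
      rw [mul_sum, mul_sum, mul_sum, ← sum_sub_distrib]
      refine sum_congr rfl fun l _ => ?_
      rw [hcrit' l, ha]
      field_simp
    rw [e1, mul_sub, e2] at h1
    have e3 : 1 / lam o * (K * (1 + lam o) ^ 2) = K * ((1 + lam o) ^ 2 / lam o) := by ring
    rw [e3] at h1
    linarith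
  have hsmall : -(n * (C / w + 2 * N * K * C / w + 4 * C * K / (lam o * w ^ 2))) ≤
      ∑ j ∈ univ.erase o, (Fd j * (-lam j / w - u j ^ 2 / w ^ 2 + a j ^ 2 + N * lam j ^ 2) -
        2 * E j * a j ^ 2) := by
    have h1 := card_nsmul_le_sum (univ.erase o) (fun j => Fd j * (-lam j / w - u j ^ 2 / w ^ 2 +
      a j ^ 2 + N * lam j ^ 2) - 2 * E j * a j ^ 2) _ fun j hj =>
        small_direction_bound hw hN0 hl0 hC (hFd j) (hFC j) (hE j (ne_of_mem_erase hj))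
          (hE4 j (ne_of_mem_erase hj)) (hu j)
    rw [nsmul_eq_mul] at h1
    have h2 : ((univ.erase o).card : ℝ) ≤ n := by
      have := card_le_card (erase_subset o univ)
      rw [Finset.card_univ] at this
      rw [hn]
      exact_mod_cast this
    have h3 : 0 ≤ C / w + 2 * N * K * C / w + 4 * C * K / (lam o * w ^ 2) := by positivity
    have h4 := mul_le_mul_of_nonneg_right h2 h3
    linarith
  have hFo : Fd o * lam o ≤ C := by
    have := hFC o
    rwa [abs_of_pos hl0] at this
  have hlarge := large_direction_bound hw hN0 hl0 hC (hFd o) hFo hcF hd0.le hd1 hdN (hu o)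
  rw [← add_sum_erase univ _ (mem_univ o)] at hsum
  have e1 : ∑ j ∈ univ.erase o, (Fd j * (-lam j / w - u j ^ 2 / w ^ 2 + a j ^ 2 + N * lam j ^ 2) -
        2 * E j * a j ^ 2) =
      ∑ j ∈ univ.erase o, Fd j * (-lam j / w - u j ^ 2 / w ^ 2 - a j ^ 2 + N * lam j ^ 2) +
        2 * ∑ j ∈ univ.erase o, (Fd j - E j) * a j ^ 2 := by
    rw [mul_sum, ← sum_add_distrib]
    exact sum_congr rfl fun j _ => by ring
  have e2 : ∑ l, u l * (G l + D l * lam l) = ∑ l, u l * G l + ∑ l, u l * (D l * lam l) := by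
    rw [← sum_add_distrib]
    exact sum_congr rfl fun j _ => by ring
  rw [e1] at hsmall
  rw [e2] at hsum
  have hKw : -(K / w) ≤ 1 / w * ∑ l, u l * D l := by
    have := (abs_le.1 huD).1
    rw [one_div, inv_mul_eq_div, ← neg_div]
    gcongr
  have hNG : -(N * K) ≤ N * ∑ l, u l * G l := by
    have := mul_le_mul_of_nonneg_left (abs_le.1 huG).1 hN0.le
    linarith
  have h4l : B * ((1 + lam o) ^ 2 / lam o) ≤ 4 * B * lam o := by
    have : (1 + lam o) ^ 2 / lam o ≤ 4 * lam o := by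
      rw [div_le_iff₀ hl0]
      have h1 : 0 ≤ (lam o - 1) * (3 * lam o + 1) :=
        mul_nonneg (sub_nonneg.2 hl1) (by positivity)
      linarith only [h1]
    calc _ ≤ B * (4 * lam o) := by gcongr
      _ = _ := by ring
  have hBe : B * ((1 + lam o) ^ 2 / lam o) = K * ((1 + lam o) ^ 2 / lam o) +
      K ^ 2 / c₀ * ((1 + lam o) ^ 2 / lam o) := by rw [hB]; ring
  have hNc : N / 2 * c * lam o = 4 * B * lam o + lam o := by
    rw [hN]; field_simp
  have hao : (u o / w - N * u o * lam o) = a o := rfl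
  rw [hao] at hlarge
  have hfin : lam o ≤ n * (C / w + 2 * N * K * C / w + 4 * C * K / (lam o * w ^ 2)) +
      C / w + 2 * C * K / (lam o * w ^ 2) + K / w + N * K := by
    linarith only [hsum, hoff, hdiag, hE2', hsmall, hlarge, hKw, hNG, h4l, hBe, hNc]
  refine hfin.trans ?_
  have x1 : 0 < 1 / w := by positivity
  have x2 : 0 < 1 / (lam o * w ^ 2) := by positivity
  have y1 : n * (C / w + 2 * N * K * C / w + 4 * C * K / (lam o * w ^ 2)) +
      C / w + 2 * C * K / (lam o * w ^ 2) + K / w + N * K =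
      (n * (C + 2 * N * K * C) + C + K) * (1 / w) +
      (n * (4 * C * K) + 2 * C * K) * (1 / (lam o * w ^ 2)) + N * K * 1 := by
    ring
  rw [y1]
  have p1 : 0 ≤ n * (C + 2 * N * K * C) := by positivity
  have p2 : 0 ≤ n * (4 * C * K) := by positivity
  have p3 : 0 ≤ C * K := by positivity
  have p4 : 0 ≤ N * K := by positivity
  have q1 : n * (C + 2 * N * K * C) + C + K ≤ R := by
    linarith only [hR, p1, p2, p3, p4]
  have q2 : n * (4 * C * K) + 2 * C * K ≤ R := by
    linarith only [hR, p1, p2, p3, p4, hK, hC]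
  have q3 : N * K ≤ R := by
    linarith only [hR, p1, p2, p3, p4, hK, hC]
  refine (add_le_add (add_le_add (mul_le_mul_of_nonneg_right q1 x1.le)
    (mul_le_mul_of_nonneg_right q2 x2.le)) (mul_le_mul_of_nonneg_right q3 zero_le_one)).trans
    (le_of_eq ?_)
  ring

end SumHessian

/-! ### Expansions of symmetric functions of eigenvalues. -/

namespace SumHessian

open Finset Polynomial Filter Topology

variable {ι : Type*} [DecidableEq ι]

theorem perm_eq_one_or_swap {i j : ι} {σ : Equiv.Perm ι} (h : ∀ l, l ≠ i → l ≠ j → σ l = l) :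
    σ = 1 ∨ σ = Equiv.swap i j := by
  have hi : σ i = i ∨ σ i = j := by
    by_contra! hc
    exact hc.1 (σ.injective (h _ hc.1 hc.2))
  have hj : σ j = i ∨ σ j = j := by
    by_contra! hc
    exact hc.2 (σ.injective (h _ hc.1 hc.2))
  rcases eq_or_ne i j with rfl | hij
  · left
    ext l
    rcases eq_or_ne l i with rfl | hl
    · simpa using hi
    · simpa using h l hl hl
  rcases hi with hi | hi
  · left
    have hj' : σ j = j := hj.resolve_left fun h' => hij (σ.injective (hi.trans h'.symm))
    ext l
    rcases eq_or_ne l i with rfl | hl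
    · simpa using hi
    rcases eq_or_ne l j with rfl | hl'
    · simpa using hj'
    · simpa using h l hl hl'
  · right
    have hj' : σ j = i := hj.resolve_right fun h' => hij (σ.injective (hi.trans h'.symm))
    ext l
    rcases eq_or_ne l i with rfl | hl
    · simpa using hi
    rcases eq_or_ne l j with rfl | hl'
    · simpa using hj'
    · rw [Equiv.swap_apply_of_ne_of_ne hl hl']
      exact h l hl hl'

/-- Second order expansion of the determinant at a diagonal matrix. -/
theorem jet_det [Fintype ι] {B : ℝ → Matrix ι ι ℝ} {d : ι → ℝ} {X Y : ι → ι → ℝ}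
    (h : ∀ p q, Jet (fun t => B t p q) (if p = q then d p else 0) (X p q) (Y p q)) :
    Jet (fun t => (B t).det) (∏ i, d i) (∑ i, X i i * ∏ j ∈ univ.erase i, d j)
      (∑ i, Y i i * ∏ j ∈ univ.erase i, d j + 1 / 2 * ∑ i, ∑ j ∈ univ.erase i,
        (X i i * X j j - X i j * X j i) * ∏ l ∈ (univ.erase i).erase j, d l) := by
  have h1 := Jet.sum univ fun (σ : Equiv.Perm ι) _ =>
    (Jet.prod univ fun i _ => h (σ i) i).const_mul ((Equiv.Perm.sign σ : ℤ) : ℝ)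
  simp only [Matrix.det_apply']
  -- A permutation moving an index other than `i`, `j` leaves a vanishing off-diagonal factor
  -- undifferentiated, so only the identity and `swap i j` contribute.
  have hzero : ∀ {i j : ι} {σ : Equiv.Perm ι} {s : Finset ι}, (∀ l, l ≠ i → l ≠ j → l ∈ s) →
      σ ≠ 1 → σ ≠ Equiv.swap i j → ∏ l ∈ s, (if σ l = l then d (σ l) else 0) = 0 := by
    intro i j σ s hs hσ1 hσ2
    by_contra hne
    rcases perm_eq_one_or_swap (i := i) (j := j) (σ := σ) fun l hl1 hl2 => by
      by_contra hl
      exact hne (prod_eq_zero (hs l hl1 hl2) (if_neg hl)) with h' | h'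
    · exact hσ1 h'
    · exact hσ2 h'
  have hone : ∀ s : Finset ι,
      ∏ l ∈ s, (if (1 : Equiv.Perm ι) l = l then d ((1 : Equiv.Perm ι) l) else 0) =
      ∏ l ∈ s, d l := fun s => prod_congr rfl fun l _ => by simp
  have hfirst : ∀ Z : ι → ι → ℝ, ∑ σ : Equiv.Perm ι, ((Equiv.Perm.sign σ : ℤ) : ℝ) *
      ∑ i, Z (σ i) i * ∏ j ∈ univ.erase i, (if σ j = j then d (σ j) else 0) =
      ∑ i, Z i i * ∏ j ∈ univ.erase i, d j := by
    intro Z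
    simp only [mul_sum]
    rw [sum_comm]
    refine sum_congr rfl fun i _ => ?_
    rw [sum_eq_single 1 (fun σ _ hσ => ?_) (fun h => absurd (mem_univ _) h), hone]
    · simp
    · rw [hzero (i := i) (j := i) (fun l hl _ => mem_erase.2 ⟨hl, mem_univ l⟩) hσ
        (by rwa [Equiv.swap_self])]
      simp
  refine h1.cast ?_ (hfirst X) ?_
  · rw [sum_eq_single 1 (fun σ _ hσ => ?_) (fun h => absurd (mem_univ _) h), hone]
    · simp
    · have : ∃ i : ι, σ i ≠ i := by
        by_contra! hc
        exact hσ (Equiv.ext hc)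
      obtain ⟨i, hi⟩ := this
      rw [prod_eq_zero (mem_univ i) (if_neg hi), mul_zero]
  · simp only [mul_add, sum_add_distrib]
    rw [hfirst Y]
    congr 1
    have e : ∀ σ : Equiv.Perm ι, ((Equiv.Perm.sign σ : ℤ) : ℝ) * (1 / 2 * ∑ i,
        ∑ j ∈ univ.erase i, X (σ i) i * X (σ j) j *
          ∏ l ∈ (univ.erase i).erase j, (if σ l = l then d (σ l) else 0)) =
        1 / 2 * ∑ i, ∑ j ∈ univ.erase i, ((Equiv.Perm.sign σ : ℤ) : ℝ) * (X (σ i) i * X (σ j) j *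
          ∏ l ∈ (univ.erase i).erase j, (if σ l = l then d (σ l) else 0)) := fun σ => by
      simp only [mul_sum]
      refine sum_congr rfl fun i _ => sum_congr rfl fun j _ => by ring
    rw [sum_congr rfl fun σ _ => e σ, ← mul_sum, sum_comm]
    congr 1
    refine sum_congr rfl fun i _ => ?_
    rw [sum_comm]
    refine sum_congr rfl fun j hj => ?_
    have hij : i ≠ j := (ne_of_mem_erase hj).symm
    have hsw : (1 : Equiv.Perm ι) ≠ Equiv.swap i j := fun h => by
      have := Equiv.congr_fun h i
      simp at this
      exact hij this
    rw [sum_eq_add 1 (Equiv.swap i j) hsw (fun σ _ hσ => ?_) (fun h => absurd (mem_univ _) h)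
      (fun h => absurd (mem_univ _) h), hone]
    · have h2 : ∏ l ∈ (univ.erase i).erase j,
          (if Equiv.swap i j l = l then d (Equiv.swap i j l) else 0) =
          ∏ l ∈ (univ.erase i).erase j, d l := prod_congr rfl fun l hl => by
        rw [Equiv.swap_apply_of_ne_of_ne (ne_of_mem_erase (mem_of_mem_erase hl))
          (ne_of_mem_erase hl), if_pos rfl]
      rw [h2, Equiv.Perm.sign_swap hij]
      simp
      ring
    · rw [hzero (i := i) (j := j) (fun l hl1 hl2 => by simp [hl1, hl2]) hσ.1 hσ.2]
      simp

theorem coeff_prod_one_add (s : Finset ι) (x : ι → ℝ) (m : ℕ) :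
    (∏ j ∈ s, (1 + C (x j) * X)).coeff m = es s m x := by
  induction s using Finset.induction_on generalizing m with
  | empty =>
    cases m with
    | zero => simp
    | succ m => rw [es_eq_zero (by simp)]; simp [coeff_one]
  | insert i s hi ih =>
    rw [prod_insert hi, add_mul, one_mul, coeff_add, ih, mul_assoc, coeff_C_mul]
    cases m with
    | zero => simp
    | succ m => rw [coeff_X_mul, ih, es_insert hi]

/-- Lagrange interpolation at `0, …, N`: the weights do not depend on `p`, so expansions of finitely
many values transfer to the coefficient. -/
theorem exists_coeff_weights (N k : ℕ) : ∃ W : ℕ → ℝ, ∀ p : ℝ[X], p.natDegree ≤ N →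
    p.coeff k = ∑ z ∈ range (N + 1), W z * p.eval (z : ℝ) := by
  refine ⟨fun z => (Lagrange.basis (range (N + 1)) (fun m : ℕ => (m : ℝ)) z).coeff k,
    fun p hp => ?_⟩
  have h := Lagrange.eq_interpolate (s := range (N + 1)) (v := fun m : ℕ => (m : ℝ)) (f := p)
    (Nat.cast_injective.injOn) (by
      rw [card_range]
      exact lt_of_le_of_lt (degree_le_of_natDegree_le hp) (by exact_mod_cast Nat.lt_succ_self N))
  rw [Lagrange.interpolate_apply] at h
  conv_lhs => rw [h]
  rw [finsetSum_coeff]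
  exact sum_congr rfl fun z _ => by rw [coeff_C_mul, mul_comm]

theorem natDegree_prod_one_add_le [Fintype ι] (s : Finset ι) (x : ι → ℝ) (r : ℕ) :
    (X ^ r * ∏ j ∈ s, (1 + C (x j) * X)).natDegree ≤ Fintype.card ι + r := by
  refine natDegree_mul_le.trans ?_
  have h1 : (∏ j ∈ s, (1 + C (x j) * X)).natDegree ≤ Fintype.card ι := by
    refine (natDegree_prod_le _ _).trans ?_
    refine (sum_le_card_nsmul _ _ 1 fun j _ => ?_).trans ?_
    · compute_degree
    · simpa using card_le_univ s
  rw [natDegree_X_pow]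
  omega

/-- The coefficient of degree `m + 2` in `X ^ r * ∏ (1 + x j X)`. One set of weights serves `r = 0,
1, 2`, the powers of `z` produced by zero, one or two differentiations of `det (1 + z A)`. -/
theorem exists_es_weights [Fintype ι] (m : ℕ) : ∃ (N : ℕ) (W : ℕ → ℝ), ∀ (s : Finset ι)
    (x : ι → ℝ) (r : ℕ), r ≤ 2 → ∑ z ∈ range N, W z * ((z : ℝ) ^ r *
      ∏ j ∈ s, (1 + (z : ℝ) * x j)) = es s (m + 2 - r) x := by
  obtain ⟨W, hW⟩ := exists_coeff_weights (Fintype.card ι + 2) (m + 2)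
  refine ⟨Fintype.card ι + 2 + 1, W, fun s x r hr => ?_⟩
  have h := hW (X ^ r * ∏ j ∈ s, (1 + C (x j) * X))
    ((natDegree_prod_one_add_le s x r).trans (by omega))
  rw [coeff_X_pow_mul', if_pos (by omega), coeff_prod_one_add] at h
  rw [h]
  refine sum_congr rfl fun z _ => ?_
  rw [eval_mul, eval_pow, eval_X, eval_prod]
  congr 2
  exact prod_congr rfl fun j _ => by
    rw [eval_add, eval_one, eval_mul, eval_C, eval_X, mul_comm]

/-- Second order expansion of elementary symmetric functions of the eigenvalues at a diagonal
matrix. -/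
theorem jet_es_eigenvalues [Fintype ι] (m : ℕ) {A : ℝ → Matrix ι ι ℝ} {μ : ℝ → ι → ℝ} {d : ι → ℝ}
    {X Y : ι → ι → ℝ}
    (h : ∀ p q, Jet (fun t => A t p q) (if p = q then d p else 0) (X p q) (Y p q))
    (hμ : ∀ᶠ t in 𝓝 0, ∀ z : ℝ, (1 + z • A t).det = ∏ i, (1 + z * μ t i)) :
    Jet (fun t => es univ (m + 2) (μ t)) (es univ (m + 2) d)
      (∑ i, X i i * es (univ.erase i) (m + 1) d)
      (∑ i, Y i i * es (univ.erase i) (m + 1) d + 1 / 2 * ∑ i, ∑ j ∈ univ.erase i,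
        (X i i * X j j - X i j * X j i) * es ((univ.erase i).erase j) m d) := by
  obtain ⟨N, W, hW⟩ := exists_es_weights (ι := ι) m
  have h1 : ∀ z : ℝ, Jet (fun t => (1 + z • A t).det) (∏ i, (1 + z * d i))
      (∑ i, X i i * (z * ∏ j ∈ univ.erase i, (1 + z * d j)))
      (∑ i, Y i i * (z * ∏ j ∈ univ.erase i, (1 + z * d j)) + 1 / 2 * ∑ i, ∑ j ∈ univ.erase i,
        (X i i * X j j - X i j * X j i) *
          (z ^ 2 * ∏ l ∈ (univ.erase i).erase j, (1 + z * d l))) := by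
    intro z
    have h2 : ∀ p q, Jet (fun t => (1 + z • A t) p q) (if p = q then 1 + z * d p else 0)
        (z * X p q) (z * Y p q) := fun p q => by
      refine ((Jet.const ((1 : Matrix ι ι ℝ) p q)).add ((h p q).const_mul z)).cast ?_ (by simp)
        (by simp)
      rw [Matrix.one_apply]
      split_ifs <;> simp
    refine (jet_det h2).cast rfl ?_ ?_
    · exact sum_congr rfl fun i _ => by ring
    · congr 1
      · exact sum_congr rfl fun i _ => by ring
      · congr 1
        exact sum_congr rfl fun i _ => sum_congr rfl fun j _ => by ring
  have h3 := Jet.sum (range N) fun z _ => (h1 z).const_mul (W z)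
  -- The eigenvalues enter only through the determinants, so `μ` need not be differentiable or even
  -- continuous.
  have h4 := h3.congr (g := fun t => es univ (m + 2) (μ t)) (by
    filter_upwards [hμ] with t ht
    have := hW univ (μ t) 0 (by omega)
    simp only [pow_zero, one_mul, Nat.sub_zero] at this
    rw [← this]
    exact sum_congr rfl fun z _ => by rw [ht])
  have hfirst : ∀ Z : ι → ℝ, ∑ z ∈ range N, W z *
      ∑ i, Z i * ((z : ℝ) * ∏ j ∈ univ.erase i, (1 + (z : ℝ) * d j)) =
      ∑ i, Z i * es (univ.erase i) (m + 1) d := by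
    intro Z
    simp only [mul_sum]
    rw [sum_comm]
    refine sum_congr rfl fun i _ => ?_
    have := hW (univ.erase i) d 1 (by omega)
    simp only [pow_one, show m + 2 - 1 = m + 1 by omega] at this
    rw [← this, mul_sum]
    exact sum_congr rfl fun z _ => by ring
  refine h4.cast ?_ (hfirst _) ?_
  · have := hW univ d 0 (by omega)
    simpa only [pow_zero, one_mul, Nat.sub_zero] using this
  · simp only [mul_add, sum_add_distrib]
    rw [hfirst]
    congr 1
    have e : ∀ z : ℕ, W z * (1 / 2 * ∑ i, ∑ j ∈ univ.erase i, (X i i * X j j - X i j * X j i) *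
          ((z : ℝ) ^ 2 * ∏ l ∈ (univ.erase i).erase j, (1 + (z : ℝ) * d l))) =
        1 / 2 * ∑ i, ∑ j ∈ univ.erase i, W z * ((X i i * X j j - X i j * X j i) *
          ((z : ℝ) ^ 2 * ∏ l ∈ (univ.erase i).erase j, (1 + (z : ℝ) * d l))) := fun z => by
      simp only [mul_sum]
      refine sum_congr rfl fun i _ => sum_congr rfl fun j _ => by ring
    rw [sum_congr rfl fun z _ => e z, ← mul_sum, sum_comm]
    congr 1
    refine sum_congr rfl fun i _ => ?_
    rw [sum_comm]
    refine sum_congr rfl fun j _ => ?_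
    have := hW ((univ.erase i).erase j) d 2 le_rfl
    simp only [show m + 2 - 2 = m by omega] at this
    rw [← this, mul_sum]
    exact sum_congr rfl fun z _ => by ring

theorem jet_sh_eigenvalues [Fintype ι] (α : ℝ) (m : ℕ) {A : ℝ → Matrix ι ι ℝ} {μ : ℝ → ι → ℝ}
    {d : ι → ℝ} {X Y : ι → ι → ℝ}
    (h : ∀ p q, Jet (fun t => A t p q) (if p = q then d p else 0) (X p q) (Y p q))
    (hμ : ∀ᶠ t in 𝓝 0, ∀ z : ℝ, (1 + z • A t).det = ∏ i, (1 + z * μ t i)) :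
    Jet (fun t => sh α univ (m + 2) (μ t)) (sh α univ (m + 2) d)
      (∑ i, sh α (univ.erase i) (m + 1) d * X i i)
      (∑ i, sh α (univ.erase i) (m + 1) d * Y i i + 1 / 2 * ∑ i, ∑ j ∈ univ.erase i,
        sh α ((univ.erase i).erase j) m d * (X i i * X j j - X i j * X j i)) := by
  refine ((jet_es_eigenvalues (m + 1) h hμ).add
    ((jet_es_eigenvalues m h hμ).const_mul α)).cast rfl ?_ ?_
  · rw [mul_sum, ← sum_add_distrib]
    exact sum_congr rfl fun i _ => by unfold sh; ring
  · simp only [sh, add_mul, sum_add_distrib, mul_add, mul_sum]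
    simp only [mul_comm, mul_left_comm]
    ring

end SumHessian

/-! ### Directional derivatives and the right-hand side along a line. -/

namespace SumHessian

open Finset Polynomial Filter Topology

section directional

variable {V : Type*} [NormedAddCommGroup V] [NormedSpace ℝ V]

/-- The derivative of `f` in the direction `a`. -/
noncomputable def dd (a : V) (f : V → ℝ) (x : V) : ℝ := fderiv ℝ f x a

theorem contDiffOn_dd {n m : ℕ} {f : V → ℝ} {Ω : Set V} (hf : ContDiffOn ℝ n f Ω) (hΩ : IsOpen Ω)
    (hmn : m + 1 ≤ n) (a : V) : ContDiffOn ℝ m (dd a f) Ω :=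
  (hf.fderiv_of_isOpen hΩ (by exact_mod_cast hmn)).clm_apply contDiffOn_const

theorem jet_line {f : V → ℝ} {Ω : Set V} (hf : ContDiffOn ℝ 2 f Ω) (hΩ : IsOpen Ω) {x : V}
    (hx : x ∈ Ω) (a : V) :
    Jet (fun t => f (x + t • a)) (f x) (dd a f x) (dd a (dd a f) x / 2) := by
  have hline : ∀ t : ℝ, HasDerivAt (fun t : ℝ => x + t • a) a t := fun t => by
    simpa using ((hasDerivAt_id t).smul_const a).const_add x
  have hev : ∀ᶠ t : ℝ in 𝓝 0, x + t • a ∈ Ω := by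
    refine (hline 0).continuousAt.eventually_mem ?_
    simpa using hΩ.mem_nhds hx
  have h1 : ∀ᶠ t : ℝ in 𝓝 0, HasDerivAt (fun t => f (x + t • a)) (dd a f (x + t • a)) t := by
    filter_upwards [hev] with t ht
    have hd : DifferentiableAt ℝ f (x + t • a) :=
      (hf.differentiableOn (by norm_num)).differentiableAt (hΩ.mem_nhds ht)
    exact hd.hasFDerivAt.comp_hasDerivAt t (hline t)
  have h2 : HasDerivAt (fun t : ℝ => dd a f (x + t • a)) (dd a (dd a f) x) 0 := by
    have hg := contDiffOn_dd (n := 2) (m := 1) hf hΩ (by norm_num) a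
    have hd : DifferentiableAt ℝ (dd a f) x :=
      (hg.differentiableOn (by norm_num)).differentiableAt (hΩ.mem_nhds hx)
    have hd' : HasFDerivAt (dd a f) (fderiv ℝ (dd a f) x) (x + (0 : ℝ) • a) := by
      simpa using hd.hasFDerivAt
    exact hd'.comp_hasDerivAt 0 (hline 0)
  simpa using Jet.of_hasDerivAt h1 h2

theorem dd_dd_eq {f : V → ℝ} {Ω : Set V} (hf : ContDiffOn ℝ 2 f Ω) (hΩ : IsOpen Ω) {x : V}
    (hx : x ∈ Ω) (a b : V) : dd a (dd b f) x = fderiv ℝ (fderiv ℝ f) x a b := by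
  have h1 : DifferentiableAt ℝ (fderiv ℝ f) x :=
    ((hf.fderiv_of_isOpen (m := 1) hΩ (by norm_num)).differentiableOn
      (by norm_num)).differentiableAt (hΩ.mem_nhds hx)
  unfold dd
  rw [fderiv_clm_apply h1 (differentiableAt_const b)]
  simp

theorem dd_comm {f : V → ℝ} {Ω : Set V} (hf : ContDiffOn ℝ 2 f Ω) (hΩ : IsOpen Ω) {x : V}
    (hx : x ∈ Ω) (a b : V) : dd a (dd b f) x = dd b (dd a f) x := by
  rw [dd_dd_eq hf hΩ hx, dd_dd_eq hf hΩ hx]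
  exact ((hf.contDiffAt (hΩ.mem_nhds hx)).isSymmSndFDerivAt (by simp)).eq a b

theorem dd_congr {f g : V → ℝ} {Ω : Set V} (hΩ : IsOpen Ω) (h : ∀ x ∈ Ω, f x = g x) {x : V}
    (hx : x ∈ Ω) (a : V) : dd a f x = dd a g x := by
  have : f =ᶠ[𝓝 x] g := by
    filter_upwards [hΩ.mem_nhds hx] with y hy using h y hy
  unfold dd
  rw [this.fderiv_eq]

theorem dd_four_comm {f : V → ℝ} {Ω : Set V} (hf : ContDiffOn ℝ 4 f Ω) (hΩ : IsOpen Ω) {x : V}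
    (hx : x ∈ Ω) (a b : V) :
    dd a (dd a (dd b (dd b f))) x = dd b (dd b (dd a (dd a f))) x := by
  have c2 : ContDiffOn ℝ 2 f Ω := hf.of_le (by norm_num)
  have c3 : ∀ v, ContDiffOn ℝ 2 (dd v f) Ω := fun v =>
    contDiffOn_dd (n := 4) (m := 2) hf hΩ (by norm_num) v
  have c3' : ∀ v, ContDiffOn ℝ 3 (dd v f) Ω := fun v =>
    contDiffOn_dd (n := 4) (m := 3) hf hΩ (by norm_num) v
  have c4 : ∀ v w, ContDiffOn ℝ 2 (dd v (dd w f)) Ω := fun v w =>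
    contDiffOn_dd (n := 3) (m := 2) (c3' w) hΩ (by norm_num) v
  -- `aabb → abab → baab → baba → bbaa`
  calc dd a (dd a (dd b (dd b f))) x = dd a (dd b (dd a (dd b f))) x :=
        dd_congr hΩ (fun y hy => dd_comm (c3 b) hΩ hy a b) hx a
    _ = dd b (dd a (dd a (dd b f))) x := dd_comm (c4 a b) hΩ hx a b
    _ = dd b (dd a (dd b (dd a f))) x :=
        dd_congr hΩ (fun y hy => dd_congr hΩ (fun z hz => dd_comm c2 hΩ hz a b) hy a) hx b
    _ = dd b (dd b (dd a (dd a f))) x :=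
        dd_congr hΩ (fun y hy => dd_comm (c3 a) hΩ hy a b) hx b

end directional

variable {n : ℕ}

theorem dd_eq_inner {u : E n → ℝ} (x a : E n) : dd a u x = inner ℝ a (gradient u x) := by
  unfold dd gradient
  rw [real_inner_comm, InnerProductSpace.toDual_symm_apply]

theorem gradient_eq_sum (e : OrthonormalBasis (Fin n) ℝ (E n)) (u : E n → ℝ) (x : E n) :
    gradient u x = ∑ l, dd (e l) u x • e l := by
  rw [← e.sum_repr (gradient u x)]
  refine sum_congr rfl fun l _ => ?_
  rw [dd_eq_inner, e.repr_apply_apply]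

theorem norm_gradient_sq (e : OrthonormalBasis (Fin n) ℝ (E n)) (u : E n → ℝ) (x : E n) :
    ‖gradient u x‖ ^ 2 = ∑ l, dd (e l) u x ^ 2 := by
  rw [← e.sum_sq_norm_inner_right]
  exact sum_congr rfl fun l _ => by rw [dd_eq_inner, Real.norm_eq_abs, sq_abs]

/-- One-sided second order Taylor estimate for functions with Lipschitz derivative. -/
theorem taylor_lower_bound {X : Type*} [NormedAddCommGroup X] [NormedSpace ℝ X] {f : X → ℝ}
    {U : Set X} (hU : IsOpen U) (hf : DifferentiableOn ℝ f U) {L : NNReal}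
    (hL : LipschitzOnWith L (fderiv ℝ f) U) {x : X} (hx : x ∈ U) :
    ∀ᶠ y in 𝓝 x, f x + fderiv ℝ f x (y - x) - L * ‖y - x‖ ^ 2 ≤ f y := by
  obtain ⟨r, hr, hball⟩ := Metric.isOpen_iff.1 hU x hx
  filter_upwards [Metric.ball_mem_nhds x hr] with y hy
  have hsub : Metric.closedBall x ‖y - x‖ ⊆ U := fun z hz => hball (by
    rw [Metric.mem_ball] at hy ⊢
    rw [Metric.mem_closedBall] at hz
    rw [dist_eq_norm] at hy
    exact lt_of_le_of_lt hz hy)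
  have h := (convex_closedBall x ‖y - x‖).norm_image_sub_le_of_norm_hasFDerivWithin_le'
    (f := f) (f' := fderiv ℝ f) (φ := fderiv ℝ f x) (C := L * ‖y - x‖) (x := x) (y := y)
    (fun z hz => ((hf z (hsub hz)).differentiableAt
      (hU.mem_nhds (hsub hz))).hasFDerivAt.hasFDerivWithinAt)
    (fun z hz => by
      have h1 := hL.norm_sub_le (hsub hz) hx
      rw [mem_closedBall_iff_norm] at hz
      exact h1.trans (by gcongr))
    (by simp) (by simp [dist_eq_norm])
  rw [Real.norm_eq_abs] at h
  have := (abs_le.1 h).1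
  nlinarith

theorem max_three_sq_le (a b c : ℝ) :
    max a (max b c) ^ 2 ≤ a ^ 2 + b ^ 2 + c ^ 2 := by
  rcases le_total b c with h | h
  · rcases le_total a c with h' | h'
    · rw [max_eq_right h, max_eq_right h']; nlinarith
    · rw [max_eq_right h, max_eq_left h']; nlinarith
  · rcases le_total a b with h' | h'
    · rw [max_eq_left h, max_eq_right h']; nlinarith
    · rw [max_eq_left h, max_eq_left h']; nlinarith

/-- Second order expansion of the right-hand side along a line. -/
theorem rhs_jet_bound {f : E n × ℝ × E n → ℝ} {U : Set (E n × ℝ × E n)} (hU : IsOpen U)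
    (hf : DifferentiableOn ℝ f U) {L : NNReal} (hL : LipschitzOnWith L (fderiv ℝ f) U)
    {u : E n → ℝ} {Ω : Set (E n)} (hΩ : IsOpen Ω) (hu : ContDiffOn ℝ 4 u Ω) {x : E n}
    (hx : x ∈ Ω) (hxU : (x, u x, gradient u x) ∈ U) (e : OrthonormalBasis (Fin n) ℝ (E n))
    (i : Fin n) {a b c : ℝ}
    (hjet : Jet (fun t => f (x + t • e i, u (x + t • e i), gradient u (x + t • e i))) a b c) :
    b = fderiv ℝ f (x, u x, gradient u x) (e i, 0, 0) +
        fderiv ℝ f (x, u x, gradient u x) (0, 1, 0) * dd (e i) u x +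
        ∑ l, fderiv ℝ f (x, u x, gradient u x) (0, 0, e l) * dd (e i) (dd (e l) u) x ∧
    fderiv ℝ f (x, u x, gradient u x) (0, 1, 0) * dd (e i) (dd (e i) u) x +
      ∑ l, fderiv ℝ f (x, u x, gradient u x) (0, 0, e l) * dd (e i) (dd (e i) (dd (e l) u)) x -
      2 * L * (1 + dd (e i) u x ^ 2 + ∑ l, dd (e i) (dd (e l) u) x ^ 2) ≤ 2 * c := by
  set T := fderiv ℝ f (x, u x, gradient u x) with hT
  have ju := jet_line (hu.of_le (by norm_num : (2 : WithTop ℕ∞) ≤ 4)) hΩ hx (e i)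
  have jul : ∀ l, Jet (fun t => dd (e l) u (x + t • e i)) (dd (e l) u x)
      (dd (e i) (dd (e l) u) x) (dd (e i) (dd (e i) (dd (e l) u)) x / 2) := fun l =>
    jet_line (contDiffOn_dd (n := 4) (m := 2) hu hΩ (by norm_num) (e l)) hΩ hx (e i)
  have du := ju.sub (Jet.const (u x))
  have dul := fun l => (jul l).sub (Jet.const (dd (e l) u x))
  have hlin : Jet (fun t => T (x + t • e i - x, u (x + t • e i) - u x,
      gradient u (x + t • e i) - gradient u x)) 0
      (T (e i, 0, 0) + T (0, 1, 0) * dd (e i) u x + ∑ l, T (0, 0, e l) * dd (e i) (dd (e l) u) x)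
      ((T (0, 1, 0) * dd (e i) (dd (e i) u) x +
        ∑ l, T (0, 0, e l) * dd (e i) (dd (e i) (dd (e l) u)) x) / 2) := by
    have h1 := ((Jet.id.const_mul (T (e i, 0, 0))).add (du.const_mul (T (0, 1, 0)))).add
      (Jet.sum univ fun l _ => (dul l).const_mul (T (0, 0, e l)))
    refine (h1.cast (by simp) (by simp) ?_).congr (Eventually.of_forall fun t => ?_)
    · rw [add_div, sum_div]
      congr 1
      · ring
      · exact sum_congr rfl fun l _ => by ring
    · have e1 : (x + t • e i - x, u (x + t • e i) - u x,
          gradient u (x + t • e i) - gradient u x) =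
          t • ((e i, 0, 0) : E n × ℝ × E n) + (u (x + t • e i) - u x) • ((0, 1, 0) : E n × ℝ × E n) +
          ∑ l, (dd (e l) u (x + t • e i) - dd (e l) u x) • ((0, 0, e l) : E n × ℝ × E n) := by
        rw [gradient_eq_sum e u (x + t • e i), gradient_eq_sum e u x]
        refine Prod.ext ?_ (Prod.ext ?_ ?_)
        · simp [Prod.fst_sum]
        · simp [Prod.snd_sum, Prod.fst_sum]
        · simp [Prod.snd_sum, ← sum_sub_distrib, sub_smul]
      beta_reduce
      rw [e1]
      simp only [map_add, map_smul, map_sum, smul_eq_mul]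
      simp only [mul_comm]
  have hquad : Jet (fun t => t ^ 2 + (u (x + t • e i) - u x) ^ 2 +
      ∑ l, (dd (e l) u (x + t • e i) - dd (e l) u x) ^ 2) 0 0
      (1 + dd (e i) u x ^ 2 + ∑ l, dd (e i) (dd (e l) u) x ^ 2) := by
    have h1 := (Jet.sq.add (du.mul du)).add (Jet.sum univ fun l _ => (dul l).mul (dul l))
    refine (h1.cast (by simp) (by simp) ?_).congr (Eventually.of_forall fun t => ?_)
    · simp [pow_two]
    · simp [pow_two]
  -- The barrier is the linearisation of `f` minus `L` times a bound for the squared distance. It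
  -- has an expansion although `f` has no second derivatives, and it touches at `t = 0`: first
  -- coefficients agree and second ones are ordered.
  have hlow := ((Jet.const (f (x, u x, gradient u x))).add hlin).sub (hquad.const_mul L)
  have hcont : Tendsto (fun t : ℝ => (x + t • e i, u (x + t • e i), gradient u (x + t • e i)))
      (𝓝 0) (𝓝 (x, u x, gradient u x)) := by
    have t1 : Tendsto (fun t : ℝ => x + t • e i) (𝓝 0) (𝓝 x) := by
      have : Continuous fun t : ℝ => x + t • e i := by fun_prop
      simpa using this.tendsto 0
    refine t1.prodMk_nhds (ju.tendsto.prodMk_nhds ?_)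
    simp only [gradient_eq_sum e u]
    exact tendsto_finsetSum _ fun l _ => (jul l).tendsto.smul_const (e l)
  have ha : a = f (x, u x, gradient u x) + 0 - L * 0 := by
    rw [← hjet.eval_zero]; simp
  have hle := hlow.le_of_eventually_le (hjet.cast ha rfl rfl) (by
    filter_upwards [hcont.eventually (taylor_lower_bound hU hf hL hxU)] with t ht
    refine le_trans ?_ ht
    have hn : ‖(x + t • e i, u (x + t • e i), gradient u (x + t • e i)) -
        (x, u x, gradient u x)‖ ^ 2 ≤ t ^ 2 + (u (x + t • e i) - u x) ^ 2 +
        ∑ l, (dd (e l) u (x + t • e i) - dd (e l) u x) ^ 2 := by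
      have e3 : ∑ l, (dd (e l) u (x + t • e i) - dd (e l) u x) ^ 2 =
          ‖gradient u (x + t • e i) - gradient u x‖ ^ 2 := by
        rw [← e.sum_sq_norm_inner_right]
        exact sum_congr rfl fun l _ => by
          rw [dd_eq_inner, dd_eq_inner, ← inner_sub_right, Real.norm_eq_abs, sq_abs]
      have e1 : ‖x + t • e i - x‖ ^ 2 = t ^ 2 := by
        rw [add_sub_cancel_left, norm_smul, e.norm_eq_one, mul_one, Real.norm_eq_abs, sq_abs]
      have e2 : ‖u (x + t • e i) - u x‖ ^ 2 = (u (x + t • e i) - u x) ^ 2 := by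
        rw [Real.norm_eq_abs, sq_abs]
      rw [e3, ← e2, ← e1, Prod.mk_sub_mk, Prod.mk_sub_mk, Prod.norm_def, Prod.norm_def]
      exact max_three_sq_le _ _ _
    have hL0 : (0 : ℝ) ≤ L := L.2
    have := mul_le_mul_of_nonneg_left hn hL0
    rw [Prod.mk_sub_mk, Prod.mk_sub_mk] at this ⊢
    linarith)
  refine ⟨?_, ?_⟩
  · rw [← hle.1]; ring
  · have := hle.2
    linarith

end SumHessian

/-! ### First and second order conditions at the maximum. -/

namespace SumHessian

open Finset Polynomial Filter Topology

variable {n : ℕ}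

theorem norm_sum_smul_sq (e : OrthonormalBasis (Fin n) ℝ (E n)) (c : Fin n → ℝ) :
    ‖∑ p, c p • e p‖ ^ 2 = ∑ p, c p ^ 2 := by
  rw [← real_inner_self_eq_norm_sq, e.orthonormal.inner_sum c c univ]
  exact sum_congr rfl fun p _ => by simp [pow_two]

theorem hessian_form_sum {u : E n → ℝ} {Ω : Set (E n)} (hΩ : IsOpen Ω)
    (hu : ContDiffOn ℝ 2 u Ω) {x : E n} (hx : x ∈ Ω) (e : OrthonormalBasis (Fin n) ℝ (E n))
    (c : Fin n → ℝ) :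
    fderiv ℝ (fderiv ℝ u) x (∑ p, c p • e p) (∑ p, c p • e p) =
      ∑ p, ∑ q, c p * c q * dd (e p) (dd (e q) u) x := by
  simp only [map_sum, map_smul, _root_.sum_apply, smul_apply,
    smul_eq_mul, dd_dd_eq hu hΩ hx, mul_sum]
  rw [sum_comm]
  exact sum_congr rfl fun p _ => sum_congr rfl fun q _ => by ring

/-- The jet of the Hessian form along a moving direction `e o + t ζ` with `ζ ⊥ e o`. -/
theorem jet_hessian_form {H : Fin n → Fin n → ℝ → ℝ} {lam : Fin n → ℝ} {X Y : Fin n → Fin n → ℝ}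
    (hH : ∀ p q, Jet (H p q) (if p = q then lam p else 0) (X p q) (Y p q))
    (hX : ∀ p q, X p q = X q p) (o : Fin n) {ζ : Fin n → ℝ} (hζ : ζ o = 0) :
    Jet (fun t => ∑ p, ∑ q, ((if p = o then 1 else 0) + t * ζ p) *
        ((if q = o then 1 else 0) + t * ζ q) * H p q t) (lam o) (X o o)
      (Y o o + 2 * ∑ q, ζ q * X o q + ∑ p, ζ p ^ 2 * lam p) := by
  have hc : ∀ p, Jet (fun t => (if p = o then 1 else 0) + t * ζ p) (if p = o then 1 else 0)
      (ζ p) 0 := fun p =>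
    (((Jet.const (if p = o then (1 : ℝ) else 0)).add (Jet.id.const_mul (ζ p))).cast
      (by simp) (by simp) (by simp)).congr (Eventually.of_forall fun t => by simp [mul_comm])
  refine (Jet.sum univ fun p _ => Jet.sum univ fun q _ =>
    ((hc p).mul (hc q)).mul (hH p q)).cast ?_ ?_ ?_
  · simp
  · simp [sum_add_distrib, hζ, add_mul]
  · have h1 : ∑ p, ζ p * X p o = ∑ q, ζ q * X o q := sum_congr rfl fun p _ => by rw [hX]
    simp [sum_add_distrib, add_mul, h1]
    ring_nf

theorem jet_gradient_sq {u : E n → ℝ} {Ω : Set (E n)} (hΩ : IsOpen Ω) (hu : ContDiffOn ℝ 4 u Ω)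
    {x : E n} (hx : x ∈ Ω) (e : OrthonormalBasis (Fin n) ℝ (E n)) {lam : Fin n → ℝ}
    (hdiag : ∀ i j, dd (e i) (dd (e j) u) x = if i = j then lam i else 0) (i : Fin n) :
    Jet (fun t => ‖gradient u (x + t • e i)‖ ^ 2) (‖gradient u x‖ ^ 2)
      (2 * dd (e i) u x * lam i)
      (lam i ^ 2 + ∑ l, dd (e l) u x * dd (e i) (dd (e i) (dd (e l) u)) x) := by
  have jul : ∀ l, Jet (fun t => dd (e l) u (x + t • e i)) (dd (e l) u x)
      (if i = l then lam i else 0) (dd (e i) (dd (e i) (dd (e l) u)) x / 2) := fun l =>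
    (jet_line (contDiffOn_dd (n := 4) (m := 2) hu hΩ (by norm_num) (e l)) hΩ hx (e i)).cast rfl
      (hdiag i l) rfl
  refine ((Jet.sum univ fun l _ => (jul l).mul (jul l)).cast ?_ ?_ ?_).congr
    (Eventually.of_forall fun t => ?_)
  · rw [norm_gradient_sq e]; exact sum_congr rfl fun l _ => (pow_two _).symm
  · simp [sum_add_distrib]; ring
  · simp only [sum_add_distrib]
    rw [add_right_comm, ← sum_add_distrib, add_comm]
    congr 1
    · simp [pow_two]
    · exact sum_congr rfl fun l _ => by ring
  · beta_reduce; rw [norm_gradient_sq e]; exact sum_congr rfl fun l _ => (pow_two _).symm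

/-- First and second order conditions at an interior maximum of
`(-u - ε) D²u(v, v) exp (N |Du|² / 2)` over unit vectors `v`. -/
theorem maximum_conditions {u : E n → ℝ} {Ω : Set (E n)} (hΩ : IsOpen Ω)
    (hu : ContDiffOn ℝ 4 u Ω) {x : E n} (hx : x ∈ Ω) (e : OrthonormalBasis (Fin n) ℝ (E n))
    {lam : Fin n → ℝ} (hdiag : ∀ i j, dd (e i) (dd (e j) u) x = if i = j then lam i else 0)
    {o : Fin n} (hlo : 0 < lam o) (hlow : ∀ p, -(lam o / 2) ≤ lam p) {N ε : ℝ}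
    (hw : 0 < -u x - ε)
    (hmax : ∀ᶠ y in 𝓝 x, ∀ v, (-u y - ε) * fderiv ℝ (fderiv ℝ u) y v v *
      Real.exp (N / 2 * ‖gradient u y‖ ^ 2) ≤
        (-u x - ε) * lam o * Real.exp (N / 2 * ‖gradient u x‖ ^ 2) * ‖v‖ ^ 2) (i : Fin n) :
    dd (e i) (dd (e o) (dd (e o) u)) x =
      lam o * (dd (e i) u x / (-u x - ε) - N * dd (e i) u x * lam i) ∧
    -lam i / (-u x - ε) - dd (e i) u x ^ 2 / (-u x - ε) ^ 2 +
      dd (e o) (dd (e o) (dd (e i) (dd (e i) u))) x / lam o +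
      (if i = o then 0 else dd (e o) (dd (e i) (dd (e i) u)) x ^ 2 / lam o ^ 2) -
      (dd (e i) u x / (-u x - ε) - N * dd (e i) u x * lam i) ^ 2 +
      N * (lam i ^ 2 + ∑ l, dd (e l) u x * dd (e i) (dd (e i) (dd (e l) u)) x) ≤ 0 := by
  have hu2 : ContDiffOn ℝ 2 u Ω := hu.of_le (by norm_num)
  have hdu : ∀ v, ContDiffOn ℝ 3 (dd v u) Ω := fun v =>
    contDiffOn_dd (n := 4) (m := 3) hu hΩ (by norm_num) v
  set w := -u x - ε with hwdef
  set T : Fin n → Fin n → ℝ := fun p q => dd (e i) (dd (e p) (dd (e q) u)) x with hT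
  have hTs : ∀ p q, T p q = T q p := fun p q =>
    dd_congr hΩ (fun y hy => dd_comm hu2 hΩ hy (e p) (e q)) hx (e i)
  -- The test direction is `e o + t ζ`, with `λ_o` in place of the exact `λ_o - λ_p`. By `λ_p ≥ -λ_o
  -- / 2` the second coefficient gains at least `3/2 ∑ ζ²`, normalisation costs `∑ ζ²`, and the half
  -- that is left yields the square `ζ_i²` after doubling.
  set ζ : Fin n → ℝ := fun p => if p = o then 0 else T o p / lam o with hζ
  have hζo : ζ o = 0 := by simp [hζ]
  set c : Fin n → ℝ → ℝ := fun p t => (if p = o then 1 else 0) + t * ζ p with hc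
  have jw : Jet (fun t => -u (x + t • e i) - ε) w (-dd (e i) u x) (-lam i / 2) :=
    ((((jet_line hu2 hΩ hx (e i)).const_mul (-1)).sub (Jet.const ε)).cast
      (by rw [hwdef]; ring) (by ring) (by rw [hdiag, if_pos rfl]; ring)).congr
      (Eventually.of_forall fun t => by ring)
  have jH := jet_hessian_form (H := fun p q t => dd (e p) (dd (e q) u) (x + t • e i)) (X := T)
    (fun p q => (jet_line (contDiffOn_dd (n := 3) (m := 2) (hdu (e q)) hΩ (by norm_num) (e p)) hΩ
      hx (e i)).cast (hdiag p q) rfl rfl) hTs o hζo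
  -- The squared norm of the moving direction is the same form with the identity in place of the
  -- Hessian.
  have jS : Jet (fun t => ∑ p, c p t ^ 2) 1 0 (∑ p, ζ p ^ 2) := by
    have h := jet_hessian_form (H := fun p q _ => if p = q then 1 else 0) (lam := 1)
      (X := 0) (Y := 0) (fun p q => Jet.const _) (fun p q => rfl) o hζo
    refine (h.cast rfl rfl (by simp)).congr (Eventually.of_forall fun t => ?_)
    simp [hc, pow_two]
  have jg := jet_gradient_sq hΩ hu hx e hdiag i
  have jΦ := (((jw.log_of_pos hw).add (jH.log_of_pos hlo)).add (jg.const_mul (N / 2))).sub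
    (jS.log_of_pos one_pos)
  have hline : Tendsto (fun t : ℝ => x + t • e i) (𝓝 0) (𝓝 x) := by
    have : Continuous fun t : ℝ => x + t • e i := by fun_prop
    simpa using this.tendsto 0
  obtain ⟨hb, hcc⟩ := jΦ.eq_zero_and_nonpos (by
    rw [jΦ.eval_zero]
    filter_upwards [hline.eventually hmax, hline.eventually (hΩ.mem_nhds hx),
      jw.tendsto.eventually_const_lt hw, jH.tendsto.eventually_const_lt hlo,
      jS.tendsto.eventually_const_lt one_pos] with t h1 h2 h3 h4 h5
    have h6 := h1 (∑ p, c p t • e p)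
    rw [hessian_form_sum hΩ hu2 h2, norm_sum_smul_sq] at h6
    have h7 := Real.log_le_log (mul_pos (mul_pos h3 h4) (Real.exp_pos _)) h6
    rw [Real.log_mul (mul_pos h3 h4).ne' (Real.exp_pos _).ne', Real.log_mul h3.ne' h4.ne',
      Real.log_mul (mul_pos (mul_pos hw hlo) (Real.exp_pos _)).ne' h5.ne',
      Real.log_mul (mul_pos hw hlo).ne' (Real.exp_pos _).ne', Real.log_mul hw.ne' hlo.ne',
      Real.log_exp, Real.log_exp] at h7
    rw [Real.log_one]
    linarith)
  have hTo : T o o / lam o = dd (e i) u x / w - N * dd (e i) u x * lam i := by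
    have : T o o / lam o = dd (e i) u x / w - N * dd (e i) u x * lam i +
      (-dd (e i) u x / w + T o o / lam o + N / 2 * (2 * dd (e i) u x * lam i) - 0 / 1) := by ring
    rw [this, hb, add_zero]
  refine ⟨?_, ?_⟩
  · rw [← hTo, mul_div_cancel₀ _ hlo.ne']
  rw [← hTo]
  have h4 := dd_four_comm hu hΩ hx (e i) (e o)
  have hsum : ∑ q, ζ q * T o q = lam o * ∑ q, ζ q ^ 2 := by
    rw [mul_sum]
    refine sum_congr rfl fun q _ => ?_
    by_cases hq : q = o
    · simp [hq, hζo]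
    · simp only [hζ, if_neg hq]; field_simp
  have hsum2 : -(lam o / 2) * ∑ q, ζ q ^ 2 ≤ ∑ q, ζ q ^ 2 * lam q := by
    rw [mul_sum]
    exact sum_le_sum fun q _ => by nlinarith [hlow q, sq_nonneg (ζ q)]
  have hone : (if i = o then 0 else dd (e o) (dd (e i) (dd (e i) u)) x ^ 2 / lam o ^ 2) ≤
      ∑ q, ζ q ^ 2 := by
    refine le_trans (le_of_eq ?_) (single_le_sum (fun q _ => sq_nonneg (ζ q)) (mem_univ i))
    by_cases hio : i = o
    · simp [hio, hζo]
    · simp only [hζ, if_neg hio, div_pow, hT]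
      rw [dd_comm ((hdu (e i)).of_le (by norm_num)) hΩ hx (e i) (e o)]
  rw [hsum, h4] at hcc
  have h8 : (dd (e o) (dd (e o) (dd (e i) (dd (e i) u))) x / 2 + 2 * (lam o * ∑ q, ζ q ^ 2) +
      ∑ p, ζ p ^ 2 * lam p) / lam o ≥
      dd (e o) (dd (e o) (dd (e i) (dd (e i) u))) x / lam o / 2 + 3 / 2 * ∑ q, ζ q ^ 2 := by
    rw [ge_iff_le, le_div_iff₀ hlo]
    have : dd (e o) (dd (e o) (dd (e i) (dd (e i) u))) x / lam o * lam o =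
      dd (e o) (dd (e o) (dd (e i) (dd (e i) u))) x := div_mul_cancel₀ _ hlo.ne'
    nlinarith
  have e1 : (-dd (e i) u x) ^ 2 / (2 * w ^ 2) = dd (e i) u x ^ 2 / w ^ 2 / 2 := by
    rw [neg_sq]; field_simp
  have e2 : T o o ^ 2 / (2 * lam o ^ 2) = (T o o / lam o) ^ 2 / 2 := by
    rw [div_pow]; field_simp
  have e3 : -lam i / 2 / w = -lam i / w / 2 := by ring
  rw [e1, e2, e3] at hcc
  linarith

end SumHessian

/-! ### Diagonalisation of the Hessian and the differentiated equation. -/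

namespace SumHessian

open Finset Polynomial Filter Topology

variable {n : ℕ}

theorem hessian_form_eq_dotProduct (u : E n → ℝ) (x v w : E n) :
    fderiv ℝ (fderiv ℝ u) x v w = (v : Fin n → ℝ) ⬝ᵥ (hessian u x).mulVec (w : Fin n → ℝ) := by
  have h : ∀ z : E n, z = ∑ i, z i • (EuclideanSpace.single i (1 : ℝ) : E n) := fun z => by
    have := (EuclideanSpace.basisFun (Fin n) ℝ).sum_repr z
    simpa using this.symm
  conv_lhs => rw [h v, h w]
  simp only [map_sum, map_smul, _root_.sum_apply, smul_apply, smul_eq_mul, dotProduct,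
    Matrix.mulVec, hessian, Matrix.of_apply, mul_sum]
  rw [sum_comm]
  exact sum_congr rfl fun p _ => sum_congr rfl fun q _ => by ring

/-- An orthonormal basis that diagonalizes the Hessian at a point. -/
theorem exists_orthonormalBasis_hessian {u : E n → ℝ} {Ω : Set (E n)} (hΩ : IsOpen Ω)
    (hu : ContDiffOn ℝ 2 u Ω) {x : E n} (hx : x ∈ Ω) :
    ∃ e : OrthonormalBasis (Fin n) ℝ (E n), ∀ i j,
      dd (e i) (dd (e j) u) x = if i = j then hessianEigenvalues u x i else 0 := by
  have h := hessian_isHermitian (hu.contDiffAt (hΩ.mem_nhds hx))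
  refine ⟨h.eigenvectorBasis, fun i j => ?_⟩
  have hon : ((h.eigenvectorBasis i : E n) : Fin n → ℝ) ⬝ᵥ
      ((h.eigenvectorBasis j : E n) : Fin n → ℝ) = if i = j then 1 else 0 := by
    have := orthonormal_iff_ite.1 h.eigenvectorBasis.orthonormal i j
    rw [← this, EuclideanSpace.inner_eq_star_dotProduct, dotProduct_comm]
    simp
  rw [dd_dd_eq hu hΩ hx, hessian_form_eq_dotProduct, h.mulVec_eigenvectorBasis,
    dotProduct_smul, hon, hessianEigenvalues, dif_pos h]
  by_cases hij : i = j
  · simp [hij]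
  · simp [hij]

/-- Orthogonal change of basis. It allows the basis to stay fixed along a line while the
eigenvectors vary, which is the determinant hypothesis of `jet_es_eigenvalues`. -/
theorem det_one_add_smul_hessian {u : E n → ℝ} {Ω : Set (E n)} (hΩ : IsOpen Ω)
    (hu : ContDiffOn ℝ 2 u Ω) {x : E n} (hx : x ∈ Ω) (e : OrthonormalBasis (Fin n) ℝ (E n))
    (z : ℝ) : (1 + z • (Matrix.of fun a b => dd (e a) (dd (e b) u) x)).det =
      ∏ i, (1 + z * hessianEigenvalues u x i) := by
  obtain ⟨e', he'⟩ := exists_orthonormalBasis_hessian hΩ hu hx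
  set Q : Matrix (Fin n) (Fin n) ℝ := Matrix.of fun p a => inner ℝ (e' p) (e a) with hQ
  have hQQ : Q.transpose * Q = 1 := by
    ext a b
    rw [Matrix.mul_apply, Matrix.one_apply, ← orthonormal_iff_ite.1 e.orthonormal a b,
      ← e'.sum_inner_mul_inner]
    exact sum_congr rfl fun p _ => by simp [hQ, real_inner_comm]
  have hA : (Matrix.of fun a b => dd (e a) (dd (e b) u) x) =
      Q.transpose * Matrix.diagonal (hessianEigenvalues u x) * Q := by
    ext a b
    have ha : ∀ a, e a = ∑ p, Q p a • e' p := fun a => by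
      conv_lhs => rw [← e'.sum_repr (e a)]
      exact sum_congr rfl fun p _ => by rw [e'.repr_apply_apply]; rfl
    rw [Matrix.of_apply, dd_dd_eq hu hΩ hx, Matrix.mul_apply]
    conv_lhs => rw [ha a, ha b]
    simp only [map_sum, map_smul, _root_.sum_apply, smul_apply, smul_eq_mul,
      ← dd_dd_eq hu hΩ hx, he', Matrix.mul_diagonal, Matrix.transpose_apply]
    exact sum_congr rfl fun p _ => by simp; ring
  have hfac : 1 + z • (Matrix.of fun a b => dd (e a) (dd (e b) u) x) =
      Q.transpose * (1 + z • Matrix.diagonal (hessianEigenvalues u x)) * Q := by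
    rw [hA, Matrix.mul_add, Matrix.add_mul, Matrix.mul_one, hQQ]
    simp [Matrix.mul_assoc]
  have hd : (1 + z • Matrix.diagonal (hessianEigenvalues u x) : Matrix (Fin n) (Fin n) ℝ) =
      Matrix.diagonal fun i => 1 + z * hessianEigenvalues u x i := by
    rw [← Matrix.diagonal_one, ← Matrix.diagonal_smul, Matrix.diagonal_add]
    rfl
  have hdet : Q.transpose.det * Q.det = 1 := by rw [← Matrix.det_mul, hQQ, Matrix.det_one]
  rw [hfac, hd, Matrix.det_mul, Matrix.det_mul, Matrix.det_diagonal, mul_right_comm, hdet, one_mul]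

theorem laplacian_eq_sum_eigenvalues {u : E n → ℝ} {Ω : Set (E n)} (hΩ : IsOpen Ω)
    (hu : ContDiffOn ℝ 2 u Ω) {x : E n} (hx : x ∈ Ω) :
    Laplacian.laplacian u x = ∑ i, hessianEigenvalues u x i := by
  obtain ⟨e, he⟩ := exists_orthonormalBasis_hessian hΩ hu hx
  rw [InnerProductSpace.laplacian_eq_iteratedFDeriv_orthonormalBasis u e]
  refine sum_congr rfl fun i _ => ?_
  rw [iteratedFDeriv_two_apply]
  simp [← dd_dd_eq hu hΩ hx, he]

theorem hessian_form_le {u : E n → ℝ} {Ω : Set (E n)} (hΩ : IsOpen Ω)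
    (hu : ContDiffOn ℝ 2 u Ω) {x : E n} (hx : x ∈ Ω) {o : Fin n}
    (ho : ∀ i, hessianEigenvalues u x i ≤ hessianEigenvalues u x o) (v : E n) :
    fderiv ℝ (fderiv ℝ u) x v v ≤ hessianEigenvalues u x o * ‖v‖ ^ 2 := by
  obtain ⟨e, he⟩ := exists_orthonormalBasis_hessian hΩ hu hx
  rw [← e.sum_repr v, hessian_form_sum hΩ hu hx, norm_sum_smul_sq, mul_sum]
  refine sum_le_sum fun p _ => ?_
  simp only [he, mul_ite, mul_zero, sum_ite_eq, mem_univ, if_true]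
  nlinarith [ho p, sq_nonneg (e.repr v p)]

/-- The equation `σ_{m+3} + α σ_{m+2} = f`, differentiated twice in the direction `e l`. -/
theorem differentiated_equation {m : ℕ} {α : ℝ} {f : E n × ℝ × E n → ℝ}
    {U : Set (E n × ℝ × E n)} (hU : IsOpen U) (hf : DifferentiableOn ℝ f U) {L : NNReal}
    (hL : LipschitzOnWith L (fderiv ℝ f) U) {u : E n → ℝ} {Ω : Set (E n)} (hΩ : IsOpen Ω)
    (hu : ContDiffOn ℝ 4 u Ω)
    (heq : ∀ y ∈ Ω, sh α univ (m + 2) (hessianEigenvalues u y) = f (y, u y, gradient u y))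
    {x : E n} (hx : x ∈ Ω) (hxU : (x, u x, gradient u x) ∈ U)
    {e : OrthonormalBasis (Fin n) ℝ (E n)} {lam : Fin n → ℝ}
    (he : ∀ i j, dd (e i) (dd (e j) u) x = if i = j then lam i else 0)
    (l : Fin n) :
    (∑ i, sh α (univ.erase i) (m + 1) lam * dd (e l) (dd (e i) (dd (e i) u)) x =
      (fderiv ℝ f (x, u x, gradient u x) (e l, 0, 0) +
        fderiv ℝ f (x, u x, gradient u x) (0, 1, 0) * dd (e l) u x) +
      fderiv ℝ f (x, u x, gradient u x) (0, 0, e l) * lam l) ∧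
    fderiv ℝ f (x, u x, gradient u x) (0, 1, 0) * lam l +
      ∑ p, fderiv ℝ f (x, u x, gradient u x) (0, 0, e p) * dd (e l) (dd (e l) (dd (e p) u)) x -
      2 * L * (1 + dd (e l) u x ^ 2 + lam l ^ 2) ≤
      ∑ i, sh α (univ.erase i) (m + 1) lam * dd (e l) (dd (e l) (dd (e i) (dd (e i) u))) x +
      ∑ i, ∑ j ∈ univ.erase i, sh α ((univ.erase i).erase j) m lam *
        (dd (e l) (dd (e i) (dd (e i) u)) x * dd (e l) (dd (e j) (dd (e j) u)) x -
          dd (e l) (dd (e i) (dd (e j) u)) x ^ 2) := by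
  have hu2 : ContDiffOn ℝ 2 u Ω := hu.of_le (by norm_num)
  have hline : Tendsto (fun t : ℝ => x + t • e l) (𝓝 0) (𝓝 x) := by
    have : Continuous fun t : ℝ => x + t • e l := by fun_prop
    simpa using this.tendsto 0
  have hev := hline.eventually (hΩ.mem_nhds hx)
  have hj := jet_sh_eigenvalues α m
    (A := fun t => Matrix.of fun a b => dd (e a) (dd (e b) u) (x + t • e l))
    (μ := fun t => hessianEigenvalues u (x + t • e l))
    (fun p q => (jet_line (contDiffOn_dd (n := 3) (m := 2)
      (contDiffOn_dd (n := 4) (m := 3) hu hΩ (by norm_num) (e q)) hΩ (by norm_num) (e p)) hΩ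
      hx (e l)).cast (he p q) rfl rfl)
    (by filter_upwards [hev] with t ht z using det_one_add_smul_hessian hΩ hu2 ht e z)
  have hj' := hj.congr (g := fun t => f (x + t • e l, u (x + t • e l), gradient u (x + t • e l)))
    (by filter_upwards [hev] with t ht using heq _ ht)
  obtain ⟨h1, h2⟩ := rhs_jet_bound hU hf hL hΩ hu hx hxU e l hj'
  refine ⟨?_, ?_⟩
  · rw [h1]
    simp [he]
  · rw [he l l, if_pos rfl] at h2
    have e1 : ∑ p : Fin n, dd (e l) (dd (e p) u) x ^ 2 = lam l ^ 2 := by simp [he]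
    rw [e1] at h2
    refine h2.trans (le_of_eq ?_)
    rw [mul_add, mul_sum, ← mul_assoc]
    congr 1
    · exact sum_congr rfl fun i _ => by ring
    · rw [show (2 : ℝ) * (1 / 2) = 1 by norm_num, one_mul]
      refine sum_congr rfl fun i _ => sum_congr rfl fun j _ => ?_
      rw [dd_congr hΩ (fun y hy => dd_comm hu2 hΩ hy (e j) (e i)) hx (e l), pow_two]

end SumHessian

/-! ### The bound at a maximum point. -/

namespace SumHessian

open Finset Polynomial Filter Topology

variable {n : ℕ}

theorem garding_of_mem_gardingCone {k : ℕ} {x : Fin n → ℝ} (hx : x ∈ gardingCone n k) :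
    Garding univ k x := by
  intro m hm
  rcases Nat.eq_zero_or_pos m with rfl | h
  · rw [es_zero]; exact one_pos
  · exact hx m h hm

/-- The bounds on the first derivatives of the right-hand side entering the maximum argument. -/
theorem abs_gradient_pairing_le {T : E n × ℝ × E n →L[ℝ] ℝ} {B M : ℝ} (hT : ‖T‖ ≤ B)
    {u : E n → ℝ} {x : E n} (hg : ‖gradient u x‖ ≤ M)
    (e : OrthonormalBasis (Fin n) ℝ (E n)) :
    (∀ i, dd (e i) u x ^ 2 ≤ M ^ 2) ∧ |T (0, 1, 0)| ≤ B ∧ (∀ i, |T (0, 0, e i)| ≤ B) ∧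
    (∀ i, |T (e i, 0, 0) + T (0, 1, 0) * dd (e i) u x| ≤ B + B * M) ∧
    |∑ l, dd (e l) u x * T (0, 0, e l)| ≤ B * M ∧
    |∑ l, dd (e l) u x * (T (e l, 0, 0) + T (0, 1, 0) * dd (e l) u x)| ≤ B * M + B * M ^ 2 := by
  have hB : 0 ≤ B := (norm_nonneg T).trans hT
  have key : ∀ v, |T v| ≤ B * ‖v‖ := fun v =>
    (T.le_opNorm v).trans (mul_le_mul_of_nonneg_right hT (norm_nonneg v))
  have hu : ∀ i, |dd (e i) u x| ≤ M := fun i => by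
    rw [dd_eq_inner]
    refine (abs_real_inner_le_norm _ _).trans ?_
    rw [e.norm_eq_one, one_mul]
    exact hg
  have h1 : ∀ v : E n, ‖((v, 0, 0) : E n × ℝ × E n)‖ = ‖v‖ := fun v => by simp [Prod.norm_def]
  have h2 : ∀ v : E n, ‖((0, 0, v) : E n × ℝ × E n)‖ = ‖v‖ := fun v => by simp [Prod.norm_def]
  have h3 : ‖((0, 1, 0) : E n × ℝ × E n)‖ = 1 := by simp [Prod.norm_def]
  have hz : |T (0, 1, 0)| ≤ B := by simpa [h3] using key (0, 1, 0)
  have hs1 : ∑ l, dd (e l) u x * T (0, 0, e l) = T (0, 0, gradient u x) := by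
    have : ((0, 0, gradient u x) : E n × ℝ × E n) =
        ∑ l, dd (e l) u x • ((0, 0, e l) : E n × ℝ × E n) := by
      rw [gradient_eq_sum e u x]
      refine Prod.ext ?_ (Prod.ext ?_ ?_)
      · simp [Prod.fst_sum]
      · simp [Prod.snd_sum, Prod.fst_sum]
      · simp [Prod.snd_sum]
    rw [this, map_sum]
    simp only [map_smul, smul_eq_mul]
  have hs2 : ∑ l, dd (e l) u x * T (e l, 0, 0) = T (gradient u x, 0, 0) := by
    have : ((gradient u x, 0, 0) : E n × ℝ × E n) =
        ∑ l, dd (e l) u x • ((e l, 0, 0) : E n × ℝ × E n) := by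
      rw [gradient_eq_sum e u x]
      refine Prod.ext ?_ (Prod.ext ?_ ?_)
      · simp [Prod.fst_sum]
      · simp [Prod.snd_sum]
      · simp [Prod.snd_sum]
    rw [this, map_sum]
    simp only [map_smul, smul_eq_mul]
  refine ⟨fun i => sq_le_sq' (abs_le.1 (hu i)).1 (abs_le.1 (hu i)).2, hz, fun i => ?_,
    fun i => ?_, ?_, ?_⟩
  · simpa [h2] using key (0, 0, e i)
  · refine (abs_add_le _ _).trans (add_le_add ?_ ?_)
    · simpa [h1] using key (e i, 0, 0)
    · rw [abs_mul]; exact mul_le_mul hz (hu i) (abs_nonneg _) hB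
  · rw [hs1]
    refine (key _).trans ?_
    rw [h2]; gcongr
  · have : ∑ l, dd (e l) u x * (T (e l, 0, 0) + T (0, 1, 0) * dd (e l) u x) =
        T (gradient u x, 0, 0) + T (0, 1, 0) * ‖gradient u x‖ ^ 2 := by
      rw [norm_gradient_sq e, ← hs2, mul_sum, ← sum_add_distrib]
      exact sum_congr rfl fun l _ => by ring
    rw [this]
    refine (abs_add_le _ _).trans (add_le_add ?_ ?_)
    · refine (key _).trans ?_
      rw [h1]; gcongr
    · rw [abs_mul, abs_of_nonneg (sq_nonneg ‖gradient u x‖)]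
      gcongr

/-- Brings the errors of the twice differentiated equation into the form `K (1 + λ_o)²`. -/
theorem linear_add_quadratic_le {B L M l a : ℝ} (hB : 0 ≤ B) (hL : 0 ≤ L) (hM : 0 ≤ M)
    (hl : 0 ≤ l) (ha : a ≤ M ^ 2) :
    B * l + 2 * L * (1 + a + l ^ 2) ≤ (B + 2 * L + 1) * (1 + M) ^ 2 * (1 + l) ^ 2 := by
  have h0 : (1 + M ^ 2) * (1 + l ^ 2) ≤ (1 + M) ^ 2 * (1 + l) ^ 2 := by
    apply mul_le_mul _ _ (by positivity) (by positivity) <;> nlinarith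
  have h1 : 1 + a + l ^ 2 ≤ (1 + M) ^ 2 * (1 + l) ^ 2 := by
    nlinarith [mul_nonneg (sq_nonneg M) (sq_nonneg l)]
  have h2 : l ≤ (1 + M) ^ 2 * (1 + l) ^ 2 := by
    calc l ≤ 1 * (1 + l) ^ 2 := by nlinarith
      _ ≤ (1 + M) ^ 2 * (1 + l) ^ 2 := by gcongr; nlinarith
  have h3 := mul_le_mul_of_nonneg_left h1 (by positivity : 0 ≤ 2 * L)
  have h4 := mul_le_mul_of_nonneg_left h2 hB
  have h5 : 0 ≤ (1 + M) ^ 2 * (1 + l) ^ 2 := by positivity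
  linarith

theorem exists_bound_at_maximum (m : ℕ) {α c₀ C₀ B M₀ M₁ : ℝ} (hα : 0 < α) (hc₀ : 0 < c₀)
    (hC₀ : 0 < C₀) (hB : 0 ≤ B) (hM₁ : 0 ≤ M₁) {f : E n × ℝ × E n → ℝ}
    {U : Set (E n × ℝ × E n)} (hU : IsOpen U) (hf : DifferentiableOn ℝ f U) {L : NNReal}
    (hL : LipschitzOnWith L (fderiv ℝ f) U) (hfB : ∀ y ∈ U, ‖fderiv ℝ f y‖ ≤ B)
    {Ω : Set (E n)} (hΩ : IsOpen Ω) :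
    ∃ N > 0, ∃ R > 0, ∀ (u : E n → ℝ) (x : E n) (ε : ℝ) (o : Fin n), ContDiffOn ℝ 4 u Ω →
      hessianEigenvalues u x ∈ gardingCone n (m + 3) →
      (∀ y ∈ Ω, sh α univ (m + 2) (hessianEigenvalues u y) = f (y, u y, gradient u y)) →
      x ∈ Ω → (x, u x, gradient u x) ∈ U → c₀ ≤ f (x, u x, gradient u x) →
      f (x, u x, gradient u x) ≤ C₀ → ‖gradient u x‖ ≤ M₁ → 0 < -u x - ε → -u x - ε ≤ M₀ →
      (∀ i, hessianEigenvalues u x i ≤ hessianEigenvalues u x o) →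
      (∀ᶠ y in 𝓝 x, ∀ v, (-u y - ε) * fderiv ℝ (fderiv ℝ u) y v v *
        Real.exp (N / 2 * ‖gradient u y‖ ^ 2) ≤ (-u x - ε) * hessianEigenvalues u x o *
          Real.exp (N / 2 * ‖gradient u x‖ ^ 2) * ‖v‖ ^ 2) →
      (-u x - ε) * hessianEigenvalues u x o ≤ R := by
  obtain ⟨c, C, hc, hC, hspec⟩ :=
    Garding.exists_spectral_bounds (ι := Fin n) m hα hc₀ hC₀
  set K : ℝ := (B + 2 * L + 1) * (1 + M₁) ^ 2 with hK
  have hL0 : (0 : ℝ) ≤ L := L.2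
  have hK0 : 0 < K := by positivity
  obtain ⟨N, hN, δ, hδ, R, hR, hbound⟩ :=
    exists_bound_of_maximum (ι := Fin n) (W := M₀) hc hC hK0 hc₀
  -- The order of choice matters: `c` and `C` determine `N` and `δ`, and only then is the threshold
  -- `Λ` fixed. Below it the product is at most `|M₀| * Λ`.
  obtain ⟨Λ, hΛ, hspec⟩ := hspec δ hδ
  refine ⟨N, hN, R + |M₀| * Λ, by positivity, ?_⟩
  intro u x ε o hu hG heq hx hxU hfc hfC hgr hw hwM hmaxo hmax
  set lam := hessianEigenvalues u x with hlam
  set w := -u x - ε with hwdef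
  have hwM' : w ≤ |M₀| := hwM.trans (le_abs_self _)
  rcases lt_or_ge (lam o) Λ with hlt | hge
  · have : w * lam o ≤ |M₀| * Λ :=
      (mul_le_mul_of_nonneg_left hlt.le hw.le).trans
        (mul_le_mul_of_nonneg_right hwM' (by linarith))
    linarith
  have hl1 : 1 ≤ lam o := hΛ.trans hge
  have hG' := garding_of_mem_gardingCone hG
  have hFeq := heq x hx
  rw [← hlam] at hFeq
  obtain ⟨s1, s2, s3, s4, s5, s6, s7⟩ := hspec lam o hG' hmaxo (hFeq ▸ hfc) (hFeq ▸ hfC) hge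
  have hu2 : ContDiffOn ℝ 2 u Ω := hu.of_le (by norm_num)
  have hdu : ∀ v, ContDiffOn ℝ 2 (dd v u) Ω := fun v =>
    contDiffOn_dd (n := 4) (m := 2) hu hΩ (by norm_num) v
  obtain ⟨e, he⟩ := exists_orthonormalBasis_hessian hΩ hu2 hx
  rw [← hlam] at he
  obtain ⟨p1, p2, p3, p4, p5, p6⟩ :=
    abs_gradient_pairing_le (hfB _ hxU) hgr e
  have hmc := maximum_conditions hΩ hu hx e he (by linarith) s5 hw hmax
  have hde := fun l => differentiated_equation hU hf hL hΩ hu heq hx hxU he l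
  set T := fderiv ℝ f (x, u x, gradient u x) with hT
  have hKB : B * (1 + M₁) ^ 2 ≤ K := by
    rw [hK]; gcongr; linarith
  have hKM : (1 + M₁) ^ 2 ≤ K := by
    rw [hK]; exact le_mul_of_one_le_left (by positivity) (by linarith)
  have hBM : 0 ≤ B * M₁ := by positivity
  have hBM2 : 0 ≤ B * M₁ ^ 2 := by positivity
  refine (hbound o lam (fun i => sh α (univ.erase i) (m + 1) lam)
    (fun j => sh α ((univ.erase o).erase j) (m + 1) lam) (fun i => dd (e i) u x)
    (fun i => T (e i, 0, 0) + T (0, 1, 0) * dd (e i) u x) (fun i => T (0, 0, e i))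
    (fun i => dd (e o) (dd (e o) (dd (e i) (dd (e i) u))) x)
    (fun i j => sh α ((univ.erase i).erase j) m lam)
    (fun i j k => dd (e i) (dd (e j) (dd (e k) u)) x) (sh α univ (m + 2) lam) w hw hwM hl1
    (fun i => (hG'.erase i).sh_pos hα.le)
    (fun i j _ => (((hG'.erase i).erase j).sh_pos hα.le).le)
    (fun i j => by rw [erase_right_comm]) (hFeq ▸ hfc) s1 s2 s3 s4 (fun j hj => ?_) s6
    (s7 fun i => dd (e o) (dd (e i) (dd (e i) u)) x)
    (fun i j k => dd_comm (hdu (e k)) hΩ hx (e i) (e j))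
    (fun i j k => dd_congr hΩ (fun y hy => dd_comm hu2 hΩ hy (e j) (e k)) hx (e i))
    (fun i => (hmc i).1) (fun i => (hmc i).2) (fun l => (hde l).1) ?_
    (fun i => ?_) ?_ ?_ ?_ ?_).trans (le_add_of_nonneg_right (by positivity))
  · have h1 := sh_erase α (mem_erase.2 ⟨hj.symm, mem_univ o⟩ : o ∈ univ.erase j) m lam
    rw [erase_right_comm (a := j)] at h1
    linarith
  · refine le_trans ?_ (hde o).2
    have h1 : -(B * lam o) ≤ T (0, 1, 0) * lam o := by
      have := mul_le_mul_of_nonneg_right (abs_le.1 p2).1 (by linarith : 0 ≤ lam o)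
      linarith
    have h2 := linear_add_quadratic_le hB hL0 hM₁ (by linarith : 0 ≤ lam o) (p1 o)
    beta_reduce
    rw [hK]
    generalize ∑ p, T (0, 0, e p) * dd (e o) (dd (e o) (dd (e p) u)) x = S
    linarith
  · have := p1 i
    nlinarith
  · refine p5.trans (le_trans ?_ hKB)
    nlinarith
  · refine p6.trans (le_trans ?_ hKB)
    nlinarith
  · refine (p4 o).trans (le_trans ?_ hKB)
    nlinarith
  · refine (p3 o).trans (le_trans ?_ hKB)
    nlinarith

end SumHessian

/-! ### The auxiliary function and the limit `ε → 0`. -/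

namespace SumHessian

open Finset Polynomial Filter Topology

variable {n : ℕ}

theorem norm_gradient_eq (u : E n → ℝ) (x : E n) : ‖gradient u x‖ = ‖fderiv ℝ u x‖ := by
  unfold gradient
  rw [LinearIsometryEquiv.norm_map]

/-- On bounded sets of values, a positive `C^{1,1}` right-hand side is bounded between positive
constants and has bounded, Lipschitz continuous derivatives. -/
theorem exists_rhs_bounds {Ω : Set (E n)} (hΩo : IsOpen Ω) (hΩn : Ω.Nonempty)
    (hΩb : Bornology.IsBounded Ω) {f : E n × ℝ × E n → ℝ}
    (hf : IsC11UpToBoundary (Ω ×ˢ Set.univ) f)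
    (hfpos : ∀ x ∈ closure Ω, ∀ (z : ℝ) (p : E n), 0 < f (x, z, p)) (M₀ M₁ : ℝ) :
    ∃ (U : Set (E n × ℝ × E n)) (L : NNReal) (B c₀ C₀ : ℝ), IsOpen U ∧ DifferentiableOn ℝ f U ∧
      LipschitzOnWith L (fderiv ℝ f) U ∧ 0 ≤ B ∧ (∀ y ∈ U, ‖fderiv ℝ f y‖ ≤ B) ∧ 0 < c₀ ∧
      0 < C₀ ∧ ∀ x ∈ Ω, ∀ (z : ℝ) (p : E n), |z| ≤ M₀ → ‖p‖ ≤ M₁ →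
        (x, z, p) ∈ U ∧ c₀ ≤ f (x, z, p) ∧ f (x, z, p) ≤ C₀ := by
  obtain ⟨hcont, hdiff, hlip⟩ := hf
  -- The added `1` lets open balls contain every value allowed by the non-strict bounds.
  set r₀ : ℝ := |M₀| + 1 with hr₀
  set r₁ : ℝ := |M₁| + 1 with hr₁
  have h0 : 0 < r₀ := by positivity
  have h1 : 0 < r₁ := by positivity
  set U : Set (E n × ℝ × E n) := Ω ×ˢ (Metric.ball 0 r₀ ×ˢ Metric.ball 0 r₁) with hU
  have hUo : IsOpen U := hΩo.prod (Metric.isOpen_ball.prod Metric.isOpen_ball)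
  have hUb : Bornology.IsBounded U :=
    hΩb.prod (Metric.isBounded_ball.prod Metric.isBounded_ball)
  have hUΩ : U ⊆ Ω ×ˢ Set.univ := Set.prod_mono le_rfl (Set.subset_univ _)
  obtain ⟨L, hL⟩ := hlip U hUb
  rw [Set.inter_eq_right.2 hUΩ] at hL
  obtain ⟨x₀, hx₀⟩ := hΩn
  have hy₀ : (x₀, (0 : ℝ), (0 : E n)) ∈ U := ⟨hx₀, by simpa using h0, by simpa using h1⟩
  set Q : Set (E n × ℝ × E n) :=
    closure Ω ×ˢ (Metric.closedBall 0 r₀ ×ˢ Metric.closedBall 0 r₁) with hQ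
  have hQc : IsCompact Q := hΩb.isCompact_closure.prod
    ((isCompact_closedBall _ _).prod (isCompact_closedBall _ _))
  have hUQ : U ⊆ Q := Set.prod_mono subset_closure
    (Set.prod_mono Metric.ball_subset_closedBall Metric.ball_subset_closedBall)
  have hfQ : ContinuousOn f Q := hcont.mono (by
    rw [closure_prod_eq, closure_univ]
    exact Set.prod_mono le_rfl (Set.subset_univ _))
  have hQn : Q.Nonempty := ⟨_, hUQ hy₀⟩
  obtain ⟨a, haQ, ha⟩ := hQc.exists_isMinOn hQn hfQ
  obtain ⟨b, hbQ, hb⟩ := hQc.exists_isMaxOn hQn hfQ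
  refine ⟨U, L, ‖fderiv ℝ f (x₀, 0, 0)‖ + L * Metric.diam U, f a, f b, hUo,
    (hdiff.differentiableOn (by norm_num)).mono hUΩ, hL, ?_, fun y hy => ?_,
    hfpos _ haQ.1 _ _, hfpos _ hbQ.1 _ _, fun x hx z p hz hp => ?_⟩
  · exact add_nonneg (norm_nonneg _) (mul_nonneg L.2 Metric.diam_nonneg)
  · have h2 := hL.norm_sub_le hy hy₀
    have h3 : ‖y - (x₀, 0, 0)‖ ≤ Metric.diam U := by
      rw [← dist_eq_norm]; exact Metric.dist_le_diam_of_mem hUb hy hy₀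
    have h4 := norm_le_norm_add_norm_sub' (fderiv ℝ f y) (fderiv ℝ f (x₀, 0, 0))
    have h5 := mul_le_mul_of_nonneg_left h3 L.2
    exact h4.trans (add_le_add le_rfl (h2.trans h5))
  · have hm : (x, z, p) ∈ U := by
      refine ⟨hx, ?_, ?_⟩
      · rw [mem_ball_zero_iff, Real.norm_eq_abs]
        exact lt_of_le_of_lt (hz.trans (le_abs_self _)) (lt_add_one _)
      · rw [mem_ball_zero_iff]
        exact lt_of_le_of_lt (hp.trans (le_abs_self _)) (lt_add_one _)
    exact ⟨hm, ha (hUQ hm), hb (hUQ hm)⟩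

theorem exists_max_eigenvalue (u : E n → ℝ) (x : E n) (i₀ : Fin n) :
    ∃ o, ∀ i, hessianEigenvalues u x i ≤ hessianEigenvalues u x o := by
  obtain ⟨o, -, ho⟩ := exists_max_image univ (hessianEigenvalues u x) ⟨i₀, mem_univ _⟩
  exact ⟨o, fun i => ho i (mem_univ i)⟩

/-- The auxiliary function `(-u - ε) D²u(v, v) exp (N |Du|² / 2)`, over unit vectors `v`, attains
its maximum at an interior point in the direction of a top eigenvector. -/
theorem exists_maximum {Ω : Set (E n)} (hΩo : IsOpen Ω) (hΩb : Bornology.IsBounded Ω)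
    {u : E n → ℝ} (hu : ContDiffOn ℝ 2 u Ω) (hc : ContinuousOn u (closure Ω))
    (hbd : ∀ x ∈ frontier Ω, u x = 0) {x₁ : E n} (hx₁ : x₁ ∈ Ω) {i₁ : Fin n}
    (hi₁ : 0 < hessianEigenvalues u x₁ i₁) {ε : ℝ} (hε : 0 < ε) (hw₁ : 0 < -u x₁ - ε) (N : ℝ) :
    ∃ x ∈ Ω, ∃ o, 0 < -u x - ε ∧ (∀ i, hessianEigenvalues u x i ≤ hessianEigenvalues u x o) ∧
      ∀ y ∈ Ω, 0 < -u y - ε → ∀ v, (-u y - ε) * fderiv ℝ (fderiv ℝ u) y v v *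
        Real.exp (N / 2 * ‖gradient u y‖ ^ 2) ≤ (-u x - ε) * hessianEigenvalues u x o *
          Real.exp (N / 2 * ‖gradient u x‖ ^ 2) * ‖v‖ ^ 2 := by
  -- Second derivatives may blow up at the frontier. Since `u` vanishes there, the shift by `ε`
  -- confines the maximisation to a compact subset of `Ω`.
  set K : Set (E n) := closure Ω ∩ u ⁻¹' Set.Iic (-ε) with hK
  have hKc : IsCompact K := hΩb.isCompact_closure.of_isClosed_subset
    (hc.preimage_isClosed_of_isClosed isClosed_closure isClosed_Iic) Set.inter_subset_left
  have hKΩ : K ⊆ Ω := by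
    rintro y ⟨hy1, hy2⟩
    by_contra hy
    have : y ∈ frontier Ω := by rw [hΩo.frontier_eq]; exact ⟨hy1, hy⟩
    have h2 : u y ≤ -ε := hy2
    rw [hbd y this] at h2
    linarith
  have hKmem : ∀ y ∈ Ω, 0 < -u y - ε → y ∈ K := fun y hy h =>
    ⟨subset_closure hy, show u y ≤ -ε by linarith⟩
  set P : E n × E n → ℝ := fun q => (-u q.1 - ε) * fderiv ℝ (fderiv ℝ u) q.1 q.2 q.2 *
    Real.exp (N / 2 * ‖gradient u q.1‖ ^ 2) with hP
  have hf1 : ContDiffOn ℝ 1 (fderiv ℝ u) Ω := hu.fderiv_of_isOpen hΩo (by norm_num)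
  have hf2 : ContinuousOn (fderiv ℝ (fderiv ℝ u)) Ω :=
    (hf1.fderiv_of_isOpen (m := 0) hΩo (by norm_num)).continuousOn
  have hPc : ContinuousOn P (K ×ˢ Metric.sphere 0 1) := by
    have hfst : ContinuousOn (fun q : E n × E n => q.1) (K ×ˢ Metric.sphere 0 1) :=
      continuousOn_fst
    have hsnd : ContinuousOn (fun q : E n × E n => q.2) (K ×ˢ Metric.sphere 0 1) :=
      continuousOn_snd
    have hmaps : Set.MapsTo (fun q : E n × E n => q.1) (K ×ˢ Metric.sphere 0 1) Ω :=
      fun q hq => hKΩ hq.1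
    have c1 := hu.continuousOn.comp hfst hmaps
    have c2 := hf1.continuousOn.comp hfst hmaps
    have c3 := ((hf2.comp hfst hmaps).clm_apply hsnd).clm_apply hsnd
    simp only [hP, norm_gradient_eq]
    exact ((c1.neg.sub continuousOn_const).mul c3).mul
      (((c2.norm.pow 2).const_mul (N / 2)).rexp)
  obtain ⟨e₁, he₁⟩ := exists_orthonormalBasis_hessian hΩo hu hx₁
  have hq₁ : (x₁, e₁ i₁) ∈ K ×ˢ Metric.sphere (0 : E n) 1 :=
    ⟨hKmem x₁ hx₁ hw₁, by simp⟩
  obtain ⟨⟨x, v₀⟩, hq, hmax⟩ :=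
    (hKc.prod (isCompact_sphere (0 : E n) 1)).exists_isMaxOn ⟨_, hq₁⟩ hPc
  have hxΩ := hKΩ hq.1
  have hw : 0 ≤ -u x - ε := by
    have : u x ≤ -ε := hq.1.2
    linarith
  obtain ⟨o, ho⟩ := exists_max_eigenvalue u x i₁
  have hPpos : 0 < P (x, v₀) := by
    refine lt_of_lt_of_le ?_ (hmax hq₁)
    have : fderiv ℝ (fderiv ℝ u) x₁ (e₁ i₁) (e₁ i₁) = hessianEigenvalues u x₁ i₁ := by
      rw [← dd_dd_eq hu hΩo hx₁, he₁, if_pos rfl]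
    simp only [hP, this]
    positivity
  have hw' : 0 < -u x - ε := by
    refine lt_of_le_of_ne hw fun h => ?_
    simp only [hP, ← h, zero_mul, lt_irrefl] at hPpos
  have hle : P (x, v₀) ≤ (-u x - ε) * hessianEigenvalues u x o *
      Real.exp (N / 2 * ‖gradient u x‖ ^ 2) := by
    have h1 := hessian_form_le hΩo hu hxΩ ho v₀
    have h2 : ‖v₀‖ = 1 := by simpa using hq.2
    rw [h2, one_pow, mul_one] at h1
    simp only [hP]
    gcongr
  refine ⟨x, hxΩ, o, hw', ho, fun y hy hwy v => ?_⟩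
  rcases eq_or_ne v 0 with rfl | hv
  · simp
  have hv0 : 0 < ‖v‖ := norm_pos_iff.2 hv
  have h3 := (hmax (⟨hKmem y hy hwy, by simp [norm_smul, hv0.ne']⟩ :
    (y, ‖v‖⁻¹ • v) ∈ K ×ˢ Metric.sphere (0 : E n) 1)).trans hle
  simp only [hP, map_smul, smul_apply, smul_eq_mul] at h3
  have h4 := mul_le_mul_of_nonneg_right h3 (sq_nonneg ‖v‖)
  refine le_trans (le_of_eq ?_) h4
  field_simp

theorem laplacian_pos {k : ℕ} (hk : 1 ≤ k) {Ω : Set (E n)} (hΩo : IsOpen Ω) {u : E n → ℝ}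
    (hu : IsKConvexOn k Ω u) {x : E n} (hx : x ∈ Ω) : 0 < Laplacian.laplacian u x := by
  rw [laplacian_eq_sum_eigenvalues hΩo hu.1 hx, ← es_one]
  exact hu.2 x hx 1 le_rfl hk

/-- The estimate for `k ≥ 3`. -/
theorem exists_pogorelov_bound (m : ℕ) {Ω : Set (E n)} (hΩo : IsOpen Ω) (hΩn : Ω.Nonempty)
    (hΩb : Bornology.IsBounded Ω) {α : ℝ} (hα : 0 < α) {f : E n × ℝ × E n → ℝ}
    (hf : IsC11UpToBoundary (Ω ×ˢ Set.univ) f)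
    (hfpos : ∀ x ∈ closure Ω, ∀ (z : ℝ) (p : E n), 0 < f (x, z, p)) (M₀ M₁ : ℝ) :
    ∃ C : ℝ, 0 < C ∧ ∀ u : E n → ℝ, ContDiffOn ℝ 4 u Ω → ContinuousOn u (closure Ω) →
      IsKConvexOn (m + 3) Ω u → IsDirichletSolution (m + 3) α Ω f u → (∀ x ∈ Ω, |u x| ≤ M₀) →
      (∀ x ∈ Ω, ‖gradient u x‖ ≤ M₁) → ∀ x ∈ Ω, (-u x) * Laplacian.laplacian u x ≤ C := by
  obtain ⟨U, L, B, c₀, C₀, hU, hfd, hfL, hB, hfB, hc₀, hC₀, hfx⟩ :=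
    exists_rhs_bounds hΩo hΩn hΩb hf hfpos M₀ M₁
  obtain ⟨N, hN, R, hR, H⟩ := exists_bound_at_maximum (M₀ := M₀) m hα hc₀ hC₀ hB (abs_nonneg M₁)
    hU hfd hfL hfB hΩo
  set S : ℝ := R * Real.exp (N / 2 * |M₁| ^ 2) with hS
  have hS0 : 0 < S := by positivity
  refine ⟨n * S + 1, by positivity, fun u hu hc hkc hsol hu0 hu1 x hx => ?_⟩
  have hΔ := laplacian_pos (by omega) hΩo hkc hx
  have hsum := laplacian_eq_sum_eigenvalues hΩo hkc.1 hx
  obtain ⟨e, he⟩ := exists_orthonormalBasis_hessian hΩo hkc.1 hx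
  -- The constants `N`, `R`, `S` were fixed before `u` and `ε`, so the bound survives `ε → 0`.
  have key : ∀ ε > 0, 0 < -u x - ε → (-u x - ε) * Laplacian.laplacian u x ≤ n * S + 1 := by
    intro ε hε hw
    obtain ⟨i₁, -, hi₁⟩ : ∃ i ∈ univ, 0 < hessianEigenvalues u x i :=
      exists_lt_of_sum_lt (by rw [sum_const_zero, ← hsum]; exact hΔ)
    obtain ⟨y, hy, o, hwy, ho, hmax⟩ :=
      exists_maximum hΩo hΩb hkc.1 hc hsol.2 hx hi₁ hε hw N
    obtain ⟨hyU, hyc, hyC⟩ := hfx y hy (u y) (gradient u y) (hu0 y hy) (hu1 y hy)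
    have hcy : ContinuousAt u y := hc.continuousAt
      (Filter.mem_of_superset (hΩo.mem_nhds hy) subset_closure)
    have hyR : (-u y - ε) * hessianEigenvalues u y o ≤ R := by
      refine H u y ε o hu (hkc.2 y hy) hsol.1 hy hyU hyc hyC
        ((hu1 y hy).trans (le_abs_self _)) hwy ?_ ho ?_
      · have := neg_abs_le (u y)
        have := hu0 y hy
        linarith
      · have hc' : ContinuousAt (fun z => -u z - ε) y := hcy.neg.sub continuousAt_const
        filter_upwards [hΩo.mem_nhds hy, hc'.eventually (lt_mem_nhds hwy)] with z hz hwz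
        exact hmax z hz hwz
    have hbd : (-u y - ε) * hessianEigenvalues u y o *
        Real.exp (N / 2 * ‖gradient u y‖ ^ 2) ≤ S := by
      have : ‖gradient u y‖ ≤ |M₁| := (hu1 y hy).trans (le_abs_self _)
      rw [hS]; gcongr
    have hi : ∀ i, (-u x - ε) * hessianEigenvalues u x i ≤ S := fun i => by
      rcases le_or_gt (hessianEigenvalues u x i) 0 with h | h
      · exact (mul_nonpos_of_nonneg_of_nonpos hw.le h).trans hS0.le
      have h1 := hmax x hx hw (e i)
      rw [← dd_dd_eq hkc.1 hΩo hx, he, if_pos rfl, e.norm_eq_one, one_pow, mul_one] at h1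
      refine le_trans ?_ (h1.trans hbd)
      exact le_mul_of_one_le_right (mul_pos hw h).le (Real.one_le_exp (by positivity))
    rw [hsum, mul_sum]
    have := sum_le_card_nsmul univ _ S fun i _ => hi i
    simp only [card_univ, Fintype.card_fin, nsmul_eq_mul] at this
    linarith
  rcases le_or_gt (-u x) 0 with h | h
  · have := mul_nonpos_of_nonpos_of_nonneg h hΔ.le
    have : 0 ≤ (n : ℝ) * S := by positivity
    linarith
  · have hlim : Tendsto (fun ε : ℝ => (-u x - ε) * Laplacian.laplacian u x) (𝓝[>] 0)
        (𝓝 ((-u x) * Laplacian.laplacian u x)) := by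
      have : Continuous fun ε : ℝ => (-u x - ε) * Laplacian.laplacian u x := by fun_prop
      simpa using (this.tendsto 0).mono_left nhdsWithin_le_nhds
    refine le_of_tendsto hlim ?_
    filter_upwards [Ioo_mem_nhdsGT h] with ε hε
    exact key ε hε.1 (by linarith [hε.2])

end SumHessian

/-! ### The main estimate. -/

theorem theorem1p2 (n k : ℕ) (hk : 1 ≤ k) (hkn : k ≤ n)
    (Ω : Set (SumHessian.E n)) (hΩo : IsOpen Ω) (hΩc : IsConnected Ω)
    (hΩb : Bornology.IsBounded Ω) (α : ℝ) (hα : 0 < α)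
    (f : SumHessian.E n × ℝ × SumHessian.E n → ℝ)
    (hf : SumHessian.IsC11UpToBoundary (Ω ×ˢ Set.univ) f)
    (hfpos : ∀ x ∈ closure Ω, ∀ (z : ℝ) (p : SumHessian.E n), 0 < f (x, z, p))
    (M₀ M₁ : ℝ) :
    ∃ C : ℝ, 0 < C ∧ ∀ u : SumHessian.E n → ℝ,
      ContDiffOn ℝ 4 u Ω →
      (∃ L : NNReal, LipschitzOnWith L u (closure Ω)) →
      SumHessian.IsKConvexOn k Ω u →
      SumHessian.IsDirichletSolution k α Ω f u →
      (∀ x ∈ Ω, |u x| ≤ M₀) →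
      (∀ x ∈ Ω, ‖gradient u x‖ ≤ M₁) →
      ∀ x ∈ Ω, (-u x) * Laplacian.laplacian u x ≤ C := by
  have small : ∀ C₁ : ℝ, (∀ u : SumHessian.E n → ℝ, SumHessian.IsKConvexOn k Ω u →
      SumHessian.IsDirichletSolution k α Ω f u → (∀ x ∈ Ω, |u x| ≤ M₀) →
      (∀ x ∈ Ω, ‖gradient u x‖ ≤ M₁) → ∀ x ∈ Ω, Laplacian.laplacian u x ≤ C₁) →
      ∃ C : ℝ, 0 < C ∧ ∀ u : SumHessian.E n → ℝ, ContDiffOn ℝ 4 u Ω →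
        (∃ L : NNReal, LipschitzOnWith L u (closure Ω)) → SumHessian.IsKConvexOn k Ω u →
        SumHessian.IsDirichletSolution k α Ω f u → (∀ x ∈ Ω, |u x| ≤ M₀) →
        (∀ x ∈ Ω, ‖gradient u x‖ ≤ M₁) → ∀ x ∈ Ω, (-u x) * Laplacian.laplacian u x ≤ C := by
    refine fun C₁ h => ⟨|M₀| * |C₁| + 1, by positivity, fun u _ _ h2 h3 h4 h5 x hx => ?_⟩
    have e1 := SumHessian.laplacian_pos hk hΩo h2 hx
    have e2 : -u x ≤ |M₀| := (neg_le_abs _).trans ((h4 x hx).trans (le_abs_self _))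
    have e3 := (h u h2 h3 h4 h5 x hx).trans (le_abs_self C₁)
    have := mul_le_mul e2 e3 e1.le (abs_nonneg M₀)
    linarith
  obtain ⟨U, L, B, c₀, C₀, -, -, -, -, -, -, hC₀, hfx⟩ :=
    SumHessian.exists_rhs_bounds hΩo hΩc.nonempty hΩb hf hfpos M₀ M₁
  match k, hk with
  | 1, _ =>
    -- The equation is `Δu + α = f`.
    refine small C₀ fun u h2 h3 h4 h5 x hx => ?_
    have e1 := h3.1 x hx
    have e2 := (hfx x hx _ _ (h4 x hx) (h5 x hx)).2.2
    have e3 : SumHessian.sigma (1 - 1) (SumHessian.hessianEigenvalues u x) = 1 :=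
      SumHessian.es_zero _ _
    rw [SumHessian.laplacian_eq_sum_eigenvalues hΩo h2.1 hx, ← SumHessian.es_one]
    rw [e3] at e1
    change SumHessian.sigma 1 _ ≤ C₀
    linarith
  | 2, _ =>
    -- Positivity of `σ_2` leaves `α Δu ≤ f`.
    refine small (C₀ / α) fun u h2 h3 h4 h5 x hx => ?_
    have e1 := h3.1 x hx
    have e2 := (hfx x hx _ _ (h4 x hx) (h5 x hx)).2.2
    have e3 := h2.2 x hx 2 (by norm_num) le_rfl
    rw [SumHessian.laplacian_eq_sum_eigenvalues hΩo h2.1 hx, ← SumHessian.es_one,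
      le_div_iff₀ hα, mul_comm]
    change α * SumHessian.sigma (2 - 1) _ ≤ C₀
    linarith
  | m + 3, _ =>
    obtain ⟨C, hC, H⟩ :=
      SumHessian.exists_pogorelov_bound m hΩo hΩc.nonempty hΩb hα hf hfpos M₀ M₁
    exact ⟨C, hC, fun u h1 ⟨_, hL⟩ h2 h3 h4 h5 x hx =>
      H u h1 hL.continuousOn h2 h3 h4 h5 x hx⟩
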